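/- Throughout, $k$ is a field, algebras are associative unital $k$-algebras, bimodules are $k$-central, and noetherian means left and right noetherian. All equivalences below between categories $\mathbb{P}^{nc}$ are $k$-linear. **Definitions.** Let $R,S$ be noetherian $k$-algebras and $N$ an $R$-$S$-bimodule. The right dual $N^*=\operatorname{Hom}_S(N_S,S)$ and the left dual ${}^*N=\operatorname{Hom}_R({}_RN,R)$ are $S$-$R$-bimodules via $(a\cdot\psi\cdot b)(n)=a\,\psi(bn)$ and $(a\cdot\phi\cdot b)(n)=\phi(na)\,b$. Put $N^{0*}=N$, $N^{i*}=(N^{(i-1)*})^*$ for $i>0$ and $N^{i*}={}^*(N^{(i+1)*})$ for $i<0$; so $N^{i*}$ is an $F_i$-$F_{i+1}$-bimodule, where $F_i=R$ for $i$ even and $F_i=S$ for $i$ odd. $N$ is *admissible* if $N^{i*}$ is finitely generated projective on each side for all $i\in\mathbb{Z}$. Let $N$ be admissible. Then $(-\otimes_{F_i}N^{i*},\,-\otimes_{F_{i+1}}N^{(i+1)*})$ is an adjoint pair for every $i$; let $Q_i\subseteq N^{i*}\otimes_{F_{i+1}}N^{(i+1)*}$ be the image of $F_i$ under its unit. The noncommutative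 symmetric algebra $\mathbb{S}^{nc}(N)$ is the $\mathbb{Z}$-algebra $\bigoplus_{i,j\in\mathbb{Z}}A_{ij}$ with $A_{ij}=0$ for $i>j$, $A_{ii}=F_i$, and, for $i<j$, $$A_{ij}=T_{ij}/R_{ij},\qquad T_{ij}=N^{i*}\otimes\cdots\otimes N^{(j-1)*},\qquad R_{ij}=\sum_{l=i}^{j-2}T_{il}\otimes Q_l\otimes T_{l+2,j}\subseteq T_{ij}$$ (with $T_{ii}=F_i$; in particular $A_{i,i+1}=N^{i*}$), the multiplication being induced by concatenation of tensors and by the scalar actions. $\mathbb{P}^{nc}(N)$ is the quotient of the category of graded right $\mathbb{S}^{nc}(N)$-modules by the full subcategory of direct limits of right bounded modules, where a graded module $M$ is right bounded if $M_i=0$ for all $i\gg 0$. **Proposition.** Let $R,R',S,S'$ be noetherian $k$-algebras and let $N$ be an admissible $R$-$S$-bimodule. 1. If $L$ is an $S$-$S'$-bimodule such that $-\otimes_SL:\mathsf{Mod}\,S\to\mathsf{Mod}\,S'$ is an equivalence between the categories of right modules, then $N\otimes_SL$ is admissible and there is an equivalence $\mathbb{P}^{nc}(N)\to\mathbb{P}^{nc}(N\otimes_SL)$.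 2. If $P$ is an $R'$-$R$-bimodule such that $P\otimes_R-:R\text{-}\mathsf{Mod}\to R'\text{-}\mathsf{Mod}$ is an equivalence between the categories of left modules, then $P\otimes_RN$ is admissible and there is an equivalence $\mathbb{P}^{nc}(N)\to\mathbb{P}^{nc}(P\otimes_RN)$. 3. In particular, suppose that $R$ and $S$ are division rings finite dimensional over $k$, that $\phi_1:R\to R'$ and $\phi_2:S\to S'$ are isomorphisms of $k$-algebras, and that $N'$ is the $R'$-$S'$-bimodule with underlying set $N$ and action $a\cdot n\cdot b=\phi_1^{-1}(a)\,n\,\phi_2^{-1}(b)$. Then $N'$ is admissible and there is an equivalence $\mathbb{P}^{nc}(N)\to\mathbb{P}^{nc}(N')$. -/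

import Mathlib

open CategoryTheory TensorProduct MulOpposite

universe u

namespace NCP1

/-- A bundled `k`-algebra. -/
structure KAlg (k : Type u) [Field k] : Type (u + 1) where
  carrier : Type u
  [ring : Ring carrier]
  [algebra : Algebra k carrier]

attribute [instance] KAlg.ring KAlg.algebra

/-- A `k`-central `R`-`S`-bimodule: left `R`-action, right `S`-action (a module over `Sᵐᵒᵖ`),
commuting with each other, and inducing the same `k`-vector space structure. -/
structure Bimodule (k : Type u) [Field k] (R S : Type u) [Ring R] [Algebra k R]
    [Ring S] [Algebra k S] : Type (u + 1) where
  carrier : Type u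
  [addCommGroup : AddCommGroup carrier]
  [moduleBase : Module k carrier]
  [moduleLeft : Module R carrier]
  [moduleRight : Module Sᵐᵒᵖ carrier]
  [smulComm : SMulCommClass R Sᵐᵒᵖ carrier]
  [towerLeft : IsScalarTower k R carrier]
  [towerRight : IsScalarTower k Sᵐᵒᵖ carrier]

namespace Bimodule

attribute [instance] addCommGroup moduleBase moduleLeft moduleRight smulComm towerLeft towerRight

instance smulCommLeft {k R S : Type u} [Field k] [Ring R] [Algebra k R] [Ring S] [Algebra k S]
    (M : Bimodule k R S) : SMulCommClass k R M.carrier :=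
  IsScalarTower.to_smulCommClass

instance smulCommRight {k R S : Type u} [Field k] [Ring R] [Algebra k R] [Ring S] [Algebra k S]
    (M : Bimodule k R S) : SMulCommClass k Sᵐᵒᵖ M.carrier :=
  IsScalarTower.to_smulCommClass

section

variable {k : Type u} [Field k] {R S T : Type u} [Ring R] [Algebra k R] [Ring S] [Algebra k S]
  [Ring T] [Algebra k T]

/-- The regular bimodule `R` over itself. -/
def regular (k : Type u) [Field k] (R : Type u) [Ring R] [Algebra k R] : Bimodule k R R where
  carrier := R

/-! ### Tensor product of bimodules over a noncommutative ring -/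

/-- The relations `m s ⊗ n = m ⊗ s n` in `M ⊗ₖ N`. -/
def balanced (M : Bimodule k R S) (N : Bimodule k S T) :
    Submodule k (M.carrier ⊗[k] N.carrier) :=
  Submodule.span k {z | ∃ (m : M.carrier) (s : S) (n : N.carrier),
    z = (op s • m) ⊗ₜ[k] n - m ⊗ₜ[k] (s • n)}

/-- The underlying vector space of `M ⊗_S N`, i.e. `M ⊗ₖ N` modulo `m s ⊗ n = m ⊗ s n`. -/
abbrev TensorCarrier (M : Bimodule k R S) (N : Bimodule k S T) : Type u :=
  (M.carrier ⊗[k] N.carrier) ⧸ balanced M N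

/-- The left action of `R` on `M ⊗_S N`. -/
noncomputable def tensorLeftEnd (M : Bimodule k R S) (N : Bimodule k S T) :
    R →ₐ[k] Module.End k (TensorCarrier M N) :=
  AlgHom.ofLinearMap
    { toFun := fun r => (balanced M N).mapQ (balanced M N)
        (TensorProduct.map (Algebra.lsmul k k M.carrier r) LinearMap.id) (by
          rw [balanced, Submodule.span_le]
          rintro _ ⟨m, s, n, rfl⟩
          refine Submodule.subset_span ⟨r • m, s, n, ?_⟩
          simp [smul_comm r (op s) m])
      map_add' := fun a b => by
        apply Submodule.linearMap_qext
        ext m n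
        simp [TensorProduct.add_tmul]
      map_smul' := fun a b => by
        apply Submodule.linearMap_qext
        ext m n
        simpa using congrArg (balanced M N).mkQ (TensorProduct.smul_tmul' a (b • m) n).symm }
    (by
      apply Submodule.linearMap_qext
      ext m n
      simp)
    (fun a b => by
      apply Submodule.linearMap_qext
      ext m n
      simp)

/-- The right action of `T` on `M ⊗_S N`. -/
noncomputable def tensorRightEnd (M : Bimodule k R S) (N : Bimodule k S T) :
    Tᵐᵒᵖ →ₐ[k] Module.End k (TensorCarrier M N) :=
  AlgHom.ofLinearMap
    { toFun := fun t => (balanced M N).mapQ (balanced M N)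
        (TensorProduct.map LinearMap.id (Algebra.lsmul k k N.carrier t)) (by
          rw [balanced, Submodule.span_le]
          rintro _ ⟨m, s, n, rfl⟩
          refine Submodule.subset_span ⟨m, s, t • n, ?_⟩
          simp [smul_comm s t n])
      map_add' := fun a b => by
        apply Submodule.linearMap_qext
        ext m n
        simp [TensorProduct.tmul_add]
      map_smul' := fun a b => by
        apply Submodule.linearMap_qext
        ext m n
        simp }
    (by
      apply Submodule.linearMap_qext
      ext m n
      simp)
    (fun a b => by
      apply Submodule.linearMap_qext
      ext m n
      simp)

/-- The tensor product `M ⊗_S N` of an `R`-`S`-bimodule and an `S`-`T`-bimodule. -/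
noncomputable def tensor (M : Bimodule k R S) (N : Bimodule k S T) : Bimodule k R T :=
  letI : Module R (TensorCarrier M N) := Module.compHom _ (tensorLeftEnd M N).toRingHom
  letI : Module Tᵐᵒᵖ (TensorCarrier M N) := Module.compHom _ (tensorRightEnd M N).toRingHom
  { carrier := TensorCarrier M N
    smulComm := ⟨fun r t x => by
      change tensorLeftEnd M N r (tensorRightEnd M N t x)
        = tensorRightEnd M N t (tensorLeftEnd M N r x)
      revert x
      refine fun x => LinearMap.congr_fun (f := tensorLeftEnd M N r ∘ₗ tensorRightEnd M N t)
        (g := tensorRightEnd M N t ∘ₗ tensorLeftEnd M N r) ?_ x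
      apply Submodule.linearMap_qext
      ext m n
      simp [tensorLeftEnd, tensorRightEnd]⟩
    towerLeft := ⟨fun c r x => by
      change tensorLeftEnd M N (c • r) x = c • tensorLeftEnd M N r x
      rw [map_smul]; rfl⟩
    towerRight := ⟨fun c r x => by
      change tensorRightEnd M N (c • r) x = c • tensorRightEnd M N r x
      rw [map_smul]; rfl⟩ }

/-- The element `m ⊗ n` of `M ⊗_S N`. -/
noncomputable def tmul {M : Bimodule k R S} {N : Bimodule k S T} (m : M.carrier)
    (n : N.carrier) : (tensor M N).carrier :=
  (Submodule.Quotient.mk (m ⊗ₜ[k] n) : TensorCarrier M N)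

/-- `m ⊗ n` as a `k`-bilinear map. -/
noncomputable def mkTensor (M : Bimodule k R S) (N : Bimodule k S T) :
    M.carrier →ₗ[k] N.carrier →ₗ[k] (tensor M N).carrier :=
  (TensorProduct.mk k M.carrier N.carrier).compr₂
    ((balanced M N).mkQ : _ →ₗ[k] TensorCarrier M N)

@[simp] theorem mkTensor_apply {M : Bimodule k R S} {N : Bimodule k S T} (m : M.carrier)
    (n : N.carrier) : mkTensor M N m n = tmul m n := rfl

theorem tmul_balanced {M : Bimodule k R S} {N : Bimodule k S T} (m : M.carrier) (s : S)
    (n : N.carrier) : tmul (op s • m) n = tmul m (s • n) :=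
  (Submodule.Quotient.eq _).2 (Submodule.subset_span ⟨m, s, n, rfl⟩)

theorem smul_tmul {M : Bimodule k R S} {N : Bimodule k S T} (r : R) (m : M.carrier)
    (n : N.carrier) : r • tmul m n = tmul (r • m) n := rfl

theorem op_smul_tmul {M : Bimodule k R S} {N : Bimodule k S T} (t : Tᵐᵒᵖ) (m : M.carrier)
    (n : N.carrier) : t • tmul m n = tmul m (t • n) := rfl

theorem tmul_add {M : Bimodule k R S} {N : Bimodule k S T} (m : M.carrier) (n n' : N.carrier) :
    tmul m (n + n') = tmul m n + tmul m n' := ((mkTensor M N) m).map_add n n'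

theorem add_tmul {M : Bimodule k R S} {N : Bimodule k S T} (m m' : M.carrier) (n : N.carrier) :
    tmul (m + m') n = tmul m n + tmul m' n := ((mkTensor M N).flip n).map_add m m'

theorem tmul_zero {M : Bimodule k R S} {N : Bimodule k S T} (m : M.carrier) :
    (tmul m 0 : (tensor M N).carrier) = 0 := ((mkTensor M N) m).map_zero

theorem zero_tmul {M : Bimodule k R S} {N : Bimodule k S T} (n : N.carrier) :
    (tmul 0 n : (tensor M N).carrier) = 0 := ((mkTensor M N).flip n).map_zero

theorem tensor_induction {M : Bimodule k R S} {N : Bimodule k S T}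
    {p : (tensor M N).carrier → Prop} (h0 : p 0)
    (h1 : ∀ m n, p (tmul m n)) (h2 : ∀ x y, p x → p y → p (x + y))
    (x : (tensor M N).carrier) : p x := by
  obtain ⟨y, rfl⟩ := Submodule.Quotient.mk_surjective (balanced M N) x
  induction y using TensorProduct.induction_on with
  | zero => exact h0
  | tmul m n => exact h1 m n
  | add a b ha hb => exact h2 _ _ ha hb

/-- Universal property: a `k`-bilinear `S`-balanced map induces a map on `M ⊗_S N`. -/
noncomputable def lift {M : Bimodule k R S} {N : Bimodule k S T} {X : Type u} [AddCommGroup X]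
    [Module k X] (f : M.carrier →ₗ[k] N.carrier →ₗ[k] X)
    (hf : ∀ m (s : S) n, f (op s • m) n = f m (s • n)) : (tensor M N).carrier →ₗ[k] X :=
  (balanced M N).liftQ (TensorProduct.lift f) (by
    rw [balanced, Submodule.span_le]
    rintro _ ⟨m, s, n, rfl⟩
    simp [hf])

@[simp] theorem lift_tmul {M : Bimodule k R S} {N : Bimodule k S T} {X : Type u} [AddCommGroup X]
    [Module k X] (f : M.carrier →ₗ[k] N.carrier →ₗ[k] X)
    (hf : ∀ m (s : S) n, f (op s • m) n = f m (s • n)) (m : M.carrier) (n : N.carrier) :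
    lift f hf (tmul m n) = f m n := rfl

/-! ### Duals -/

theorem op_algebraMap_smul (M : Bimodule k R S) (c : k) (m : M.carrier) :
    op (algebraMap k S c) • m = c • m := by
  rw [← MulOpposite.algebraMap_apply, algebraMap_smul]

/-- The right dual `N^* = Hom_S(N_S, S)`, with `(a · ψ · b)(n) = a ψ(b n)`. -/
def rightDual (N : Bimodule k R S) : Bimodule k S R :=
  letI : Module Rᵐᵒᵖ (N.carrier →ₗ[Sᵐᵒᵖ] S) :=
    { smul := fun b ψ =>
        { toFun := fun n => ψ (unop b • n)
          map_add' := fun x y => by rw [smul_add, map_add]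
          map_smul' := fun s x => by rw [smul_comm, map_smul, RingHom.id_apply] }
      one_smul := fun ψ => LinearMap.ext fun n => congrArg ψ (one_smul R n)
      mul_smul := fun a b ψ => LinearMap.ext fun n => congrArg ψ (mul_smul (unop b) (unop a) n)
      smul_zero := fun a => rfl
      smul_add := fun a ψ φ => rfl
      add_smul := fun a b ψ => LinearMap.ext fun n =>
        (congrArg ψ (add_smul (unop a) (unop b) n)).trans (ψ.map_add _ _)
      zero_smul := fun ψ => LinearMap.ext fun n =>
        (congrArg ψ (zero_smul R n)).trans ψ.map_zero }
  { carrier := N.carrier →ₗ[Sᵐᵒᵖ] S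
    smulComm := ⟨fun a b ψ => rfl⟩
    towerLeft := ⟨fun c a ψ => LinearMap.ext fun n => smul_assoc c a (ψ n)⟩
    towerRight := ⟨fun c b ψ => LinearMap.ext fun n => by
      change ψ ((c • unop b) • n) = c • ψ (unop b • n)
      rw [smul_assoc, ← op_algebraMap_smul, map_smul, op_smul_eq_mul, ← Algebra.commutes,
        Algebra.smul_def]⟩ }

/-- The left dual `^*N = Hom_R(_R N, R)`, with `(a · φ · b)(n) = φ(n a) b`. -/
def leftDual (N : Bimodule k R S) : Bimodule k S R :=
  letI : Module S (N.carrier →ₗ[R] R) :=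
    { smul := fun a φ =>
        { toFun := fun n => φ (op a • n)
          map_add' := fun x y => by rw [smul_add, map_add]
          map_smul' := fun s x => by rw [← smul_comm, map_smul, RingHom.id_apply] }
      one_smul := fun ψ => LinearMap.ext fun n => congrArg ψ (one_smul Sᵐᵒᵖ n)
      mul_smul := fun a b ψ => LinearMap.ext fun n => congrArg ψ (mul_smul (op b) (op a) n)
      smul_zero := fun a => rfl
      smul_add := fun a ψ φ => rfl
      add_smul := fun a b ψ => LinearMap.ext fun n =>
        (congrArg ψ (add_smul (op a) (op b) n)).trans (ψ.map_add _ _)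
      zero_smul := fun ψ => LinearMap.ext fun n =>
        (congrArg ψ (zero_smul Sᵐᵒᵖ n)).trans ψ.map_zero }
  { carrier := N.carrier →ₗ[R] R
    smulComm := ⟨fun a b ψ => rfl⟩
    towerLeft := ⟨fun c a φ => LinearMap.ext fun n => by
      change φ ((c • op a) • n) = c • φ (op a • n)
      rw [smul_assoc, ← algebraMap_smul R c (op a • n), map_smul, smul_eq_mul, Algebra.smul_def]⟩
    towerRight := ⟨fun c b φ => LinearMap.ext fun n => smul_assoc c b (φ n)⟩ }

/-- Evaluation of an element of `N^* = Hom_S(N_S, S)`. -/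
def rightEval {N : Bimodule k R S} (ψ : N.rightDual.carrier) : N.carrier →ₗ[Sᵐᵒᵖ] S := ψ

/-- Evaluation of an element of `^*N = Hom_R(_R N, R)`. -/
def leftEval {N : Bimodule k R S} (φ : N.leftDual.carrier) : N.carrier →ₗ[R] R := φ

/-- The canonical map `N ⊗_S N^* → End(N_S)`, sending `n ⊗ ψ` to `x ↦ n ψ(x)`. -/
noncomputable def rightCoev (N : Bimodule k R S) :
    (N.tensor N.rightDual).carrier →ₗ[k] Module.End k N.carrier :=
  lift
    (LinearMap.mk₂ k (fun n ψ =>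
      { toFun := fun x => op (rightEval ψ x) • n
        map_add' := fun x y => by simp [add_smul]
        map_smul' := fun c x => by
          rw [← op_algebraMap_smul, map_smul, op_smul_eq_mul, ← Algebra.commutes,
            ← Algebra.smul_def, op_smul, smul_assoc]; rfl })
      (fun a b ψ => LinearMap.ext fun x => smul_add _ _ _)
      (fun c a ψ => LinearMap.ext fun x => (smul_comm c _ a).symm)
      (fun a ψ φ => LinearMap.ext fun x => add_smul (op (rightEval ψ x)) (op (rightEval φ x)) a)
      (fun c a ψ => LinearMap.ext fun x => smul_assoc c (op (rightEval ψ x)) a))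
    (fun n s ψ => LinearMap.ext fun x => (mul_smul (op (rightEval ψ x)) (op s) n).symm)

/-- The canonical map `^*N ⊗_R N → End(_R N)`, sending `φ ⊗ n` to `x ↦ φ(x) n`. -/
noncomputable def leftCoev (N : Bimodule k R S) :
    (N.leftDual.tensor N).carrier →ₗ[k] Module.End k N.carrier :=
  lift
    (LinearMap.mk₂ k (fun φ n =>
      { toFun := fun x => leftEval φ x • n
        map_add' := fun x y => by simp [add_smul]
        map_smul' := fun c x => by
          rw [← algebraMap_smul R c x, map_smul, smul_eq_mul, ← Algebra.smul_def, smul_assoc]; rfl })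
      (fun ψ φ a => LinearMap.ext fun x => add_smul (leftEval ψ x) (leftEval φ x) a)
      (fun c ψ a => LinearMap.ext fun x => smul_assoc c (leftEval ψ x) a)
      (fun ψ a b => LinearMap.ext fun x => smul_add _ _ _)
      (fun c ψ a => LinearMap.ext fun x => (smul_comm c _ a).symm))
    (fun φ s n => LinearMap.ext fun x => mul_smul (leftEval φ x) s n)

/-- The image of `R` under the unit of the adjoint pair `(- ⊗_R N, - ⊗_S N^*)`:
the unit is `R → End(N_S) ≅ N ⊗_S N^*`, where `a : R` goes to left multiplication by `a`. -/
noncomputable def unitRight (N : Bimodule k R S) : Submodule k (N.tensor N.rightDual).carrier :=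
  (LinearMap.range (Algebra.lsmul k k N.carrier : R →ₐ[k] _).toLinearMap).comap (rightCoev N)

/-- The image of `S` under the unit of the adjoint pair `(- ⊗_S ^*N, - ⊗_R N)`:
the unit is `S → End(_R N) ≅ ^*N ⊗_R N`, where `a : S` goes to right multiplication by `a`. -/
noncomputable def unitLeft (N : Bimodule k R S) : Submodule k (N.leftDual.tensor N).carrier :=
  (LinearMap.range (Algebra.lsmul k k N.carrier : Sᵐᵒᵖ →ₐ[k] _).toLinearMap).comap (leftCoev N)

end


/-! ### Iterated duals -/

section

variable {k : Type u} [Field k]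

/-- The `n`-th base ring, for `n : ℕ`: `R` for even `n` and `S` for odd `n`. -/
def baseNat (R S : KAlg.{u} k) : ℕ → KAlg.{u} k
  | 0 => R
  | 1 => S
  | n + 2 => baseNat R S n

/-- `F_i`: equal to `R` for `i` even and to `S` for `i` odd. -/
def base (R S : KAlg.{u} k) : ℤ → KAlg.{u} k
  | .ofNat n => baseNat R S n
  | .negSucc n => baseNat R S (n + 1)

/-- `N^{n*}` for `n ≥ 0`: iterated right duals. -/
def dualPos {R S : KAlg.{u} k} (N : Bimodule k R.carrier S.carrier) :
    ∀ n : ℕ, Bimodule k (baseNat R S n).carrier (baseNat R S (n + 1)).carrier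
  | 0 => N
  | n + 1 => (dualPos N n).rightDual

/-- `N^{-n*}` for `n ≥ 0`: iterated left duals. -/
def dualNeg {R S : KAlg.{u} k} (N : Bimodule k R.carrier S.carrier) :
    ∀ n : ℕ, Bimodule k (baseNat R S n).carrier (baseNat R S (n + 1)).carrier
  | 0 => N
  | n + 1 => (dualNeg N n).leftDual

/-- `N^{i*}` for `i : ℤ`, an `F_i`-`F_{i+1}`-bimodule: `N^{0*} = N`, `N^{(i+1)*} = (N^{i*})^*`
for `i ≥ 0` and `N^{i*} = ^*(N^{(i+1)*})` for `i < 0`. -/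
def iterDual {R S : KAlg.{u} k} (N : Bimodule k R.carrier S.carrier) :
    ∀ i : ℤ, Bimodule k (base R S i).carrier (base R S (i + 1)).carrier
  | .ofNat n => dualPos N n
  | .negSucc 0 => dualNeg N 1
  | .negSucc (n + 1) => dualNeg N (n + 2)

/-- `Q_i ⊆ N^{i*} ⊗ N^{(i+1)*}`: the image of `F_i` under the unit of the adjoint pair
`(- ⊗ N^{i*}, - ⊗ N^{(i+1)*})`. -/
noncomputable def unitRel {R S : KAlg.{u} k} (N : Bimodule k R.carrier S.carrier) :
    ∀ i : ℤ, Submodule k ((iterDual N i).tensor (iterDual N (i + 1))).carrier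
  | .ofNat n => (dualPos N n).unitRight
  | .negSucc 0 => (dualNeg N 0).unitLeft
  | .negSucc 1 => (dualNeg N 1).unitLeft
  | .negSucc (n + 2) => (dualNeg N (n + 2)).unitLeft

theorem op_smul_mem_unitRight {R S : Type u} [Ring R] [Algebra k R] [Ring S] [Algebra k S]
    (N : Bimodule k R S) (s : Rᵐᵒᵖ) (q : (N.tensor N.rightDual).carrier) (hq : q ∈ N.unitRight) :
    s • q ∈ N.unitRight := by
  obtain ⟨a, ha⟩ := hq
  have key : ∀ q : (N.tensor N.rightDual).carrier, ∀ x,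
      N.rightCoev (s • q) x = N.rightCoev q (unop s • x) := fun q x => by
    induction q using tensor_induction with
    | h0 => simp
    | h1 m n => rfl
    | h2 a b ha hb => rw [smul_add, map_add, map_add, LinearMap.add_apply, LinearMap.add_apply,
        ha, hb]
  refine ⟨a * unop s, LinearMap.ext fun x => ?_⟩
  rw [key q x, ← ha]
  exact mul_smul a (unop s) x

theorem op_smul_mem_unitLeft {R S : Type u} [Ring R] [Algebra k R] [Ring S] [Algebra k S]
    (N : Bimodule k R S) (s : Sᵐᵒᵖ) (q : (N.leftDual.tensor N).carrier) (hq : q ∈ N.unitLeft) :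
    s • q ∈ N.unitLeft := by
  obtain ⟨a, ha⟩ := hq
  have key : ∀ q : (N.leftDual.tensor N).carrier, ∀ x,
      N.leftCoev (s • q) x = s • N.leftCoev q x := fun q x => by
    induction q using tensor_induction with
    | h0 => simp
    | h1 m n => exact (smul_comm (leftEval m x) s n)
    | h2 a b ha hb => rw [smul_add, map_add, map_add, LinearMap.add_apply, LinearMap.add_apply,
        ha, hb, smul_add]
  refine ⟨s * a, LinearMap.ext fun x => ?_⟩
  rw [key q x, ← ha]
  exact mul_smul s a x

theorem op_smul_mem_unitRel {R S : KAlg.{u} k} (N : Bimodule k R.carrier S.carrier) :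
    ∀ (i : ℤ) (s : (base R S (i + 1 + 1)).carrierᵐᵒᵖ), ∀ q ∈ unitRel N i, s • q ∈ unitRel N i
  | .ofNat n => (dualPos N n).op_smul_mem_unitRight
  | .negSucc 0 => (dualNeg N 0).op_smul_mem_unitLeft
  | .negSucc 1 => (dualNeg N 1).op_smul_mem_unitLeft
  | .negSucc (n + 2) => (dualNeg N (n + 2)).op_smul_mem_unitLeft

/-- `M` is finitely generated projective on each side. -/
structure IsFGProjective {R S : Type u} [Ring R] [Algebra k R] [Ring S] [Algebra k S]
    (M : Bimodule k R S) : Prop where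
  finite_left : Module.Finite R M.carrier
  projective_left : Module.Projective R M.carrier
  finite_right : Module.Finite Sᵐᵒᵖ M.carrier
  projective_right : Module.Projective Sᵐᵒᵖ M.carrier

theorem base_even (R S : KAlg.{u} k) (i : ℤ) (h : Even i) : base R S i = R := by
  have key : ∀ n, baseNat R S (2 * n) = R := fun n => by
    induction n with
    | zero => rfl
    | succ n ih => exact ih
  obtain ⟨j, rfl⟩ := h
  rcases j with n | n
  · have : Int.ofNat n + Int.ofNat n = Int.ofNat (2 * n) := by simp; ring
    rw [this]; exact key n
  · have : Int.negSucc n + Int.negSucc n = Int.negSucc (2 * n + 1) := by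
      simp only [Int.negSucc_eq]; push_cast; ring
    rw [this]; exact key n

theorem base_odd (R S : KAlg.{u} k) (i : ℤ) (h : Odd i) : base R S i = S := by
  have key : ∀ n, baseNat R S (2 * n + 1) = S := fun n => by
    induction n with
    | zero => rfl
    | succ n ih => exact ih
  obtain ⟨j, rfl⟩ := h
  rcases j with n | n
  · have : 2 * Int.ofNat n + 1 = Int.ofNat (2 * n + 1) := by simp
    rw [this]; exact key n
  · have : 2 * Int.negSucc n + 1 = Int.negSucc (2 * n) := by
      simp only [Int.negSucc_eq]; push_cast; ring
    rw [this]; exact key n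

end

/-! ### Auxiliary maps for concatenation of tensors -/

section

variable {k : Type u} [Field k] {A B C E : Type u} [Ring A] [Algebra k A] [Ring B] [Algebra k B]
  [Ring C] [Algebra k C] [Ring E] [Algebra k E]

/-- For `x : U`, the map `M ⊗ N → (U ⊗ M) ⊗ N` sending `m ⊗ n` to `x ⊗ m ⊗ n`. -/
noncomputable def insertMap (U : Bimodule k A B) (M : Bimodule k B C) (N : Bimodule k C E)
    (x : U.carrier) : (M.tensor N).carrier →ₗ[k] ((U.tensor M).tensor N).carrier :=
  lift ((mkTensor (U.tensor M) N).comp (mkTensor U M x))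
    (fun m s n => tmul_balanced (tmul x m) s n)

/-- The right action `U × B → U` as a bilinear map, right `B`-linear in the second variable. -/
noncomputable def mulNil (U : Bimodule k A B) :
    {f : U.carrier →ₗ[k] (regular k B).carrier →ₗ[k] U.carrier //
      ∀ x y (s : Bᵐᵒᵖ), f x (s • y) = s • f x y} :=
  ⟨LinearMap.mk₂ k (fun (x : U.carrier) (y : (regular k B).carrier) => op (α := B) y • x)
    (fun _ _ _ => smul_add _ _ _)
    (fun c x y => (smul_comm c (op (α := B) y) x).symm)
    (fun x y y' => add_smul (op (α := B) y) (op (α := B) y') x)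
    (fun c x y => smul_assoc c (op (α := B) y) x),
    fun x y s => mul_smul s (op (α := B) y) x⟩

/-- From `f : U × V → W`, right linear in the second variable, the map
`U × (V ⊗ N) → W ⊗ N` sending `(x, y ⊗ n)` to `f x y ⊗ n`. -/
noncomputable def mulStep {U : Bimodule k A B} {V : Bimodule k B C} {W : Bimodule k A C}
    (f : {f : U.carrier →ₗ[k] V.carrier →ₗ[k] W.carrier //
      ∀ x y (s : Cᵐᵒᵖ), f x (s • y) = s • f x y}) (N : Bimodule k C E) :
    {g : U.carrier →ₗ[k] (V.tensor N).carrier →ₗ[k] (W.tensor N).carrier //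
      ∀ x y (s : Eᵐᵒᵖ), g x (s • y) = s • g x y} :=
  ⟨LinearMap.flip (lift
      (LinearMap.mk₂ k (fun y n => ((mkTensor W N).flip n).comp (f.1.flip y))
        (fun y y' n => LinearMap.ext fun x =>
          (congrArg ((mkTensor W N).flip n) ((f.1 x).map_add y y')).trans
            (((mkTensor W N).flip n).map_add _ _))
        (fun c y n => LinearMap.ext fun x =>
          (congrArg ((mkTensor W N).flip n) ((f.1 x).map_smul c y)).trans
            (((mkTensor W N).flip n).map_smul c (f.1 x y)))
        (fun y n n' => LinearMap.ext fun x => (mkTensor W N (f.1 x y)).map_add n n')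
        (fun c y n => LinearMap.ext fun x => (mkTensor W N (f.1 x y)).map_smul c n))
      (fun y s n => by
        ext x
        change tmul (f.1 x (op s • y)) n = tmul (f.1 x y) (s • n)
        rw [f.2, tmul_balanced])),
    fun x y s => by
      induction y using tensor_induction with
      | h0 => rw [smul_zero, map_zero, smul_zero]
      | h1 y n => rfl
      | h2 y y' h h' => rw [smul_add, map_add, map_add, h, h', smul_add]⟩

theorem mulStep_tmul {U : Bimodule k A B} {V : Bimodule k B C} {W : Bimodule k A C}
    (f : {f : U.carrier →ₗ[k] V.carrier →ₗ[k] W.carrier //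
      ∀ x y (s : Cᵐᵒᵖ), f x (s • y) = s • f x y}) (N : Bimodule k C E) (x : U.carrier)
    (y : V.carrier) (n : N.carrier) : (mulStep f N).1 x (tmul y n) = tmul (f.1 x y) n := rfl

theorem op_smul_insertMap (U : Bimodule k A B) (M : Bimodule k B C) (N : Bimodule k C E)
    (x : U.carrier) (s : Eᵐᵒᵖ) (z : (M.tensor N).carrier) :
    s • insertMap U M N x z = insertMap U M N x (s • z) := by
  induction z using tensor_induction with
  | h0 => rw [smul_zero, map_zero, smul_zero]
  | h1 m n => rfl
  | h2 a b ha hb => rw [map_add, smul_add, ha, hb, smul_add, map_add]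

theorem finite_tensor {U : Bimodule k A B} {N : Bimodule k B C}
    (hU : Module.Finite Bᵐᵒᵖ U.carrier) (hN : Module.Finite Cᵐᵒᵖ N.carrier) :
    Module.Finite Cᵐᵒᵖ (U.tensor N).carrier := by
  classical
  obtain ⟨s, hs⟩ := hU.fg_top
  obtain ⟨t, ht⟩ := hN.fg_top
  refine ⟨⟨(s ×ˢ t).image fun x => tmul x.1 x.2, ?_⟩⟩
  rw [eq_top_iff]
  rintro z -
  induction z using tensor_induction with
  | h0 => exact zero_mem _
  | h2 a b ha hb => exact add_mem ha hb
  | h1 u n =>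
  have hu : u ∈ Submodule.span Bᵐᵒᵖ (s : Set U.carrier) := hs ▸ trivial
  induction hu using Submodule.span_induction generalizing n with
  | zero => rw [Bimodule.zero_tmul]; exact zero_mem _
  | add a b _ _ ha hb => rw [Bimodule.add_tmul]; exact add_mem (ha n) (hb n)
  | smul c a _ ha => rw [← op_unop c, tmul_balanced]; exact ha _
  | mem u hu =>
  have hn : n ∈ Submodule.span Cᵐᵒᵖ (t : Set N.carrier) := ht ▸ trivial
  induction hn using Submodule.span_induction with
  | zero => rw [Bimodule.tmul_zero]; exact zero_mem _
  | add a b _ _ ha hb => rw [Bimodule.tmul_add]; exact add_mem ha hb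
  | smul c a _ ha => rw [← op_smul_tmul]; exact Submodule.smul_mem _ c ha
  | mem n hn =>
  exact Submodule.subset_span (Finset.mem_coe.2 (Finset.mem_image.2
    ⟨(u, n), Finset.mem_product.2 ⟨hu, hn⟩, rfl⟩))

theorem mulStep_insert {E' : Type u} [Ring E'] [Algebra k E']
    {U : Bimodule k A B} {V : Bimodule k B C} {W : Bimodule k A C}
    (f : {f : U.carrier →ₗ[k] V.carrier →ₗ[k] W.carrier //
      ∀ x y (s : Cᵐᵒᵖ), f x (s • y) = s • f x y}) (N : Bimodule k C E) (N' : Bimodule k E E')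
    (x : U.carrier) (y : V.carrier) (z : (N.tensor N').carrier) :
    (mulStep (mulStep f N) N').1 x (insertMap V N N' y z) = insertMap W N N' (f.1 x y) z := by
  induction z using tensor_induction with
  | h0 => rw [map_zero, map_zero, map_zero]
  | h1 m n => rfl
  | h2 a b ha hb => rw [map_add, map_add, map_add, ha, hb]

end

end Bimodule

/-! ### The `ℤ`-algebra of a sequence of bimodules with quadratic relations -/

/-- A sequence of `F_i`-`F_{i+1}`-bimodules `N_i` together with subspaces
`Q_i ⊆ N_i ⊗ N_{i+1}` stable under the right action of `F_{i+2}`. -/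
structure BimoduleSeq (k : Type u) [Field k] : Type (u + 1) where
  F : ℤ → KAlg.{u} k
  N : ∀ i : ℤ, Bimodule k (F i).carrier (F (i + 1)).carrier
  Q : ∀ i : ℤ, Submodule k ((N i).tensor (N (i + 1))).carrier
  op_smul_mem : ∀ (i : ℤ) (s : (F (i + 1 + 1)).carrierᵐᵒᵖ), ∀ q ∈ Q i, s • q ∈ Q i

/-- `Path i j` has exactly one element if `i ≤ j` and none otherwise. It records the sequence
`i, i + 1, …, j` along which the bimodules `N_i, N_{i+1}, …, N_{j-1}` are tensored. -/
inductive Path (i : ℤ) : ℤ → Type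
  | nil : Path i i
  | snoc {j : ℤ} (p : Path i j) : Path i (j + 1)

namespace Path

/-- Concatenation. -/
def comp {i j : ℤ} (p : Path i j) : ∀ {l : ℤ}, Path j l → Path i l
  | _, nil => p
  | _, snoc q => snoc (comp p q)

theorem nil_comp {i : ℤ} : ∀ {j : ℤ} (p : Path i j), comp nil p = p
  | _, nil => rfl
  | _, snoc p => congrArg snoc (nil_comp p)

theorem comp_assoc {i j l : ℤ} (p : Path i j) (q : Path j l) :
    ∀ {m : ℤ} (r : Path l m), comp (comp p q) r = comp p (comp q r)
  | _, nil => rfl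
  | _, snoc r => congrArg snoc (comp_assoc p q r)

theorem le {i : ℤ} : ∀ {j : ℤ}, Path i j → i ≤ j
  | _, nil => le_rfl
  | _, snoc p => (le p).trans (by lia)

theorem eq_of_heq_aux {i : ℤ} : ∀ {j : ℤ} (p : Path i j) {j' : ℤ} (q : Path i j'), j = j' → HEq p q
  | _, nil, _, nil, _ => HEq.rfl
  | _, nil, _, snoc q, h => absurd (le q) (by lia)
  | _, snoc p, _, nil, h => absurd (le p) (by lia)
  | _, snoc (j := a) p, _, snoc (j := b) q, h => by
      obtain rfl : a = b := by lia
      rw [eq_of_heq (eq_of_heq_aux p q rfl)]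

instance {i j : ℤ} : Subsingleton (Path i j) := ⟨fun p q => eq_of_heq (eq_of_heq_aux p q rfl)⟩

/-- The path from `i` to `i + n`. -/
theorem exists_path {i j : ℤ} (h : i ≤ j) : Nonempty (Path i j) := by
  induction j, h using Int.leInduction with
  | base => exact ⟨nil⟩
  | succ j _ ih => exact ih.map snoc

noncomputable instance {i j : ℤ} : DecidableEq (Path i j) := Classical.decEq _

end Path

namespace BimoduleSeq

open Bimodule DirectSum

variable {k : Type u} [Field k] (D : BimoduleSeq k)

/-- `T_{ij} = N_i ⊗ N_{i+1} ⊗ ⋯ ⊗ N_{j-1}`, as an iterated tensor product starting with the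
regular bimodule `F_i`; in particular `T_{ii} = F_i` and `T_{i,i+1} = F_i ⊗ N_i ≅ N_i`. -/
noncomputable def T {i : ℤ} : ∀ {j : ℤ}, Path i j → Bimodule k (D.F i).carrier (D.F j).carrier
  | _, .nil => regular k (D.F i).carrier
  | _, .snoc (j := j) p => (T p).tensor (D.N j)

/-- The element `1` of `T_{ii} = F_i`. -/
def oneT (i : ℤ) : (D.T (.nil (i := i))).carrier := (1 : (D.F i).carrier)

/-- The product `x ⊗ n ∈ T_{i,j+1}` of `x ∈ T_{ij}` and `n ∈ N_j`. -/
noncomputable def snocT {i j : ℤ} (p : Path i j) :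
    (D.T p).carrier →ₗ[k] (D.N j).carrier →ₗ[k] (D.T p.snoc).carrier :=
  mkTensor (D.T p) (D.N j)

/-- The product `x ⊗ q ∈ T_{i,j+2}` of `x ∈ T_{ij}` and `q ∈ N_j ⊗ N_{j+1}`. -/
noncomputable def snocT₂ {i j : ℤ} (p : Path i j) (x : (D.T p).carrier) :
    ((D.N j).tensor (D.N (j + 1))).carrier →ₗ[k] (D.T p.snoc.snoc).carrier :=
  insertMap (D.T p) (D.N j) (D.N (j + 1)) x

theorem snocT₂_tmul {i j : ℤ} (p : Path i j) (x : (D.T p).carrier) (m : (D.N j).carrier)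
    (n : (D.N (j + 1)).carrier) : D.snocT₂ p x (tmul m n) = D.snocT p.snoc (D.snocT p x m) n :=
  rfl

theorem op_smul_snocT {i j : ℤ} (p : Path i j) (x : (D.T p).carrier) (n : (D.N j).carrier)
    (s : (D.F (j + 1)).carrierᵐᵒᵖ) : s • D.snocT p x n = D.snocT p x (s • n) := rfl

theorem op_smul_snocT₂ {i j : ℤ} (p : Path i j) (x : (D.T p).carrier)
    (z : ((D.N j).tensor (D.N (j + 1))).carrier) (s : (D.F (j + 1 + 1)).carrierᵐᵒᵖ) :
    s • D.snocT₂ p x z = D.snocT₂ p x (s • z) :=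
  op_smul_insertMap _ _ _ _ _ _

theorem T_induction {i j : ℤ} {p : Path i j} {P : (D.T p.snoc).carrier → Prop} (h0 : P 0)
    (h1 : ∀ x n, P (D.snocT p x n)) (h2 : ∀ x y, P x → P y → P (x + y))
    (x : (D.T p.snoc).carrier) : P x :=
  tensor_induction (M := D.T p) (N := D.N j) (p := P) h0 h1 h2 x

/-- The relations `R_{ij} ⊆ T_{ij}`: `R_{ij}` is the sum of the images of
`T_{il} ⊗ Q_l ⊗ T_{l+2,j}` over `i ≤ l ≤ j - 2`. The summands with `l < j - 2` add up to the
image of `R_{i,j-1} ⊗ N_{j-1}`, and the last one is the image of `T_{i,j-2} ⊗ Q_{j-2}`. -/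
noncomputable def R {i : ℤ} : ∀ {j : ℤ} (p : Path i j), Submodule k (D.T p).carrier
  | _, .nil => ⊥
  | _, .snoc .nil => ⊥
  | _, .snoc (.snoc (j := j) p) =>
      Submodule.span k
        ({z | ∃ x ∈ R (.snoc p), ∃ n, z = D.snocT (.snoc p) x n} ∪
          {z | ∃ x, ∃ q ∈ D.Q j, z = D.snocT₂ p x q})

/-- Concatenation of tensors `T_{ij} × T_{jl} → T_{il}`, which is right `F_l`-linear. -/
noncomputable def mulTAux {i j : ℤ} (p : Path i j) : ∀ {l : ℤ} (q : Path j l),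
    {f : (D.T p).carrier →ₗ[k] (D.T q).carrier →ₗ[k] (D.T (p.comp q)).carrier //
      ∀ x y (s : (D.F l).carrierᵐᵒᵖ), f x (s • y) = s • f x y}
  | _, .nil => mulNil (D.T p)
  | _, .snoc (j := l) q => mulStep (mulTAux p q) (D.N l)

/-- Concatenation of tensors `T_{ij} × T_{jl} → T_{il}`. -/
noncomputable def mulT {i j l : ℤ} (p : Path i j) (q : Path j l) :
    (D.T p).carrier →ₗ[k] (D.T q).carrier →ₗ[k] (D.T (p.comp q)).carrier :=
  (D.mulTAux p q).1

theorem mulT_smul {i j l : ℤ} (p : Path i j) (q : Path j l) (x : (D.T p).carrier)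
    (y : (D.T q).carrier) (s : (D.F l).carrierᵐᵒᵖ) : D.mulT p q x (s • y) = s • D.mulT p q x y :=
  (D.mulTAux p q).2 x y s

theorem mulT_oneT {i j : ℤ} (p : Path i j) (x : (D.T p).carrier) :
    D.mulT p .nil x (D.oneT j) = x := one_smul (D.F j).carrierᵐᵒᵖ x

theorem mulT_snoc {i j l : ℤ} (p : Path i j) (q : Path j l) (x : (D.T p).carrier)
    (y : (D.T q).carrier) (n : (D.N l).carrier) :
    D.mulT p q.snoc x (D.snocT q y n) = D.snocT (p.comp q) (D.mulT p q x y) n := rfl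

theorem mulT_snocT₂ {i j l : ℤ} (p : Path i j) (q : Path j l) (x : (D.T p).carrier)
    (y : (D.T q).carrier) (z : ((D.N l).tensor (D.N (l + 1))).carrier) :
    D.mulT p q.snoc.snoc x (D.snocT₂ q y z) = D.snocT₂ (p.comp q) (D.mulT p q x y) z :=
  mulStep_insert (D.mulTAux p q) _ _ _ _ _

theorem snocT_mem_R {i : ℤ} : ∀ {j : ℤ} (p : Path i j) (x : (D.T p).carrier) (_ : x ∈ D.R p)
    (n : (D.N j).carrier), D.snocT p x n ∈ D.R p.snoc
  | _, .nil, x, hx, n => by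
      have : x = 0 := by simpa [R] using hx
      rw [this, map_zero, LinearMap.zero_apply]; exact zero_mem _
  | _, .snoc p, x, hx, n => by
      rw [R]
      exact Submodule.subset_span (Or.inl ⟨x, hx, n, rfl⟩)

theorem mulT_op_smul {i j : ℤ} (p : Path i j) (x : (D.T p).carrier) (c : (D.F j).carrier) :
    ∀ {l : ℤ} (q : Path j l) (y : (D.T q).carrier),
      D.mulT p q (op c • x) y = D.mulT p q x (c • y)
  | _, .nil, y => (mul_smul (op (α := (D.F j).carrier) y) (op c) x).symm
  | _, .snoc q, y => by
      induction y using T_induction with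
      | h0 => rw [map_zero, smul_zero, map_zero]
      | h2 a b ha hb => rw [map_add, smul_add, map_add, ha, hb]
      | h1 y n =>
        change D.snocT _ (D.mulT p q (op c • x) y) n = D.snocT _ (D.mulT p q x (c • y)) n
        rw [mulT_op_smul p x c q y]

theorem R_snoc_snoc {i j : ℤ} (p : Path i j) : D.R p.snoc.snoc = Submodule.span k
    ({z | ∃ x ∈ D.R p.snoc, ∃ n, z = D.snocT p.snoc x n} ∪
      {z | ∃ x, ∃ q ∈ D.Q j, z = D.snocT₂ p x q}) := by
  rw [R]

theorem op_smul_mem_R {i : ℤ} : ∀ {j : ℤ} (p : Path i j) (s : (D.F j).carrierᵐᵒᵖ) (x : (D.T p).carrier)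
    (_ : x ∈ D.R p), s • x ∈ D.R p
  | _, .nil, s, x, hx => by
      have : x = 0 := by simpa [R] using hx
      rw [this, smul_zero]; exact zero_mem _
  | _, .snoc .nil, s, x, hx => by
      have : x = 0 := by simpa [R] using hx
      rw [this, smul_zero]; exact zero_mem _
  | _, .snoc (.snoc (j := j) p), s, x, hx => by
      rw [R_snoc_snoc] at hx ⊢
      induction hx using Submodule.span_induction with
      | mem x h =>
        apply Submodule.subset_span
        rcases h with ⟨x, hx, n, rfl⟩ | ⟨x, q, hq, rfl⟩
        · exact Or.inl ⟨x, hx, s • n, rfl⟩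
        · exact Or.inr ⟨x, s • q, D.op_smul_mem _ _ _ hq, D.op_smul_snocT₂ _ _ _ _⟩
      | zero => rw [smul_zero]; exact zero_mem _
      | add x y _ _ h h' => rw [smul_add]; exact add_mem h h'
      | smul c x _ h => rw [← smul_comm]; exact Submodule.smul_mem _ _ h

theorem mulT_mem_R_left {i j : ℤ} (p : Path i j) (x : (D.T p).carrier) (hx : x ∈ D.R p) :
    ∀ {l : ℤ} (q : Path j l) (y : (D.T q).carrier), D.mulT p q x y ∈ D.R (p.comp q)
  | _, .nil, y => D.op_smul_mem_R p _ x hx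
  | _, .snoc (j := l) q, y => by
      induction y using T_induction with
      | h0 => rw [map_zero]; exact zero_mem _
      | h1 y n => exact D.snocT_mem_R _ _ (mulT_mem_R_left p x hx q y) n
      | h2 a b ha hb => rw [map_add]; exact add_mem ha hb

theorem mulT_mem_R_right {i j : ℤ} (p : Path i j) (x : (D.T p).carrier) :
    ∀ {l : ℤ} (q : Path j l) (y : (D.T q).carrier) (_ : y ∈ D.R q),
      D.mulT p q x y ∈ D.R (p.comp q)
  | _, .nil, y, hy => by
      have : y = 0 := by simpa [R] using hy
      rw [this, map_zero]; exact zero_mem _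
  | _, .snoc .nil, y, hy => by
      have : y = 0 := by simpa [R] using hy
      rw [this, map_zero]; exact zero_mem _
  | _, .snoc (.snoc (j := l) q), y, hy => by
      rw [R_snoc_snoc] at hy
      induction hy using Submodule.span_induction with
      | mem y h =>
        rcases h with ⟨y, hy, n, rfl⟩ | ⟨y, r, hr, rfl⟩
        · exact D.snocT_mem_R _ _ (mulT_mem_R_right p x q.snoc y hy) n
        · rw [mulT_snocT₂]
          change _ ∈ D.R (p.comp q).snoc.snoc
          rw [R_snoc_snoc]
          exact Submodule.subset_span (Or.inr ⟨_, r, hr, rfl⟩)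
      | zero => rw [map_zero]; exact zero_mem _
      | add a b _ _ ha hb => rw [map_add]; exact add_mem ha hb
      | smul c a _ ha => rw [map_smul]; exact Submodule.smul_mem _ _ ha

/-- The vector space `A_{ij}`: equal to `T_{ij} / R_{ij}` if `i ≤ j` (there is then exactly one
path from `i` to `j`) and to `0` otherwise (there is then no path). -/
abbrev A (i j : ℤ) : Type u := ⨁ p : Path i j, (D.T p).carrier ⧸ D.R p

/-- The class in `A_{ij}` of an element of `T_{ij}`. -/
noncomputable def cls {i j : ℤ} (p : Path i j) : (D.T p).carrier →ₗ[k] D.A i j :=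
  (lof k (Path i j) (fun p => (D.T p).carrier ⧸ D.R p) p).comp (D.R p).mkQ

theorem cls_eq_zero {i j : ℤ} (p : Path i j) (x : (D.T p).carrier) (hx : x ∈ D.R p) :
    D.cls p x = 0 := by
  change lof k _ (fun p => (D.T p).carrier ⧸ D.R p) p (Submodule.Quotient.mk x) = 0
  rw [(Submodule.Quotient.mk_eq_zero _).2 hx, map_zero]

/-- The multiplication `T_{ij} × T_{jl}/R_{jl} → A_{il}`. -/
noncomputable def mulQuotAux {i j l : ℤ} (p : Path i j) (q : Path j l) :
    ((D.T q).carrier ⧸ D.R q) →ₗ[k] (D.T p).carrier →ₗ[k] D.A i l :=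
  (D.R q).liftQ (M₂ := (D.T p).carrier →ₗ[k] D.A i l) ((D.mulT p q).compr₂ (D.cls (p.comp q))).flip (fun y hy =>
    LinearMap.ext fun x => D.cls_eq_zero _ _ (D.mulT_mem_R_right p x q y hy))

/-- The multiplication `T_{ij}/R_{ij} × T_{jl}/R_{jl} → A_{il}`. -/
noncomputable def mulQuot {i j l : ℤ} (p : Path i j) (q : Path j l) :
    ((D.T p).carrier ⧸ D.R p) →ₗ[k] ((D.T q).carrier ⧸ D.R q) →ₗ[k] D.A i l :=
  (D.R p).liftQ (M₂ := ((D.T q).carrier ⧸ D.R q) →ₗ[k] D.A i l) (D.mulQuotAux p q).flip (fun x hx => by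
    apply LinearMap.ext
    intro y
    obtain ⟨y, rfl⟩ := Submodule.Quotient.mk_surjective _ y
    exact D.cls_eq_zero _ _ (D.mulT_mem_R_left p x hx q y))

/-- The multiplication `A_{ij} × A_{jl} → A_{il}`. -/
noncomputable def mul (i j l : ℤ) : D.A i j →ₗ[k] D.A j l →ₗ[k] D.A i l :=
  toModule k _ _ fun p => (toModule k _ _ fun q => (D.mulQuot p q).flip).flip

theorem mul_cls {i j l : ℤ} (p : Path i j) (q : Path j l) (x : (D.T p).carrier)
    (y : (D.T q).carrier) :
    D.mul i j l (D.cls p x) (D.cls q y) = D.cls (p.comp q) (D.mulT p q x y) := by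
  simp [mul, cls, mulQuot, mulQuotAux]

/-- The local unit `e_i ∈ A_{ii}`. -/
noncomputable def one (i : ℤ) : D.A i i := D.cls .nil (D.oneT i)

theorem A_induction {i j : ℤ} {P : D.A i j → Prop} (h0 : P 0)
    (h1 : ∀ (p : Path i j) (x : (D.T p).carrier), P (D.cls p x))
    (h2 : ∀ x y, P x → P y → P (x + y)) (x : D.A i j) : P x := by
  induction x using DirectSum.induction_on with
  | zero => exact h0
  | of p x =>
    obtain ⟨x, rfl⟩ := Submodule.Quotient.mk_surjective _ x
    exact h1 p x
  | add x y hx hy => exact h2 x y hx hy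

/-- Transport of tensors along an equality of paths. -/
theorem cls_eq_of_heq {i j : ℤ} {p q : Path i j} (h : p = q) {x : (D.T p).carrier}
    {y : (D.T q).carrier} (hxy : HEq x y) : D.cls p x = D.cls q y := by
  subst h; rw [eq_of_heq hxy]

theorem snocT_heq {i j : ℤ} {p q : Path i j} (h : p = q) {x : (D.T p).carrier}
    {y : (D.T q).carrier} (hxy : HEq x y) (n : (D.N j).carrier) :
    HEq (D.snocT p x n) (D.snocT q y n) := by
  subst h; rw [eq_of_heq hxy]

theorem add_heq {i j : ℤ} {p q : Path i j} (h : p = q) {x x' : (D.T p).carrier}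
    {y y' : (D.T q).carrier} (hxy : HEq x y) (hxy' : HEq x' y') : HEq (x + x') (y + y') := by
  subst h; rw [eq_of_heq hxy, eq_of_heq hxy']

theorem zero_heq {i j : ℤ} {p q : Path i j} (h : p = q) :
    HEq (0 : (D.T p).carrier) (0 : (D.T q).carrier) := by
  subst h; rfl

theorem one_mulT {i : ℤ} : ∀ {j : ℤ} (p : Path i j) (x : (D.T p).carrier),
    HEq (D.mulT .nil p (D.oneT i) x) x
  | _, .nil, x => heq_of_eq (one_mul (M := (D.F i).carrier) x)
  | _, .snoc (j := j) p, x => by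
      induction x using T_induction with
      | h0 =>
        rw [map_zero]
        exact D.zero_heq (Path.nil_comp _)
      | h1 x n => exact D.snocT_heq (Path.nil_comp p) (one_mulT p x) n
      | h2 a b ha hb =>
        rw [map_add]
        exact D.add_heq (Path.nil_comp _) ha hb

theorem mulT_assoc {i j l : ℤ} (p : Path i j) (q : Path j l) (x : (D.T p).carrier)
    (y : (D.T q).carrier) : ∀ {m : ℤ} (r : Path l m) (z : (D.T r).carrier),
    HEq (D.mulT (p.comp q) r (D.mulT p q x y) z) (D.mulT p (q.comp r) x (D.mulT q r y z))
  | _, .nil, z => heq_of_eq (D.mulT_smul p q x y (op (α := (D.F l).carrier) z)).symm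
  | _, .snoc (j := j) r, z => by
      induction z using T_induction with
      | h0 =>
        rw [map_zero, map_zero, map_zero]
        exact D.zero_heq (Path.comp_assoc _ _ _)
      | h1 z n => exact D.snocT_heq (Path.comp_assoc p q r) (mulT_assoc p q x y r z) n
      | h2 a b ha hb =>
        rw [map_add, map_add, map_add]
        exact D.add_heq (Path.comp_assoc _ _ _) ha hb

theorem mul_assoc' {i j l m : ℤ} (a : D.A i j) (b : D.A j l) (c : D.A l m) :
    D.mul i l m (D.mul i j l a b) c = D.mul i j m a (D.mul j l m b c) := by
  induction a using A_induction with
  | h0 => simp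
  | h2 a a' h h' => simp only [map_add, LinearMap.add_apply, h, h']
  | h1 p x =>
  induction b using A_induction with
  | h0 => simp
  | h2 a a' h h' => simp only [map_add, LinearMap.add_apply, h, h']
  | h1 q y =>
  induction c using A_induction with
  | h0 => simp
  | h2 a a' h h' => simp only [map_add, h, h']
  | h1 r z =>
  simp only [mul_cls]
  exact D.cls_eq_of_heq (Path.comp_assoc _ _ _) (D.mulT_assoc _ _ _ _ _ _)

theorem one_mul' {i j : ℤ} (a : D.A i j) : D.mul i i j (D.one i) a = a := by
  induction a using A_induction with
  | h0 => simp
  | h2 a a' h h' => simp only [map_add, h, h']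
  | h1 p x =>
  rw [one, mul_cls]
  exact D.cls_eq_of_heq (Path.nil_comp _) (D.one_mulT _ _)

theorem mul_one' {i j : ℤ} (a : D.A i j) : D.mul i j j a (D.one j) = a := by
  induction a using A_induction with
  | h0 => simp
  | h2 a a' h h' => simp only [map_add, LinearMap.add_apply, h, h']
  | h1 p x =>
  rw [one, mul_cls]
  rw [mulT_oneT]; rfl

/-- The `ℤ`-algebra `A = ⊕ A_{ij}`, as the `k`-linear category with set of objects `ℤ`, morphism
spaces `Hom(i, j) = A_{ij}` and composition (in diagrammatic order) the multiplication
`A_{ij} × A_{jl} → A_{il}`. -/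
def Alg (_ : BimoduleSeq k) : Type := ℤ

/-- The integer `i` as an object of the `ℤ`-algebra, viewed as a category. -/
def pt (i : ℤ) : D.Alg := i

noncomputable instance : Category.{u} D.Alg where
  Hom i j := D.A i j
  id i := D.one i
  comp {i j l} a b := D.mul i j l a b
  id_comp a := D.one_mul' a
  comp_id a := D.mul_one' a
  assoc a b c := D.mul_assoc' a b c

noncomputable instance : Preadditive D.Alg where
  homGroup i j := inferInstanceAs (AddCommGroup (D.A i j))
  add_comp i j l a b c := LinearMap.congr_fun ((D.mul i j l).map_add a b) c
  comp_add i j l a b c := (D.mul i j l a).map_add b c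

noncomputable instance : Linear k D.Alg where
  homModule i j := inferInstanceAs (Module k (D.A i j))
  smul_comp i j l r a b := LinearMap.congr_fun ((D.mul i j l).map_smul r a) b
  comp_smul i j l a r b := (D.mul i j l a).map_smul r b


/-! ### Graded right modules -/

/-- The property that a functor from the `ℤ`-algebra to `k`-vector spaces is `k`-linear. -/
def isLinear : ObjectProperty (D.Alg ⥤ ModuleCat.{u} k) := fun M => M.Additive ∧ M.Linear k

instance : D.isLinear.IsClosedUnderSubobjects where
  prop_of_mono {M M'} f _ h := by
    have := h.1
    have := h.2
    have inj (j : D.Alg) : Mono (f.app j) := inferInstance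
    refine ⟨⟨fun {i j a b} => ?_⟩, ⟨fun {i j} a r => ?_⟩⟩
    · rw [← cancel_mono (f.app j)]
      simp [Functor.map_add]
    · rw [← cancel_mono (f.app j)]
      simp [Functor.map_smul]

instance : D.isLinear.IsClosedUnderQuotients where
  prop_of_epi {M M'} f _ h := by
    have := h.1
    have := h.2
    have inj (j : D.Alg) : Epi (f.app j) := inferInstance
    refine ⟨⟨fun {i j a b} => ?_⟩, ⟨fun {i j} a r => ?_⟩⟩
    · rw [← cancel_epi (f.app i)]
      simp [← NatTrans.naturality, Functor.map_add]
    · rw [← cancel_epi (f.app i)]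
      simp [← NatTrans.naturality, Functor.map_smul]

open scoped ZeroObject in
instance : D.isLinear.ContainsZero where
  exists_zero := ⟨0, Limits.isZero_zero _,
    ⟨⟨fun {i _ _ _} => (Limits.isZero_zero (D.Alg ⥤ ModuleCat.{u} k)).obj i |>.eq_of_src _ _⟩,
      ⟨fun {i _} _ _ => (Limits.isZero_zero (D.Alg ⥤ ModuleCat.{u} k)).obj i |>.eq_of_src _ _⟩⟩⟩

instance (J : Type) [Category.{0} J] : D.isLinear.IsClosedUnderLimitsOfShape J where
  limitsOfShape_le := by
    rintro M ⟨p⟩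
    have ha := fun j => (p.prop_diag_obj j).1
    have hl := fun j => (p.prop_diag_obj j).2
    have hc (i : D.Alg) := Limits.isLimitOfPreserves ((evaluation _ _).obj i) p.isLimit
    refine ⟨⟨fun {i j a b} => ?_⟩, ⟨fun {i j} a r => ?_⟩⟩
    · refine (hc j).hom_ext fun t => ?_
      have := ha t
      change M.map (a + b) ≫ (p.π.app t).app j = (M.map a + M.map b) ≫ (p.π.app t).app j
      rw [Preadditive.add_comp, NatTrans.naturality, NatTrans.naturality, NatTrans.naturality]
      rw [Functor.map_add, Preadditive.comp_add]
    · refine (hc j).hom_ext fun t => ?_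
      have := ha t
      have := hl t
      change M.map (r • a) ≫ (p.π.app t).app j = (r • M.map a) ≫ (p.π.app t).app j
      rw [Linear.smul_comp, NatTrans.naturality, NatTrans.naturality]
      rw [Functor.map_smul, Linear.comp_smul]

instance : D.isLinear.IsClosedUnderFiniteProducts where

instance (J : Type u) [Category.{u} J] : D.isLinear.IsClosedUnderColimitsOfShape J where
  colimitsOfShape_le := by
    rintro M ⟨p⟩
    have ha := fun j => (p.prop_diag_obj j).1
    have hl := fun j => (p.prop_diag_obj j).2
    have hc (i : D.Alg) := Limits.isColimitOfPreserves ((evaluation _ _).obj i) p.isColimit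
    have nat (t : J) {i j : D.Alg} (a : i ⟶ j) : (p.ι.app t).app i ≫ M.map a =
        (p.diag.obj t).map a ≫ (p.ι.app t).app j := ((p.ι.app t).naturality a).symm
    refine ⟨⟨fun {i j a b} => ?_⟩, ⟨fun {i j} a r => ?_⟩⟩
    · refine (hc i).hom_ext fun t => ?_
      have := ha t
      change (p.ι.app t).app i ≫ M.map (a + b) = (p.ι.app t).app i ≫ (M.map a + M.map b)
      rw [Preadditive.comp_add, nat, nat, nat,
        Functor.map_add, Preadditive.add_comp]
    · refine (hc i).hom_ext fun t => ?_
      have := ha t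
      have := hl t
      change (p.ι.app t).app i ≫ M.map (r • a) = (p.ι.app t).app i ≫ (r • M.map a)
      rw [Linear.comp_smul, nat, nat,
        Functor.map_smul, Linear.smul_comp]

/-- The category of graded right modules over the `ℤ`-algebra `A = ⊕ A_{ij}`: families of vector
spaces `M_i`, `i : ℤ`, with an associative unital action `M_i ⊗ A_{ij} → M_j`, that is,
`k`-linear functors `i ↦ M_i` from `A` to `k`-vector spaces. -/
abbrev GrMod : Type (u + 1) := D.isLinear.FullSubcategory



noncomputable instance : Abelian D.GrMod := inferInstance
noncomputable instance : Linear k D.GrMod := inferInstance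

variable {D}

/-- The component `M_i` of a graded module. -/
abbrev GrMod.deg (M : D.GrMod) (i : D.Alg) : ModuleCat.{u} k := M.obj.obj i

/-- A graded module `M` is right bounded if `M_i = 0` for all `i ≫ 0`. -/
def rightBounded : ObjectProperty D.GrMod := fun M =>
  ∃ n : ℤ, ∀ i : ℤ, n ≤ i → Limits.IsZero (M.deg (D.pt i))

/-- The torsion modules: (filtered) direct limits of right bounded modules. -/
def tors : ObjectProperty D.GrMod := ObjectProperty.ind.{u} rightBounded

/-- `x ∈ M_i` satisfies `x A_{ij} = 0` for `j ≫ 0`. -/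
def IsKilled (M : D.GrMod) {i : D.Alg} (x : M.deg i) : Prop :=
  ∃ n : ℤ, ∀ j : ℤ, n ≤ j → ∀ a : i ⟶ D.pt j, M.obj.map a x = 0

theorem isKilled_of_rightBounded {M : D.GrMod} (h : rightBounded M) {i : D.Alg} (x : M.deg i) :
    IsKilled M x := by
  obtain ⟨n, hn⟩ := h
  refine ⟨n, fun j hj a => ?_⟩
  have := ModuleCat.subsingleton_of_isZero (hn j hj)
  exact Subsingleton.elim _ _

theorem IsKilled.map {M M' : D.GrMod} (f : M ⟶ M') {i : D.Alg} {x : M.deg i}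
    (h : IsKilled M x) : IsKilled M' (f.hom.app i x) := by
  obtain ⟨n, hn⟩ := h
  refine ⟨n, fun j hj a => ?_⟩
  rw [← NatTrans.naturality_apply, hn j hj a, map_zero]

instance (i : D.Alg) : Limits.PreservesColimitsOfSize.{u, u}
    (D.isLinear.ι ⋙ (evaluation _ _).obj i) where
  preservesColimitsOfShape := inferInstance

theorem isKilled_of_tors {M : D.GrMod} (h : tors M) {i : D.Alg} (x : M.deg i) :
    IsKilled M x := by
  obtain ⟨J, _, _, pres, hp⟩ := h
  have hc := Limits.isColimitOfPreserves (D.isLinear.ι ⋙ (evaluation _ _).obj i) pres.isColimit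
  obtain ⟨j, y, rfl⟩ := Limits.Concrete.isColimit_exists_rep _ hc x
  exact (isKilled_of_rightBounded (hp j) y).map (pres.ι.app j)

/-- The right bounded graded submodules of a graded module. -/
@[ext]
structure BddSub (M : D.GrMod) : Type u where
  sub : ∀ i : D.Alg, Submodule k (M.deg i)
  map_mem : ∀ {i j : D.Alg} (a : i ⟶ j) (x : M.deg i), x ∈ sub i → M.obj.map a x ∈ sub j
  bdd : ∃ n : ℤ, ∀ i : ℤ, n ≤ i → sub i = ⊥

namespace BddSub

variable {M : D.GrMod}

instance : PartialOrder (BddSub M) := PartialOrder.lift sub fun _ _ => BddSub.ext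

instance : Nonempty (BddSub M) :=
  ⟨⟨fun _ => ⊥, fun a x hx => by rw [(Submodule.mem_bot k).1 hx, map_zero]; exact zero_mem _,
    0, fun _ _ => rfl⟩⟩

instance : IsDirectedOrder (BddSub M) where
  directed S S' := by
    obtain ⟨n, hn⟩ := S.bdd
    obtain ⟨n', hn'⟩ := S'.bdd
    refine ⟨⟨fun i => S.sub i ⊔ S'.sub i, fun {i j} a x hx => ?_, max n n', fun i hi => ?_⟩,
      fun i => le_sup_left, fun i => le_sup_right⟩
    · obtain ⟨y, hy, z, hz, rfl⟩ := Submodule.mem_sup.1 hx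
      rw [map_add]
      exact Submodule.add_mem_sup (S.map_mem a y hy) (S'.map_mem a z hz)
    · rw [hn i (by lia), hn' i (by lia), bot_sup_eq]

/-- A right bounded submodule as a graded module. -/
noncomputable def toGrMod (S : BddSub M) : D.GrMod where
  obj :=
    { obj := fun i => ModuleCat.of k (S.sub i)
      map := fun {i j} a => ModuleCat.ofHom ((M.obj.map a).hom.restrict (S.map_mem a))
      map_id := fun i => ModuleCat.hom_ext (LinearMap.ext fun x =>
        Subtype.ext (congrArg (fun f => f.hom x.1) (M.obj.map_id i)))
      map_comp := fun a b => ModuleCat.hom_ext (LinearMap.ext fun x =>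
        Subtype.ext (congrArg (fun f => f.hom x.1) (M.obj.map_comp a b))) }
  property := by
    have := M.property.1
    have := M.property.2
    refine ⟨⟨fun {i j a b} => ?_⟩, ⟨fun {i j} a r => ?_⟩⟩
    · exact ModuleCat.hom_ext (LinearMap.ext fun x =>
        Subtype.ext (congrArg (fun f => f.hom x.1) (M.obj.map_add (f := a) (g := b))))
    · exact ModuleCat.hom_ext (LinearMap.ext fun x =>
        Subtype.ext (congrArg (fun f => f.hom x.1) (M.obj.map_smul r a)))

/-- The inclusion of a right bounded submodule. -/
noncomputable def incl (S : BddSub M) : S.toGrMod ⟶ M :=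
  ObjectProperty.homMk
    { app := fun i => ModuleCat.ofHom (S.sub i).subtype
      naturality := fun _ _ _ => rfl }

/-- The inclusion between right bounded submodules. -/
noncomputable def inclLE {S S' : BddSub M} (h : S ≤ S') : S.toGrMod ⟶ S'.toGrMod :=
  ObjectProperty.homMk
    { app := fun i => ModuleCat.ofHom (Submodule.inclusion (h i))
      naturality := fun _ _ _ => rfl }

/-- The diagram of right bounded submodules. -/
noncomputable def diagram (M : D.GrMod) : BddSub M ⥤ D.GrMod where
  obj S := S.toGrMod
  map f := inclLE (leOfHom f)

/-- The cocone over the diagram of right bounded submodules. -/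
noncomputable def cocone (M : D.GrMod) : diagram M ⟶ (Functor.const _).obj M where
  app S := S.incl
  naturality _ _ _ := rfl

theorem exists_mem {i : D.Alg} (x : M.deg i) (h : IsKilled M x) :
    ∃ S : BddSub M, x ∈ S.sub i := by
  have := M.property.1
  have := M.property.2
  obtain ⟨n, hn⟩ := h
  let act (j : D.Alg) : (i ⟶ j) →ₗ[k] M.deg j :=
    { toFun := fun a => M.obj.map a x
      map_add' := fun a b => by rw [M.obj.map_add]; rfl
      map_smul' := fun r a => by rw [M.obj.map_smul]; rfl }
  have hb (j : D.Alg) (hj : n ≤ (show ℤ from j)) : LinearMap.range (act j) = ⊥ := by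
    rw [LinearMap.range_eq_bot]
    exact LinearMap.ext fun a => hn j hj a
  refine ⟨⟨fun j => LinearMap.range (act j), ?_, n, fun j hj => hb j hj⟩, 𝟙 i, ?_⟩
  · rintro j l a _ ⟨b, rfl⟩
    refine ⟨b ≫ a, ?_⟩
    change M.obj.map (b ≫ a) x = M.obj.map a (M.obj.map b x)
    rw [M.obj.map_comp]; rfl
  · change M.obj.map (𝟙 i) x = x
    rw [M.obj.map_id]; rfl

/-- A graded module all of whose elements are killed is the colimit of its right bounded
submodules. -/
noncomputable def isColimit (h : ∀ (i : D.Alg) (x : M.deg i), IsKilled M x) :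
    Limits.IsColimit (Limits.Cocone.mk M (cocone M)) := by
  choose S hS using fun (i : D.Alg) (x : M.deg i) => exists_mem x (h i x)
  have key (s : Limits.Cocone (diagram M)) (i : D.Alg) (x : M.deg i) (T T' : BddSub M)
      (hx : x ∈ T.sub i) (hx' : x ∈ T'.sub i) :
      (s.ι.app T).hom.app i ⟨x, hx⟩ = (s.ι.app T').hom.app i ⟨x, hx'⟩ := by
    obtain ⟨U, hU, hU'⟩ := exists_ge_ge T T'
    rw [← s.w (homOfLE hU), ← s.w (homOfLE hU')]
    rfl
  have key' (s : Limits.Cocone (diagram M)) (T : BddSub M) {i j : D.Alg} (a : i ⟶ j)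
      (x : M.deg i) (hx : x ∈ T.sub i) :
      (s.ι.app T).hom.app j ⟨M.obj.map a x, T.map_mem a x hx⟩ =
        s.pt.obj.map a ((s.ι.app T).hom.app i ⟨x, hx⟩) :=
    NatTrans.naturality_apply (s.ι.app T).hom a (⟨x, hx⟩ : T.sub i)
  refine
    { desc := fun s => ObjectProperty.homMk
        { app := fun i => ModuleCat.ofHom
            { toFun := fun x => (s.ι.app (S i x)).hom.app i ⟨x, hS i x⟩
              map_add' := fun x y => ?_
              map_smul' := fun r x => ?_ }
          naturality := fun i j a => ?_ }
      fac := fun s T => ?_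
      uniq := fun s m hm => ?_ }
  · obtain ⟨U, hU, hU'⟩ := exists_ge_ge (S i x) (S i y)
    rw [key s i x (S i x) U (hS i x) (hU i (hS i x)), key s i y (S i y) U (hS i y) (hU' i (hS i y)),
      key s i (x + y) _ U (hS i _) (add_mem (hU i (hS i x)) (hU' i (hS i y)))]
    exact LinearMap.map_add ((s.ι.app U).hom.app i).hom (⟨x, hU i (hS i x)⟩ : U.sub i)
      ⟨y, hU' i (hS i y)⟩
  · rw [key s i (r • x) _ (S i x) (hS i _) (Submodule.smul_mem _ r (hS i x))]
    exact LinearMap.map_smul ((s.ι.app (S i x)).hom.app i).hom r (⟨x, hS i x⟩ : (S i x).sub i)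
  · ext x
    exact (key s j (M.obj.map a x) (S j (M.obj.map a x)) (S i x) (hS _ _)
      ((S i x).map_mem a x (hS i x))).trans
      (key' s (S i x) a x (hS i x))
  · apply ObjectProperty.hom_ext
    ext i x
    exact key s i x.1 _ T _ x.2
  · apply ObjectProperty.hom_ext
    ext i x
    have := congrArg (fun f => f.hom.app i ⟨x, hS i x⟩) (hm (S i x))
    exact this

end BddSub

/-- A graded module is torsion if and only if each of its elements is killed by `A_{ij}`
for `j ≫ 0`. -/
theorem tors_iff (M : D.GrMod) : tors M ↔ ∀ (i : D.Alg) (x : M.deg i), IsKilled M x := by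
  refine ⟨fun h i x => isKilled_of_tors h x, fun h => ?_⟩
  refine ⟨BddSub M, inferInstance, inferInstance,
    ⟨BddSub.diagram M, BddSub.cocone M, BddSub.isColimit h⟩, fun S => ?_⟩
  obtain ⟨n, hn⟩ := S.bdd
  refine ⟨n, fun i hi => ?_⟩
  have : Subsingleton (S.sub i) := (Submodule.subsingleton_iff_eq_bot).2 (hn i hi)
  exact ModuleCat.isZero_of_subsingleton (ModuleCat.of k (S.sub i))

/-! ### Torsion modules form a Serre subcategory -/

variable (D) in
/-- Each `N_i` is finitely generated as a right module. -/
class RightFinite : Prop where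
  finite : ∀ i : ℤ, Module.Finite (D.F (i + 1)).carrierᵐᵒᵖ (D.N i).carrier

theorem T_finite [D.RightFinite] {i : ℤ} : ∀ {j : ℤ} (p : Path i j),
    Module.Finite (D.F j).carrierᵐᵒᵖ (D.T p).carrier
  | _, .nil => ⟨⟨{D.oneT i}, by
      rw [Finset.coe_singleton, eq_top_iff]
      intro x _
      exact Submodule.mem_span_singleton.2 ⟨op (α := (D.F i).carrier) x,
        one_mul (M := (D.F i).carrier) x⟩⟩⟩
  | _, .snoc (j := j) p => finite_tensor (T_finite p) (RightFinite.finite j)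

theorem mulT_span {i j : ℤ} (p : Path i j) : ∀ {l : ℤ} (q : Path j l)
    (z : (D.T (p.comp q)).carrier),
    z ∈ Submodule.span k {z | ∃ x y, z = D.mulT p q x y}
  | _, .nil, z => Submodule.subset_span ⟨z, D.oneT j, (D.mulT_oneT p z).symm⟩
  | _, .snoc (j := l) q, z => by
      change (D.T (p.comp q).snoc).carrier at z
      induction z using T_induction with
      | h0 => exact zero_mem _
      | h2 a b ha hb => exact add_mem ha hb
      | h1 z n =>
        have hz := mulT_span p q z
        induction hz using Submodule.span_induction with
        | mem z h =>
          obtain ⟨x, y, rfl⟩ := h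
          exact Submodule.subset_span ⟨x, D.snocT q y n, rfl⟩
        | zero => rw [map_zero, LinearMap.zero_apply]; exact zero_mem _
        | add a b _ _ ha hb => rw [map_add, LinearMap.add_apply]; exact add_mem ha hb
        | smul c a _ ha => rw [map_smul, LinearMap.smul_apply]; exact Submodule.smul_mem _ c ha

variable (D) in
/-- The class of an element of `T_{ij}` as a morphism `i ⟶ j`. -/
noncomputable def hom {i j : ℤ} (p : Path i j) : (D.T p).carrier →ₗ[k] (D.pt i ⟶ D.pt j) :=
  D.cls p

theorem hom_comp {i j l : ℤ} (p : Path i j) (q : Path j l) (x : (D.T p).carrier)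
    (y : (D.T q).carrier) : D.hom p x ≫ D.hom q y = D.hom (p.comp q) (D.mulT p q x y) :=
  D.mul_cls p q x y

theorem hom_induction {i j : ℤ} {P : (D.pt i ⟶ D.pt j) → Prop} (h0 : P 0)
    (h1 : ∀ (p : Path i j) (x : (D.T p).carrier), P (D.hom p x))
    (h2 : ∀ x y, P x → P y → P (x + y)) (x : D.pt i ⟶ D.pt j) : P x :=
  D.A_induction (P := P) h0 h1 h2 x

theorem map_hom_hom {M : D.GrMod} {i j l : ℤ} (p : Path i j) (q : Path j l) (x : (D.T p).carrier)
    (y : (D.T q).carrier) (m : M.deg (D.pt i)) :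
    M.obj.map (D.hom q y) (M.obj.map (D.hom p x) m) =
      M.obj.map (D.hom (p.comp q) (D.mulT p q x y)) m := by
  rw [← hom_comp, M.obj.map_comp]; rfl

/-- If `x A_{in}` consists of killed elements for some `n`, then `x` is killed. -/
theorem isKilled_of_forall_map [D.RightFinite] {M : D.GrMod} {i n : ℤ} (p : Path i n)
    (x : M.deg (D.pt i)) (h : ∀ t : (D.T p).carrier, IsKilled M (M.obj.map (D.hom p t) x)) :
    IsKilled M x := by
  have := M.property.1
  have := M.property.2
  obtain ⟨s, hs⟩ := (T_finite (D := D) p).fg_top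
  choose m hm using h
  obtain ⟨b, hb⟩ := (s.image m).bddAbove
  refine ⟨max n b, fun j hj a => ?_⟩
  have hgen (q : Path n j) (t : (D.T p).carrier) (y : (D.T q).carrier) :
      M.obj.map (D.hom (p.comp q) (D.mulT p q t y)) x = 0 := by
    have ht : t ∈ Submodule.span (D.F n).carrierᵐᵒᵖ (s : Set (D.T p).carrier) := by
      rw [hs]; trivial
    induction ht using Submodule.span_induction generalizing y with
    | mem t ht =>
      rw [← map_hom_hom]
      exact hm t j ((hb (Finset.mem_coe.2 (Finset.mem_image_of_mem m ht))).trans (by lia)) _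
    | zero => rw [map_zero, LinearMap.zero_apply, map_zero, M.obj.map_zero]; rfl
    | add a b _ _ ha hb =>
      rw [map_add, LinearMap.add_apply, map_add, M.obj.map_add]
      change M.obj.map _ x + M.obj.map _ x = 0
      rw [ha, hb, add_zero]
    | smul c a _ ha =>
      rw [← op_unop c, mulT_op_smul]
      exact ha _
  induction a using hom_induction with
  | h0 => rw [M.obj.map_zero]; rfl
  | h2 a b ha hb =>
    rw [M.obj.map_add]
    change M.obj.map _ x + M.obj.map _ x = 0
    rw [ha, hb, add_zero]
  | h1 r z =>
    obtain ⟨q⟩ := Path.exists_path (show n ≤ j by lia)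
    obtain rfl : r = p.comp q := Subsingleton.elim _ _
    have hz := mulT_span p q z
    induction hz using Submodule.span_induction with
    | mem z hz =>
      obtain ⟨t, y, rfl⟩ := hz
      exact hgen q t y
    | zero => rw [map_zero, M.obj.map_zero]; rfl
    | add a b _ _ ha hb =>
      rw [map_add, M.obj.map_add]
      change M.obj.map _ x + M.obj.map _ x = 0
      rw [ha, hb, add_zero]
    | smul c a _ ha =>
      rw [map_smul, M.obj.map_smul]
      change c • M.obj.map _ x = 0
      rw [ha, smul_zero]

/-- Evaluation at `i`, as an exact functor. -/
noncomputable abbrev evalFunctor (i : D.Alg) : D.GrMod ⥤ ModuleCat.{u} k :=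
  D.isLinear.ι ⋙ (evaluation _ _).obj i

instance : Limits.PreservesFiniteLimits D.isLinear.ι :=
  have := D.isLinear.preservesKernels_ι
  D.isLinear.ι.preservesFiniteLimits_of_preservesKernels

instance : Limits.PreservesFiniteColimits D.isLinear.ι :=
  have := D.isLinear.preservesCokernels_ι
  D.isLinear.ι.preservesFiniteColimits_of_preservesCokernels

open scoped ZeroObject in
instance [D.RightFinite] : (tors (D := D)).IsSerreClass where
  exists_zero := by
    refine ⟨0, Limits.isZero_zero _, (tors_iff _).2 fun i x => ⟨0, fun j _ a => ?_⟩⟩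
    have : Limits.IsZero ((evalFunctor (D.pt j)).obj 0) :=
      (evalFunctor (D.pt j)).map_isZero (Limits.isZero_zero _)
    have : Subsingleton ((0 : D.GrMod).deg (D.pt j)) := ModuleCat.subsingleton_of_isZero this
    exact Subsingleton.elim _ _
  prop_of_mono {X Y} f _ h := by
    rw [tors_iff] at h ⊢
    intro i x
    obtain ⟨n, hn⟩ := h i (f.hom.app i x)
    refine ⟨n, fun j hj a => ?_⟩
    have inj : Function.Injective ((evalFunctor (D.pt j)).map f) :=
      (ModuleCat.mono_iff_injective _).1 inferInstance
    apply inj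
    change f.hom.app (D.pt j) (X.obj.map a x) = f.hom.app (D.pt j) 0
    rw [NatTrans.naturality_apply, hn j hj a, map_zero]
  prop_of_epi {X Y} f _ h := by
    rw [tors_iff] at h ⊢
    intro i y
    have surj : Function.Surjective ((evalFunctor i).map f) :=
      (ModuleCat.epi_iff_surjective _).1 inferInstance
    obtain ⟨x, rfl⟩ := surj y
    exact (h i x).map f
  prop_X₂_of_shortExact {S} hS h₁ h₃ := by
    rw [tors_iff] at h₁ h₃ ⊢
    intro i x
    change ℤ at i
    change S.X₂.deg (D.pt i) at x
    obtain ⟨n, hn⟩ := h₃ _ (S.g.hom.app (D.pt i) x)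
    obtain ⟨p⟩ := Path.exists_path (le_max_left i n)
    refine isKilled_of_forall_map p x fun t => ?_
    have ex := (ShortComplex.moduleCat_exact_iff _).1
      (hS.exact.map (evalFunctor (D.pt (max i n))))
    obtain ⟨y, hy⟩ := ex (S.X₂.obj.map (D.hom p t) x) (by
      change S.g.hom.app _ (S.X₂.obj.map (D.hom p t) x) = 0
      rw [NatTrans.naturality_apply]
      exact hn _ (le_max_right _ _) _)
    rw [← hy]
    exact (h₁ _ y).map S.f

/-- The quotient category of graded right modules modulo torsion modules: the localization at the
morphisms whose kernel and cokernel are torsion. -/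
abbrev QGr (D : BimoduleSeq k) [D.RightFinite] : Type (u + 1) :=
  (tors (D := D)).isoModSerre.Localization

end BimoduleSeq

namespace Bimodule

variable {k : Type u} [Field k] {R S T : Type u} [Ring R] [Algebra k R] [Ring S] [Algebra k S]
  [Ring T] [Algebra k T]

/-! ### Noncommutative symmetric algebras and noncommutative `ℙ¹`-bundles -/

/-- An `R`-`S`-bimodule `N` is admissible if `N^{i*}` is finitely generated projective on each
side for all `i : ℤ`. -/
def Admissible (N : Bimodule k R S) : Prop :=
  ∀ i : ℤ, (iterDual (R := ⟨R⟩) (S := ⟨S⟩) N i).IsFGProjective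

/-- The data defining the noncommutative symmetric algebra `𝕊^{nc}(N)`: the rings `F_i`, the
bimodules `N^{i*}` and the relations `Q_i ⊆ N^{i*} ⊗ N^{(i+1)*}`. The `ℤ`-algebra itself is
`(ncSym N).Alg`. -/
noncomputable def ncSym (N : Bimodule k R S) : BimoduleSeq k where
  F := base ⟨R⟩ ⟨S⟩
  N := iterDual (R := ⟨R⟩) (S := ⟨S⟩) N
  Q := unitRel (R := ⟨R⟩) (S := ⟨S⟩) N
  op_smul_mem := op_smul_mem_unitRel (R := ⟨R⟩) (S := ⟨S⟩) N

theorem Admissible.rightFinite {N : Bimodule k R S} (h : N.Admissible) : N.ncSym.RightFinite :=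
  ⟨fun i => (h i).finite_right⟩

/-- The noncommutative `ℙ¹`-bundle `ℙ^{nc}(N)` of an admissible bimodule `N`: the category of graded
right `𝕊^{nc}(N)`-modules modulo the direct limits of right bounded modules. -/
def Pnc (N : Bimodule k R S) (h : N.Admissible) : Type (u + 1) :=
  haveI := h.rightFinite
  N.ncSym.QGr

noncomputable instance (N : Bimodule k R S) (h : N.Admissible) : Category.{u + 1} (N.Pnc h) :=
  haveI := h.rightFinite
  inferInstanceAs (Category N.ncSym.QGr)

noncomputable instance (N : Bimodule k R S) (h : N.Admissible) : Preadditive (N.Pnc h) :=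
  haveI := h.rightFinite
  inferInstanceAs (Preadditive N.ncSym.QGr)

noncomputable instance (N : Bimodule k R S) (h : N.Admissible) : Linear k (N.Pnc h) :=
  haveI := h.rightFinite
  inferInstanceAs (Linear k N.ncSym.QGr)

/-! ### Morita equivalences given by tensoring with a bimodule -/

/-- The map `f ⊗ L : M ⊗_S L → M' ⊗_S L`. -/
noncomputable def mapTensor {M M' : Bimodule k R S} (f : M.carrier →ₗ[k] M'.carrier)
    (hf : ∀ (s : Sᵐᵒᵖ) m, f (s • m) = s • f m) (L : Bimodule k S T) :
    (M.tensor L).carrier →ₗ[k] (M'.tensor L).carrier :=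
  lift ((mkTensor M' L).comp f) fun m s n => by
    change tmul (f (op s • m)) n = tmul (f m) (s • n)
    rw [hf, tmul_balanced]

/-- The map `P ⊗ f : P ⊗_S M → P ⊗_S M'`. -/
noncomputable def tensorMap (P : Bimodule k R S) {M M' : Bimodule k S T}
    (f : M.carrier →ₗ[k] M'.carrier) (hf : ∀ (s : S) m, f (s • m) = s • f m) :
    (P.tensor M).carrier →ₗ[k] (P.tensor M').carrier :=
  lift ((mkTensor P M').compl₂ f) fun m s n => by
    change tmul (op s • m) (f n) = tmul m (f (s • n))
    rw [hf, tmul_balanced]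

/-- A right `S`-module as a `k`-`S`-bimodule. -/
def ofRight (k : Type u) [Field k] {S : Type u} [Ring S] [Algebra k S]
    (M : ModuleCat.{u} Sᵐᵒᵖ) : Bimodule k k S :=
  letI : Module k M := Module.compHom M (algebraMap k Sᵐᵒᵖ)
  { carrier := M
    smulComm := ⟨fun r s m => by
      change algebraMap k Sᵐᵒᵖ r • s • m = s • algebraMap k Sᵐᵒᵖ r • m
      rw [← mul_smul, ← mul_smul, Algebra.commutes]⟩
    towerLeft := ⟨fun a b m => mul_smul (α := k) a b m⟩
    towerRight := ⟨fun a s m => by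
      change (a • s) • m = algebraMap k Sᵐᵒᵖ a • s • m
      rw [Algebra.smul_def, mul_smul]⟩ }

/-- A left `R`-module as an `R`-`k`-bimodule. -/
def ofLeft (k : Type u) [Field k] {R : Type u} [Ring R] [Algebra k R]
    (M : ModuleCat.{u} R) : Bimodule k R k :=
  letI : Module k M := Module.compHom M (algebraMap k R)
  letI : Module kᵐᵒᵖ M := Module.compHom M
    ((RingHom.id k).fromOpposite fun x y => mul_comm (id x) (id y))
  { carrier := M
    smulComm := ⟨fun r s m => by
      change r • algebraMap k R s.unop • m = algebraMap k R s.unop • r • m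
      rw [← mul_smul, ← mul_smul, Algebra.commutes]⟩
    towerLeft := ⟨fun a s m => by
      change (a • s) • m = algebraMap k R a • s • m
      rw [Algebra.smul_def, mul_smul]⟩
    towerRight := ⟨fun a b m => mul_smul (α := k) a b.unop m⟩ }

/-- The functor `- ⊗_S L : Mod S → Mod T` between categories of right modules. -/
noncomputable def rightTensorFunctor (L : Bimodule k S T) :
    ModuleCat.{u} Sᵐᵒᵖ ⥤ ModuleCat.{u} Tᵐᵒᵖ where
  obj M := ModuleCat.of Tᵐᵒᵖ ((ofRight k M).tensor L).carrier
  map {M M'} f := ModuleCat.ofHom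
    { toFun := mapTensor (M := ofRight k M) (M' := ofRight k M')
        { toFun := f.hom
          map_add' := f.hom.map_add
          map_smul' := fun c m => f.hom.map_smul (algebraMap k Sᵐᵒᵖ c) m }
        (fun s m => f.hom.map_smul s m) L
      map_add' := fun x y => map_add _ x y
      map_smul' := fun t x => by
        induction x using tensor_induction with
        | h0 => rw [smul_zero, map_zero, smul_zero]
        | h1 m n => rfl
        | h2 x y hx hy => rw [smul_add, map_add, map_add, hx, hy, smul_add] }
  map_id M := by
    apply ModuleCat.hom_ext
    apply LinearMap.ext
    intro x
    induction x using tensor_induction (M := ofRight k M) (N := L) with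
    | h0 => exact map_zero _
    | h1 m n => rfl
    | h2 x y hx hy => rw [map_add, hx, hy]; rfl
  map_comp f g := by
    apply ModuleCat.hom_ext
    apply LinearMap.ext
    intro x
    induction x using tensor_induction (M := ofRight k _) (N := L) with
    | h0 => rw [map_zero, map_zero]
    | h1 m n => rfl
    | h2 x y hx hy => rw [map_add, hx, hy, map_add]

/-- The functor `P ⊗_S - : S-Mod → R-Mod` between categories of left modules. -/
noncomputable def leftTensorFunctor (P : Bimodule k R S) :
    ModuleCat.{u} S ⥤ ModuleCat.{u} R where
  obj M := ModuleCat.of R (P.tensor (ofLeft k M)).carrier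
  map {M M'} f := ModuleCat.ofHom
    { toFun := tensorMap P (M := ofLeft k M) (M' := ofLeft k M')
        { toFun := f.hom
          map_add' := f.hom.map_add
          map_smul' := fun c m => f.hom.map_smul (algebraMap k S c) m }
        (fun s m => f.hom.map_smul s m)
      map_add' := fun x y => map_add _ x y
      map_smul' := fun t x => by
        induction x using tensor_induction with
        | h0 => rw [smul_zero, map_zero, smul_zero]
        | h1 m n => rfl
        | h2 x y hx hy => rw [smul_add, map_add, map_add, hx, hy, smul_add] }
  map_id M := by
    apply ModuleCat.hom_ext
    apply LinearMap.ext
    intro x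
    induction x using tensor_induction (M := P) (N := ofLeft k M) with
    | h0 => exact map_zero _
    | h1 m n => rfl
    | h2 x y hx hy => rw [map_add, hx, hy]; rfl
  map_comp f g := by
    apply ModuleCat.hom_ext
    apply LinearMap.ext
    intro x
    induction x using tensor_induction (M := P) (N := ofLeft k _) with
    | h0 => rw [map_zero, map_zero]
    | h1 m n => rfl
    | h2 x y hx hy => rw [map_add, hx, hy, map_add]

/-- The `R'`-`S'`-bimodule with the same underlying set as `N` and with actions
`a · n · b = φ₁⁻¹(a) n φ₂⁻¹(b)`. -/
def twist {R' S' : Type u} [Ring R'] [Algebra k R'] [Ring S'] [Algebra k S']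
    (N : Bimodule k R S) (φ₁ : R ≃ₐ[k] R') (φ₂ : S ≃ₐ[k] S') : Bimodule k R' S' :=
  letI : Module R' N.carrier := Module.compHom N.carrier (φ₁.symm : R' →+* R)
  letI : Module S'ᵐᵒᵖ N.carrier := Module.compHom N.carrier (RingHom.op (φ₂.symm : S' →+* S))
  { carrier := N.carrier
    smulComm := ⟨fun a b n => smul_comm (φ₁.symm a) (op (φ₂.symm b.unop)) n⟩
    towerLeft := ⟨fun c a n => by
      change φ₁.symm (c • a) • n = c • φ₁.symm a • n
      rw [map_smul, smul_assoc]⟩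
    towerRight := ⟨fun c b n => by
      change op (φ₂.symm (c • b.unop)) • n = c • op (φ₂.symm b.unop) • n
      rw [map_smul, op_smul, smul_assoc]⟩ }

end Bimodule

/-- Two `k`-linear categories are `k`-linearly equivalent. -/
def LinearlyEquivalent (k : Type*) [Field k] (C C' : Type*) [Category* C] [Preadditive C]
    [Linear k C] [Category* C'] [Preadditive C'] [Linear k C'] : Prop :=
  ∃ e : C ≌ C', e.functor.Additive ∧ e.functor.Linear k

end NCP1

/-!
The category `ℙ^{nc}(N)` depends only on the functor `- ⊗_R N`, up to `k`-linear equivalences of its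
source and its target (`Bimodule.Admissible.linearlyEquivalent`). Given equivalences
`e : Mod R ≌ Mod R'` and `f : Mod S ≌ Mod S'` and an isomorphism `θ` between `e` followed by `- ⊗ N'`
and `- ⊗ N` followed by `f`, the argument is as follows.

* If `N^{i*}` is finitely generated projective on each side, tensoring with the next dual is right
  adjoint to tensoring with `N^{i*}`, and the relations `Q_i` are the multiples of the canonical
  element `∑ x_j ⊗ y_j`, that is, of the image of `1` under the unit (`mem_unitRight_iff`,
  `mem_unitLeft_iff`). Adjoints of corresponding functors correspond, so taking mates transports `θ`
  to all iterated duals (`isoInt`), compatibly with the units (`unit_rightMate`, `unit_leftMate`).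
* Being finitely generated projective on each side is a property of the functor `- ⊗ N`: on the right
  `N` is the image of the regular module, and on the left it amounts to the existence of a left
  adjoint (`IsFGProjective.of_iso`). Hence `N'` is admissible.
* A graded right `𝕊^{nc}(N)`-module is a sequence of `F_i`-modules `M_i` with maps
  `M_i ⊗ N^{i*} → M_{i+1}` whose two-step composites vanish on `M_i ⊗ Q_i`
  (`BimoduleSeq.toRep` is an equivalence). The latter condition says that the composite with the unit
  `M_i → M_i ⊗ N^{i*} ⊗ N^{(i+1)*}` is zero (`DualPair.kills_iff`), so such data are transported along
  the equivalences `e` and `f` (`BimoduleSeq.MoritaEquiv.mapRep`).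
* The resulting equivalence of graded module categories preserves right bounded modules in both
  directions, hence also torsion modules, and it descends to the quotient categories
  (`linearlyEquivalent_localization`).

For `N ⊗ L` one takes `f = - ⊗ L`, and for a twist the restrictions of scalars. For `P ⊗ N` one needs
that `- ⊗ P` is an equivalence between categories of right modules, whereas the hypothesis is about
left modules: `P` and its left dual form a Morita context whose two pairings have `1` in their images,
so `- ⊗ P` and `- ⊗ ^*P` are mutually inverse (`nonempty_leftDual_tensor_isos`).
-/

namespace NCP1

/-! ### Tensoring right modules with a bimodule -/

namespace Bimodule

section

variable {k : Type u} [Field k] {R S T : Type u} [Ring R] [Algebra k R] [Ring S] [Algebra k S]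
  [Ring T] [Algebra k T]

/-- The universal property of the tensor product of bimodules, as an abelian group. -/
noncomputable def liftAdd {M : Bimodule k R S} {N : Bimodule k S T} {Z : Type*} [AddCommGroup Z]
    (b : M.carrier →+ N.carrier →+ Z) (hb : ∀ m (s : S) n, b (op s • m) n = b m (s • n)) :
    (M.tensor N).carrier →+ Z :=
  let f : M.carrier ⊗[k] N.carrier →+ Z := TensorProduct.liftAddHom b fun c m n => by
    rw [← op_algebraMap_smul, hb, algebraMap_smul]
  QuotientAddGroup.lift (balanced M N).toAddSubgroup f fun z hz => by
    have key : ∀ c : k, f (c • z) = 0 := by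
      change z ∈ balanced M N at hz
      induction hz using Submodule.span_induction with
      | zero => intro c; rw [smul_zero, map_zero]
      | add x y _ _ hx hy => intro c; rw [smul_add, map_add, hx, hy, add_zero]
      | smul a x _ hx => intro c; rw [← mul_smul]; exact hx _
      | mem z h =>
        rintro c
        obtain ⟨m, s, n, rfl⟩ := h
        rw [smul_sub, ← TensorProduct.tmul_smul, ← TensorProduct.tmul_smul, map_sub, sub_eq_zero,
          smul_comm c s n]
        exact hb m s (c • n)
    rw [← one_smul k z]
    exact key 1

/-- The pure tensor `m ⊗ n` in `M ⊗_S N`, for a right `S`-module `M`. -/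
noncomputable def pure (N : Bimodule k S T) (M : ModuleCat.{u} Sᵐᵒᵖ) (m : M) (n : N.carrier) :
    N.rightTensorFunctor.obj M :=
  tmul (M := ofRight k M) m n

variable {N : Bimodule k S T} {M M' : ModuleCat.{u} Sᵐᵒᵖ}

theorem pure_add (m : M) (n n' : N.carrier) :
    pure N M m (n + n') = pure N M m n + pure N M m n' :=
  tmul_add (M := ofRight k M) m n n'

theorem add_pure (m m' : M) (n : N.carrier) :
    pure N M (m + m') n = pure N M m n + pure N M m' n :=
  add_tmul (M := ofRight k M) m m' n

theorem pure_zero (m : M) : pure N M m 0 = 0 := tmul_zero (M := ofRight k M) m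

theorem zero_pure (n : N.carrier) : pure N M 0 n = 0 := zero_tmul (M := ofRight k M) n

theorem pure_balanced (m : M) (s : S) (n : N.carrier) :
    pure N M (op s • m) n = pure N M m (s • n) :=
  tmul_balanced (M := ofRight k M) m s n

theorem smul_pure (t : Tᵐᵒᵖ) (m : M) (n : N.carrier) :
    t • pure N M m n = pure N M m (t • n) := rfl

theorem map_pure (f : M ⟶ M') (m : M) (n : N.carrier) :
    N.rightTensorFunctor.map f (pure N M m n) = pure N M' (f m) n := rfl

theorem pure_sum {ι : Type*} (s : Finset ι) (m : M) (n : ι → N.carrier) :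
    pure N M m (∑ i ∈ s, n i) = ∑ i ∈ s, pure N M m (n i) :=
  map_sum (mkTensor (ofRight k M) N m) n s

theorem sum_pure {ι : Type*} (s : Finset ι) (m : ι → M) (n : N.carrier) :
    pure N M (∑ i ∈ s, m i) n = ∑ i ∈ s, pure N M (m i) n :=
  map_sum (AddMonoidHom.mk' (fun m => pure N M m n) fun _ _ => add_pure _ _ _) m s

theorem pure_induction {p : N.rightTensorFunctor.obj M → Prop} (h0 : p 0)
    (h1 : ∀ m n, p (pure N M m n)) (h2 : ∀ x y, p x → p y → p (x + y))
    (x : N.rightTensorFunctor.obj M) : p x :=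
  tensor_induction (M := ofRight k M) (N := N) (p := p) h0 h1 h2 x

theorem tensorHom_ext {Z : ModuleCat.{u} Tᵐᵒᵖ} {f g : N.rightTensorFunctor.obj M ⟶ Z}
    (h : ∀ m n, f (pure N M m n) = g (pure N M m n)) : f = g := by
  ext x
  induction x using pure_induction with
  | h0 => rw [map_zero, map_zero]
  | h1 m n => exact h m n
  | h2 x y hx hy => rw [map_add, map_add, hx, hy]

theorem smul_eq_algebraMap (N : Bimodule k S T) (c : k) (n : N.carrier) :
    c • n = algebraMap k S c • n := (algebraMap_smul S c n).symm

theorem smul_eq_op_algebraMap (N : Bimodule k S T) (c : k) (n : N.carrier) :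
    c • n = op (algebraMap k T c) • n := (op_algebraMap_smul N c n).symm

/-- The universal property of `M ⊗_S N` as an abelian group. -/
noncomputable def tensorLift {Z : Type*} [AddCommGroup Z] (b : M →+ N.carrier →+ Z)
    (hb : ∀ m (s : S) n, b (op s • m) n = b m (s • n)) : N.rightTensorFunctor.obj M →+ Z :=
  liftAdd (M := ofRight k M) b hb

/-- The universal property of `M ⊗_S N` for morphisms of right modules. -/
noncomputable def tensorDesc {Z : ModuleCat.{u} Tᵐᵒᵖ} (b : M →+ N.carrier →+ Z)
    (hb : ∀ m (s : S) n, b (op s • m) n = b m (s • n))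
    (hl : ∀ m (t : Tᵐᵒᵖ) n, b m (t • n) = t • b m n) : N.rightTensorFunctor.obj M ⟶ Z :=
  ModuleCat.ofHom (X := N.rightTensorFunctor.obj M)
    { tensorLift b hb with
      map_smul' := fun t (x : N.rightTensorFunctor.obj M) => by
        change tensorLift b hb (t • x) = t • tensorLift b hb x
        induction x using pure_induction with
        | h0 => rw [smul_zero, map_zero, smul_zero]
        | h1 m n => exact hl m t n
        | h2 x y hx hy => rw [smul_add, map_add, hx, hy, map_add, smul_add] }

instance : N.rightTensorFunctor.Additive where
  map_add {_ _ f g} := tensorHom_ext fun m n => add_pure (f m) (g m) n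

instance : N.rightTensorFunctor.Linear k where
  map_smul {_ M'} f c := tensorHom_ext fun m n => by
    change pure N M' (op (algebraMap k S c) • f m) n =
      op (algebraMap k T c) • pure N M' (f m) n
    rw [pure_balanced, smul_pure, ← smul_eq_algebraMap, smul_eq_op_algebraMap]

end

end Bimodule

/-! ### Dualities of bimodules and adjunctions -/

/-- A map of two variables that is additive in each of them, as a bundled biadditive map. -/
def biadd {A B C : Type*} [AddCommGroup A] [AddCommGroup B] [AddCommGroup C] (f : A → B → C)
    (hl : ∀ a a' b, f (a + a') b = f a b + f a' b)
    (hr : ∀ a b b', f a (b + b') = f a b + f a b') : A →+ B →+ C :=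
  AddMonoidHom.mk' (fun a => AddMonoidHom.mk' (f a) (hr a)) fun a a' =>
    AddMonoidHom.ext fun b => hl a a' b

namespace Bimodule

section

variable {k : Type u} [Field k] {R S T : Type u} [Ring R] [Algebra k R] [Ring S] [Algebra k S]
  [Ring T] [Algebra k T]

section

variable {X : Bimodule k R S} {Y : Bimodule k S T} {M : ModuleCat.{u} Rᵐᵒᵖ}
  {Z : ModuleCat.{u} Tᵐᵒᵖ} (b : M → X.carrier → Y.carrier → Z)
  (h₁ : ∀ m m' x y, b (m + m') x y = b m x y + b m' x y)
  (h₂ : ∀ m x x' y, b m (x + x') y = b m x y + b m x' y)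
  (h₃ : ∀ m x y y', b m x (y + y') = b m x y + b m x y')
  (h₄ : ∀ m (r : R) x y, b (op r • m) x y = b m (r • x) y)
  (h₅ : ∀ m x (s : S) y, b m (op s • x) y = b m x (s • y))
  (h₆ : ∀ m x (t : Tᵐᵒᵖ) y, b m x (t • y) = t • b m x y)

/-- The universal property of `(M ⊗ X) ⊗ Y`. -/
noncomputable def tensorTensorDesc :
    Y.rightTensorFunctor.obj (X.rightTensorFunctor.obj M) ⟶ Z :=
  let g (y : Y.carrier) : X.rightTensorFunctor.obj M →+ Z :=
    tensorLift (biadd (fun m x => b m x y) (fun m m' x => h₁ m m' x y) (fun m x x' => h₂ m x x' y))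
      (fun m r x => h₄ m r x y)
  have hg (y : Y.carrier) (m : M) (x : X.carrier) : g y (pure X M m x) = b m x y := rfl
  tensorDesc (biadd (fun w y => g y w) (fun w w' y => map_add _ _ _)
      (fun w y y' => by
        induction w using pure_induction with
        | h0 => simp
        | h1 m x => rw [hg, hg, hg, h₃]
        | h2 a b ha hb => rw [map_add, map_add, map_add, ha, hb]; abel))
    (fun w s y => by
      change g y (op s • w) = g (s • y) w
      induction w using pure_induction with
      | h0 => simp
      | h1 m x => rw [smul_pure, hg, hg, h₅]
      | h2 a b ha hb => rw [smul_add, map_add, map_add, ha, hb])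
    (fun w t y => by
      change g (t • y) w = t • g y w
      induction w using pure_induction with
      | h0 => simp
      | h1 m x => rw [hg, hg, h₆]
      | h2 a b ha hb => rw [map_add, map_add, smul_add, ha, hb])

theorem tensorTensor_induction {p : Y.rightTensorFunctor.obj (X.rightTensorFunctor.obj M) → Prop}
    (h0 : p 0) (h1 : ∀ m x y, p (pure Y _ (pure X M m x) y)) (h2 : ∀ z w, p z → p w → p (z + w))
    (z : Y.rightTensorFunctor.obj (X.rightTensorFunctor.obj M)) : p z := by
  induction z using pure_induction with
  | h0 => exact h0
  | h1 w y =>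
    induction w using pure_induction with
    | h0 => rw [zero_pure]; exact h0
    | h1 m x => exact h1 m x y
    | h2 a b ha hb => rw [add_pure]; exact h2 _ _ ha hb
  | h2 a b ha hb => exact h2 _ _ ha hb

theorem tensorTensorHom_ext {f g : Y.rightTensorFunctor.obj (X.rightTensorFunctor.obj M) ⟶ Z}
    (h : ∀ m x y, f (pure Y _ (pure X M m x) y) = g (pure Y _ (pure X M m x) y)) : f = g := by
  ext z
  induction z using tensorTensor_induction with
  | h0 => rw [map_zero, map_zero]
  | h1 m x y => exact h m x y
  | h2 a b ha hb => rw [map_add, map_add, ha, hb]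

end

/-- A duality between an `R`-`S`-bimodule `X` and an `S`-`R`-bimodule `Y`: a balanced `S`-bilinear
pairing `Y × X → S` together with dual bases `x`, `y`. It identifies `Y` with the right
dual of `X` and `X` with the left dual of `Y`. -/
structure DualPair (X : Bimodule k R S) (Y : Bimodule k S R) where
  form : Y.carrier →+ X.carrier →+ S
  form_smul_left : ∀ (s : S) y x, form (s • y) x = s * form y x
  form_smul_right : ∀ y (s : S) x, form y (op s • x) = form y x * s
  form_balanced : ∀ y (r : R) x, form (op r • y) x = form y (r • x)
  n : ℕ
  x : Fin n → X.carrier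
  y : Fin n → Y.carrier
  sum_left : ∀ a, ∑ i, op (form (y i) a) • x i = a
  sum_right : ∀ b, ∑ i, form b (x i) • y i = b

namespace DualPair

variable {X : Bimodule k R S} {Y : Bimodule k S R} (P : DualPair X Y)

/-- The canonical element `∑ x_i ⊗ y_i` of `X ⊗_S Y`. -/
noncomputable def coev : (X.tensor Y).carrier := ∑ i, tmul (P.x i) (P.y i)

theorem sum_tmul {M : Bimodule k R S} {N : Bimodule k S T} {ι : Type*} (s : Finset ι)
    (m : ι → M.carrier) (n : N.carrier) :
    (tmul (∑ i ∈ s, m i) n : (M.tensor N).carrier) = ∑ i ∈ s, tmul (m i) n :=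
  map_sum (AddMonoidHom.mk' (fun m => (tmul m n : (M.tensor N).carrier))
    fun _ _ => Bimodule.add_tmul _ _ _) m s

theorem tmul_sum {M : Bimodule k R S} {N : Bimodule k S T} {ι : Type*} (s : Finset ι)
    (m : M.carrier) (n : ι → N.carrier) :
    (tmul m (∑ i ∈ s, n i) : (M.tensor N).carrier) = ∑ i ∈ s, tmul m (n i) :=
  map_sum (mkTensor M N m) n s

/-- The canonical element is central, which makes `m ↦ m ⊗ coev` right linear. -/
theorem smul_coev (r : R) : r • P.coev = op r • P.coev := by
  simp only [coev, Finset.smul_sum, smul_tmul, op_smul_tmul]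
  calc ∑ i, (tmul (r • P.x i) (P.y i) : (X.tensor Y).carrier)
      = ∑ i, ∑ j, tmul (P.x j) (P.form (P.y j) (r • P.x i) • P.y i) := by
        refine Finset.sum_congr rfl fun i _ => ?_
        conv_lhs => rw [← P.sum_left (r • P.x i), sum_tmul]
        simp only [tmul_balanced]
    _ = ∑ j, tmul (P.x j) (op r • P.y j) := by
        rw [Finset.sum_comm]
        refine Finset.sum_congr rfl fun j _ => ?_
        conv_rhs => rw [← P.sum_right (op r • P.y j), tmul_sum]
        simp only [P.form_balanced]

end DualPair

/-- The element `m ⊗ q` of `(M ⊗ X) ⊗ Y`, for `q ∈ X ⊗ Y`. -/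
noncomputable def insertPure (X : Bimodule k R S) (Y : Bimodule k S T)
    (M : ModuleCat.{u} Rᵐᵒᵖ) (m : M) : (X.tensor Y).carrier →+
      Y.rightTensorFunctor.obj (X.rightTensorFunctor.obj M) :=
  liftAdd
    (biadd (fun x y => pure Y (X.rightTensorFunctor.obj M) (pure X M m x) y)
      (fun x x' y => by rw [pure_add, add_pure]) (fun x y y' => pure_add _ _ _))
    fun x s y => pure_balanced (pure X M m x) s y

section

variable {X : Bimodule k R S} {Y : Bimodule k S T} {M M' : ModuleCat.{u} Rᵐᵒᵖ}

theorem insertPure_tmul (m : M) (x : X.carrier) (y : Y.carrier) :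
    insertPure X Y M m (tmul x y) = pure Y (X.rightTensorFunctor.obj M) (pure X M m x) y := rfl

theorem insertPure_add (m m' : M) (q : (X.tensor Y).carrier) :
    insertPure X Y M (m + m') q = insertPure X Y M m q + insertPure X Y M m' q := by
  induction q using tensor_induction with
  | h0 => simp
  | h1 x y => rw [insertPure_tmul, insertPure_tmul, insertPure_tmul, add_pure, add_pure]
  | h2 a b ha hb => rw [map_add, map_add, map_add, ha, hb]; abel

theorem insertPure_smul (m : M) (t : Tᵐᵒᵖ) (q : (X.tensor Y).carrier) :
    insertPure X Y M m (t • q) = t • insertPure X Y M m q := by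
  induction q using tensor_induction with
  | h0 => simp
  | h1 x y => rfl
  | h2 a b ha hb => rw [smul_add, map_add, map_add, ha, hb, smul_add]

theorem insertPure_op_smul (m : M) (r : R) (q : (X.tensor Y).carrier) :
    insertPure X Y M (op r • m) q = insertPure X Y M m (r • q) := by
  induction q using tensor_induction with
  | h0 => simp
  | h1 x y => rw [smul_tmul, insertPure_tmul, insertPure_tmul, pure_balanced]
  | h2 a b ha hb => rw [smul_add, map_add, map_add, ha, hb]

theorem map_insertPure (f : M ⟶ M') (m : M) (q : (X.tensor Y).carrier) :
    Y.rightTensorFunctor.map (X.rightTensorFunctor.map f) (insertPure X Y M m q) =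
      insertPure X Y M' (f m) q := by
  induction q using tensor_induction with
  | h0 => simp
  | h1 x y => rfl
  | h2 a b ha hb => rw [map_add, map_add, map_add, ha, hb]

end

namespace DualPair

variable {X : Bimodule k R S} {Y : Bimodule k S R} (P : DualPair X Y)

/-- The unit `M → (M ⊗ X) ⊗ Y`, `m ↦ ∑ m ⊗ x_i ⊗ y_i`. -/
noncomputable def unitHom (M : ModuleCat.{u} Rᵐᵒᵖ) :
    M ⟶ Y.rightTensorFunctor.obj (X.rightTensorFunctor.obj M) :=
  ModuleCat.ofHom
    { toFun := fun m => insertPure X Y M m P.coev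
      map_add' := fun m m' => insertPure_add m m' _
      map_smul' := fun r m => by
        rw [← op_unop r, insertPure_op_smul, smul_coev, insertPure_smul, RingHom.id_apply]
        rfl }

theorem unitHom_apply (M : ModuleCat.{u} Rᵐᵒᵖ) (m : M) :
    P.unitHom M m = insertPure X Y M m P.coev := rfl

theorem unitHom_apply_eq_sum (M : ModuleCat.{u} Rᵐᵒᵖ) (m : M) :
    P.unitHom M m = ∑ i, pure Y (X.rightTensorFunctor.obj M) (pure X M m (P.x i)) (P.y i) := by
  rw [unitHom_apply, coev, map_sum]
  rfl

/-- The counit `(Z ⊗ Y) ⊗ X → Z`, `z ⊗ y ⊗ x ↦ z ⟨y, x⟩`. -/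
noncomputable def counitHom (Z : ModuleCat.{u} Sᵐᵒᵖ) :
    X.rightTensorFunctor.obj (Y.rightTensorFunctor.obj Z) ⟶ Z :=
  tensorTensorDesc (fun z y x => op (P.form y x) • z) (fun _ _ _ _ => smul_add _ _ _)
    (fun z y y' x => by rw [map_add, AddMonoidHom.add_apply, MulOpposite.op_add, add_smul])
    (fun z y x x' => by rw [map_add, MulOpposite.op_add, add_smul])
    (fun z s y x => by rw [P.form_smul_left, op_mul, mul_smul])
    (fun z y r x => by rw [P.form_balanced])
    (fun z y s x => by rw [← op_unop s, P.form_smul_right, op_mul, mul_smul])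

theorem counitHom_pure (Z : ModuleCat.{u} Sᵐᵒᵖ) (z : Z) (y : Y.carrier) (x : X.carrier) :
    P.counitHom Z (pure X (Y.rightTensorFunctor.obj Z) (pure Y Z z y) x) =
      op (P.form y x) • z := rfl

/-- The adjunction `- ⊗ X ⊣ - ⊗ Y` given by a duality between `X` and `Y`. -/
noncomputable def adjunction : X.rightTensorFunctor ⊣ Y.rightTensorFunctor :=
  Adjunction.mkOfUnitCounit
    { unit :=
        { app := P.unitHom
          naturality := fun M M' f => by
            ext m
            exact (map_insertPure f m P.coev).symm }
      counit :=
        { app := P.counitHom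
          naturality := fun Z Z' f => by
            refine tensorHom_ext fun w x => ?_
            induction w using pure_induction with
            | h0 => rw [zero_pure, map_zero, map_zero]
            | h1 z y => exact (f.hom.map_smul (op (P.form y x)) z).symm
            | h2 a b ha hb => rw [add_pure, map_add, map_add, ha, hb] }
      left_triangle := by
        ext M : 2
        refine tensorHom_ext fun m x => ?_
        change P.counitHom _ (X.rightTensorFunctor.map (P.unitHom M) (pure X M m x)) = pure X M m x
        rw [map_pure, unitHom_apply_eq_sum, sum_pure, map_sum]
        simp only [counitHom_pure, smul_pure]
        rw [← pure_sum, P.sum_left]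
      right_triangle := by
        ext Z : 2
        refine tensorHom_ext fun z y => ?_
        change Y.rightTensorFunctor.map (P.counitHom Z)
          (P.unitHom (Y.rightTensorFunctor.obj Z) (pure Y Z z y)) = pure Y Z z y
        rw [unitHom_apply_eq_sum, map_sum]
        simp only [map_pure, counitHom_pure, pure_balanced]
        rw [← pure_sum, P.sum_right] }

end DualPair

/-- A morphism out of `(M ⊗ X) ⊗ Y` kills the relations `Q ⊆ X ⊗ Y` if it vanishes on `m ⊗ q` for
all `m ∈ M` and `q ∈ Q`. -/
def Kills {X : Bimodule k R S} {Y : Bimodule k S T} (Q : Submodule k (X.tensor Y).carrier)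
    {M : ModuleCat.{u} Rᵐᵒᵖ} {Z : ModuleCat.{u} Tᵐᵒᵖ}
    (g : Y.rightTensorFunctor.obj (X.rightTensorFunctor.obj M) ⟶ Z) : Prop :=
  ∀ (m : M), ∀ q ∈ Q, g (insertPure X Y M m q) = 0

namespace DualPair

variable {X : Bimodule k R S} {Y : Bimodule k S R} (P : DualPair X Y)

/-- If `Q` is the image of the unit, then a morphism kills `Q` if and only if its composition with
the unit vanishes. -/
theorem kills_iff {Q : Submodule k (X.tensor Y).carrier} (hQ : ∀ q, q ∈ Q ↔ ∃ r : R, q = r • P.coev)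
    {M Z : ModuleCat.{u} Rᵐᵒᵖ} (g : Y.rightTensorFunctor.obj (X.rightTensorFunctor.obj M) ⟶ Z) :
    Kills Q g ↔ P.adjunction.unit.app M ≫ g = 0 := by
  refine ⟨fun h => ?_, fun h m q hq => ?_⟩
  · ext m
    exact h m P.coev ((hQ _).2 ⟨1, (one_smul R _).symm⟩)
  · obtain ⟨r, rfl⟩ := (hQ q).1 hq
    rw [← insertPure_op_smul]
    exact congrArg (fun f : M ⟶ Z => f (op r • m)) h

end DualPair

end

end Bimodule

/-! ### Duals of finitely generated projective bimodules -/

namespace Bimodule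

section

variable {k : Type u} [Field k] {R S T : Type u} [Ring R] [Algebra k R] [Ring S] [Algebra k S]
  [Ring T] [Algebra k T]

theorem exists_dual_basis (A : Type*) [Ring A] (M : Type*) [AddCommGroup M] [Module A M]
    [Module.Finite A M] [Module.Projective A M] :
    ∃ (n : ℕ) (x : Fin n → M) (f : Fin n → M →ₗ[A] A), ∀ m, ∑ i, f i m • x i = m := by
  obtain ⟨n, p, hp⟩ := Module.Finite.exists_fin' A M
  obtain ⟨s, hs⟩ := Module.projective_lifting_property p LinearMap.id hp
  refine ⟨n, fun i => p (Pi.single i 1), fun i => (LinearMap.proj i).comp s, fun m => ?_⟩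
  have h := LinearMap.congr_fun hs m
  conv_rhs => rw [← LinearMap.id_apply (R := A) m, ← h, LinearMap.comp_apply, pi_eq_sum_univ (s m)]
  rw [map_sum]
  refine Finset.sum_congr rfl fun i _ => ?_
  rw [map_smul]
  exact congrArg (fun v => s m i • p v) (by ext j; simp [Pi.single_apply, eq_comm])

theorem finite_projective_of_dual_basis {A : Type*} [Ring A] {M : Type*} [AddCommGroup M]
    [Module A M] {n : ℕ} (x : Fin n → M) (f : Fin n → M →ₗ[A] A)
    (h : ∀ m, ∑ i, f i m • x i = m) : Module.Finite A M ∧ Module.Projective A M := by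
  let p : (Fin n → A) →ₗ[A] M := Fintype.linearCombination A x
  have hs : p ∘ₗ LinearMap.pi f = LinearMap.id := LinearMap.ext fun m => by
    simpa [p, Fintype.linearCombination_apply] using h m
  exact ⟨Module.Finite.of_surjective p fun m => ⟨_, LinearMap.congr_fun hs m⟩,
    Module.Projective.of_split _ p hs⟩

/-- The duality between a bimodule that is finitely generated projective on the right and its right
dual. -/
noncomputable def dualPairRight (N : Bimodule k R S) (h₁ : Module.Finite Sᵐᵒᵖ N.carrier)
    (h₂ : Module.Projective Sᵐᵒᵖ N.carrier) : DualPair N N.rightDual :=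
  let B := exists_dual_basis Sᵐᵒᵖ N.carrier
  let x := B.choose_spec.choose
  let f := B.choose_spec.choose_spec.choose
  have hf : ∀ m, ∑ i, f i m • x i = m := B.choose_spec.choose_spec.choose_spec
  let y : Fin B.choose → (N.carrier →ₗ[Sᵐᵒᵖ] S) := fun i =>
    { toFun := fun m => unop (f i m)
      map_add' := fun m m' => by rw [map_add, MulOpposite.unop_add]
      map_smul' := fun s m => by rw [map_smul]; rfl }
  { form := biadd (fun ψ n => rightEval ψ n) (fun _ _ _ => rfl) (fun ψ n n' => map_add _ _ _)
    form_smul_left := fun s ψ n => rfl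
    form_smul_right := fun ψ s n => (rightEval ψ).map_smul (op s) n
    form_balanced := fun ψ r n => rfl
    n := B.choose
    x := x
    y := y
    sum_left := hf
    sum_right := fun (ψ : N.carrier →ₗ[Sᵐᵒᵖ] S) => by
      refine LinearMap.ext fun m => ?_
      have h : ∑ i, ψ (x i) * y i m = ψ m := by
        conv_rhs => rw [← hf m, map_sum]
        simp only [map_smul]
        rfl
      rw [← h]
      exact LinearMap.sum_apply _ (fun i => ψ (x i) • y i) m }

/-- The relations, defined as the preimage of the left multiplications under `N ⊗ N^* → End(N_S)`, are
the multiples of the canonical element of the duality: `q = ∑ q(x_i) ⊗ y_i`, where `q` also denotes its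
image in `End(N_S)`. -/
theorem mem_unitRight_iff (N : Bimodule k R S) (h₁ : Module.Finite Sᵐᵒᵖ N.carrier)
    (h₂ : Module.Projective Sᵐᵒᵖ N.carrier) (q : (N.tensor N.rightDual).carrier) :
    q ∈ N.unitRight ↔ ∃ r : R, q = r • (N.dualPairRight h₁ h₂).coev := by
  set P := N.dualPairRight h₁ h₂
  have key (q) : q = ∑ i, (tmul (N.rightCoev q (P.x i)) (P.y i) :
      (N.tensor N.rightDual).carrier) := by
    induction q using tensor_induction with
    | h0 => simp [Bimodule.zero_tmul]
    | h1 n ψ =>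
      conv_lhs => rw [← P.sum_right ψ, DualPair.tmul_sum]
      simp only [← tmul_balanced]
      rfl
    | h2 a b ha hb =>
      simp only [map_add, LinearMap.add_apply, Bimodule.add_tmul, Finset.sum_add_distrib]
      rw [← ha, ← hb]
  have hcoev (r : R) (n : N.carrier) : N.rightCoev (r • P.coev) n = r • n := by
    conv_rhs => rw [← P.sum_left n, Finset.smul_sum]
    rw [DualPair.coev, Finset.smul_sum, map_sum, LinearMap.sum_apply]
    refine Finset.sum_congr rfl fun i _ => ?_
    rw [smul_comm]
    rfl
  constructor
  · rintro ⟨r, hr⟩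
    refine ⟨r, ?_⟩
    rw [key q, ← hr, DualPair.coev, Finset.smul_sum]
    rfl
  · rintro ⟨r, rfl⟩
    exact ⟨r, LinearMap.ext fun n => (hcoev r n).symm⟩

/-- The duality between a bimodule that is finitely generated projective on the left and its left
dual. -/
noncomputable def dualPairLeft (N : Bimodule k R S) (h₁ : Module.Finite R N.carrier)
    (h₂ : Module.Projective R N.carrier) : DualPair N.leftDual N :=
  let B := exists_dual_basis R N.carrier
  let x := B.choose_spec.choose
  let f := B.choose_spec.choose_spec.choose
  have hf : ∀ m, ∑ i, f i m • x i = m := B.choose_spec.choose_spec.choose_spec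
  { form := biadd (fun n φ => leftEval φ n) (fun φ n n' => map_add _ _ _) (fun _ _ _ => rfl)
    form_smul_left := fun r n φ => (leftEval φ).map_smul r n
    form_smul_right := fun n r φ => rfl
    form_balanced := fun n s φ => rfl
    n := B.choose
    x := f
    y := x
    sum_left := fun (φ : N.carrier →ₗ[R] R) => by
      refine LinearMap.ext fun m => ?_
      have h : ∑ i, f i m * φ (x i) = φ m := by
        conv_rhs => rw [← hf m, map_sum]
        simp only [map_smul]
        rfl
      rw [← h]
      exact LinearMap.sum_apply _ (fun i => op (φ (x i)) • f i) m
    sum_right := hf }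

/-- The relations, defined as the preimage of the right multiplications under `^*N ⊗ N → End(_R N)`,
are the multiples of the canonical element of the duality. -/
theorem mem_unitLeft_iff (N : Bimodule k R S) (h₁ : Module.Finite R N.carrier)
    (h₂ : Module.Projective R N.carrier) (q : (N.leftDual.tensor N).carrier) :
    q ∈ N.unitLeft ↔ ∃ s : S, q = s • (N.dualPairLeft h₁ h₂).coev := by
  set P := N.dualPairLeft h₁ h₂
  have key (q) : q = ∑ i, (tmul (P.x i) (N.leftCoev q (P.y i)) :
      (N.leftDual.tensor N).carrier) := by
    induction q using tensor_induction with
    | h0 => simp [Bimodule.tmul_zero]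
    | h1 φ n =>
      conv_lhs => rw [← P.sum_left φ, DualPair.sum_tmul]
      simp only [tmul_balanced]
      rfl
    | h2 a b ha hb =>
      simp only [map_add, LinearMap.add_apply, Bimodule.tmul_add, Finset.sum_add_distrib]
      rw [← ha, ← hb]
  have hcoev (s : S) (n : N.carrier) : N.leftCoev (s • P.coev) n = op s • n := by
    rw [P.smul_coev]
    conv_rhs => rw [← P.sum_right n, Finset.smul_sum]
    rw [DualPair.coev, Finset.smul_sum, map_sum, LinearMap.sum_apply]
    refine Finset.sum_congr rfl fun i _ => ?_
    rw [← smul_comm]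
    rfl
  constructor
  · rintro ⟨s, hs⟩
    refine ⟨unop s, ?_⟩
    rw [P.smul_coev, key q, ← hs, DualPair.coev, Finset.smul_sum]
    rfl
  · rintro ⟨s, rfl⟩
    exact ⟨op s, LinearMap.ext fun n => (hcoev s n).symm⟩

end

end Bimodule

/-! ### Mates of squares whose vertical sides are equivalences -/

section Mates

universe v₁ v₂ v₃ v₄ u₁ u₂ u₃ u₄

variable {C : Type u₁} [Category.{v₁} C] {D : Type u₂} [Category.{v₂} D]
  {C' : Type u₃} [Category.{v₃} C'] {D' : Type u₄} [Category.{v₄} D']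
  {L : C ⥤ D} {R : D ⥤ C} {L' : C' ⥤ D'} {R' : D' ⥤ C'} (adj : L ⊣ R) (adj' : L' ⊣ R')
  (e : C ≌ C') (f : D ≌ D')

/-- For equivalences `e` and `f`, the mate of a transformation filling a square with horizontal
sides `L`, `L'` and vertical sides `e`, `f` is invertible if and only if the transformation is. -/
theorem isIso_mateEquiv_iff (α : e.functor ⋙ L' ⟶ L ⋙ f.functor) :
    IsIso (mateEquiv adj adj' (TwoSquare.mk _ _ _ _ α)).natTrans ↔ IsIso α := by
  -- the second mate of `α` along the equivalences is its conjugate, and it is invertible if and only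
  -- if `α` is
  set β := mateEquiv adj adj' (TwoSquare.mk _ _ _ _ α) with hβ
  have h := iterated_mateEquiv_conjugateEquiv adj adj' e.toAdjunction f.toAdjunction
    (TwoSquare.mk _ _ _ _ α)
  rw [← hβ] at h
  have happ (d : D') : (mateEquiv f.toAdjunction e.toAdjunction β).natTrans.app d =
      e.unitIso.hom.app (R.obj (f.inverse.obj d)) ≫
        e.inverse.map (β.natTrans.app (f.inverse.obj d)) ≫
          e.inverse.map (R'.map (f.counitIso.hom.app d)) := by
    simp [mateEquiv]
  have hγ (d : D') : IsIso ((mateEquiv f.toAdjunction e.toAdjunction β).natTrans.app d) ↔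
      IsIso (β.natTrans.app (f.inverse.obj d)) := by
    rw [happ, isIso_comp_left_iff, isIso_comp_right_iff]
    exact isIso_iff_of_reflects_iso _ e.inverse
  have hα : IsIso α ↔ IsIso (mateEquiv f.toAdjunction e.toAdjunction β).natTrans := by
    rw [h]
    refine ⟨fun _ => conjugateEquiv_iso _ _ _, fun _ => ?_⟩
    exact conjugateEquiv_of_iso (adj.comp f.toAdjunction) (e.toAdjunction.comp adj') α
  rw [hα, NatTrans.isIso_iff_isIso_app, NatTrans.isIso_iff_isIso_app]
  refine ⟨fun H d => (hγ d).2 (H _), fun H x => ?_⟩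
  exact (NatTrans.isIso_app_iff_of_iso β.natTrans (f.unitIso.app x)).2 ((hγ _).1 (H (f.functor.obj x)))

/-- A commutative square with vertical sides equivalences and horizontal sides left adjoints gives a
commutative square of right adjoints. -/
noncomputable def rightMate (θ : e.functor ⋙ L' ≅ L ⋙ f.functor) :
    f.functor ⋙ R' ≅ R ⋙ e.functor :=
  haveI := (isIso_mateEquiv_iff adj adj' e f θ.hom).2 inferInstance
  (asIso (mateEquiv adj adj' (TwoSquare.mk _ _ _ _ θ.hom)).natTrans).symm

/-- Mates are compatible with units. -/
theorem unit_rightMate (θ : e.functor ⋙ L' ≅ L ⋙ f.functor) (c : C) :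
    adj'.unit.app (e.functor.obj c) ≫ R'.map (θ.hom.app c) ≫
      (rightMate adj adj' e f θ).hom.app (L.obj c) = e.functor.map (adj.unit.app c) := by
  have h := unit_mateEquiv adj adj' (TwoSquare.mk _ _ _ _ θ.hom) c
  have h' : (rightMate adj adj' e f θ).inv.app (L.obj c) =
    (mateEquiv adj adj' (TwoSquare.mk _ _ _ _ θ.hom)).natTrans.app (L.obj c) := rfl
  have h'' := (rightMate adj adj' e f θ).inv_hom_id_app (L.obj c)
  rw [← Category.assoc]
  refine (congrArg (· ≫ (rightMate adj adj' e f θ).hom.app (L.obj c)) h.symm).trans ?_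
  refine (Category.assoc _ _ _).trans ?_
  refine (congrArg (e.functor.map (adj.unit.app c) ≫ ·) h'').trans ?_
  exact Category.comp_id _

/-- A commutative square with vertical sides equivalences and horizontal sides right adjoints gives
a commutative square of left adjoints. -/
noncomputable def leftMate (θ : f.functor ⋙ R' ≅ R ⋙ e.functor) :
    e.functor ⋙ L' ≅ L ⋙ f.functor :=
  let α := (mateEquiv adj adj').symm (TwoSquare.mk _ _ _ _ θ.inv)
  haveI : IsIso α.natTrans := (isIso_mateEquiv_iff adj adj' e f α.natTrans).1 (by
    have h : mateEquiv adj adj' (TwoSquare.mk _ _ _ _ α.natTrans) = TwoSquare.mk _ _ _ _ θ.inv :=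
      (mateEquiv adj adj').apply_symm_apply _
    rw [h]
    exact inferInstanceAs (IsIso θ.inv))
  asIso α.natTrans

/-- Mates are compatible with units. -/
theorem unit_leftMate (θ : f.functor ⋙ R' ≅ R ⋙ e.functor) (c : C) :
    adj'.unit.app (e.functor.obj c) ≫ R'.map ((leftMate adj adj' e f θ).hom.app c) ≫
      θ.hom.app (L.obj c) = e.functor.map (adj.unit.app c) := by
  have h := unit_mateEquiv_symm adj adj' (TwoSquare.mk _ _ _ _ θ.inv) c
  have h'' := θ.inv_hom_id_app (L.obj c)
  rw [← Category.assoc]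
  refine (congrArg (· ≫ θ.hom.app (L.obj c)) h.symm).trans ?_
  refine (Category.assoc _ _ _).trans ?_
  refine (congrArg (e.functor.map (adj.unit.app c) ≫ ·) h'').trans ?_
  exact Category.comp_id _

end Mates

/-! ### Morita invariance of finite generation and projectivity -/

theorem _root_.OrderIso.isCompactElement {α β : Type*} [PartialOrder α] [PartialOrder β]
    (o : α ≃o β) {a : α} (h : IsCompactElement a) : IsCompactElement (o a) := by
  intro s b hs hd hb hab
  obtain ⟨_, ⟨x, hx, rfl⟩, hx'⟩ := h (o.symm '' s) (o.symm b) (hs.image _)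
    (hd.mono_comp fun _ _ h => o.symm.monotone h) (o.symm.isLUB_image'.2 hb)
    (o.le_symm_apply.2 hab)
  exact ⟨x, hx, o.le_symm_apply.1 hx'⟩

/-- Equivalences of module categories preserve finite generation, because a module is finitely
generated if and only if it is a compact element of its lattice of subobjects. -/
theorem _root_.ModuleCat.finite_obj_of_equivalence {A B : Type u} [Ring A] [Ring B]
    (e : ModuleCat.{u} A ≌ ModuleCat.{u} B) (M : ModuleCat.{u} A) [Module.Finite A M] :
    Module.Finite B (e.functor.obj M) := by
  let o : Submodule A M ≃o Submodule B (e.functor.obj M) :=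
    (ModuleCat.subobjectModule M).symm.trans
      ((Subobject.lowerEquivalence (MonoOver.congr M e)).toOrderIso.trans
        (ModuleCat.subobjectModule (e.functor.obj M)))
  refine ⟨(Submodule.fg_iff_compact _).2 ?_⟩
  rw [← o.map_top]
  exact o.isCompactElement ((Submodule.fg_iff_compact _).1 Module.Finite.fg_top)

theorem _root_.ModuleCat.projective_obj_of_equivalence {A B : Type u} [Ring A] [Ring B]
    (e : ModuleCat.{u} A ≌ ModuleCat.{u} B) (M : ModuleCat.{u} A) [Module.Projective A M] :
    Module.Projective B (e.functor.obj M) := by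
  rw [IsProjective.iff_projective] at *
  exact (e.map_projective_iff M).2 ‹_›

namespace Bimodule

section

variable {k : Type u} [Field k] {R S T : Type u} [Ring R] [Algebra k R] [Ring S] [Algebra k S]
  [Ring T] [Algebra k T]

theorem finite_projective_op (R : Type*) [Ring R] :
    Module.Finite Rᵐᵒᵖ R ∧ Module.Projective Rᵐᵒᵖ R :=
  finite_projective_of_dual_basis (n := 1) (fun _ => (1 : R))
    (fun _ => { toFun := op, map_add' := fun _ _ => rfl, map_smul' := fun _ _ => rfl })
    fun m => by simp

/-- The isomorphism `R ⊗_R N ≅ N` of right modules. -/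
noncomputable def tensorUnitIso (N : Bimodule k R S) :
    N.rightTensorFunctor.obj (ModuleCat.of Rᵐᵒᵖ R) ≅ ModuleCat.of Sᵐᵒᵖ N.carrier where
  hom := tensorDesc (M := ModuleCat.of Rᵐᵒᵖ R) (Z := ModuleCat.of Sᵐᵒᵖ N.carrier)
    (biadd (fun (r : R) n => r • n) (fun r r' n => add_smul _ _ _) (fun r n n' => smul_add _ _ _))
    (fun (r : R) s n => mul_smul r s n) (fun (r : R) t n => smul_comm r t n)
  inv := ModuleCat.ofHom
    { toFun := fun n => pure N (ModuleCat.of Rᵐᵒᵖ R) (1 : R) n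
      map_add' := fun n n' => pure_add _ _ _
      map_smul' := fun t n => rfl }
  hom_inv_id := tensorHom_ext fun (r : R) n => by
    change pure N (ModuleCat.of Rᵐᵒᵖ R) (1 : R) (r • n) = pure N (ModuleCat.of Rᵐᵒᵖ R) r n
    rw [← pure_balanced]
    exact congrArg (fun a : R => pure N (ModuleCat.of Rᵐᵒᵖ R) a n) (one_mul r)
  inv_hom_id := by
    ext n
    exact one_smul R n

theorem finite_rightTensorFunctor_obj (N : Bimodule k R S) (hN : Module.Finite Sᵐᵒᵖ N.carrier)
    (M : ModuleCat.{u} Rᵐᵒᵖ) (hM : Module.Finite Rᵐᵒᵖ M) :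
    Module.Finite Sᵐᵒᵖ (N.rightTensorFunctor.obj M) :=
  finite_tensor (U := ofRight k M) hM hN

instance (N : Bimodule k R S) : N.rightTensorFunctor.PreservesEpimorphisms where
  preserves {M M'} f hf := by
    rw [ModuleCat.epi_iff_surjective] at hf ⊢
    intro y
    induction y using pure_induction with
    | h0 => exact ⟨0, map_zero _⟩
    | h1 m n =>
      obtain ⟨m, rfl⟩ := hf m
      exact ⟨pure N M m n, rfl⟩
    | h2 a b ha hb =>
      obtain ⟨a, rfl⟩ := ha
      obtain ⟨b, rfl⟩ := hb
      exact ⟨a + b, map_add _ _ _⟩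

/-- If `- ⊗_R N` has a left adjoint `W`, then `N` is finitely generated projective as a left
module: writing the image of `1` under the unit `S → W(S) ⊗_R N` as `∑ y_i ⊗ n_i`, every `n : N`
is `∑ ĥ(y_i) n_i`, where `ĥ : W(S) → R` corresponds to `s ↦ n s` under the adjunction. -/
theorem finite_projective_left_of_isRightAdjoint (N : Bimodule k R S)
    [N.rightTensorFunctor.IsRightAdjoint] :
    Module.Finite R N.carrier ∧ Module.Projective R N.carrier := by
  let adj := Adjunction.ofIsRightAdjoint N.rightTensorFunctor
  set W := N.rightTensorFunctor.leftAdjoint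
  let RR := ModuleCat.of Rᵐᵒᵖ R
  let SS := ModuleCat.of Sᵐᵒᵖ S
  let u : N.rightTensorFunctor.obj (W.obj SS) := adj.unit.app SS (1 : S)
  have hu : ∃ (l : ℕ) (y : Fin l → W.obj SS) (n : Fin l → N.carrier),
      u = ∑ i, pure N _ (y i) (n i) := by
    generalize u = u
    induction u using pure_induction with
    | h0 => exact ⟨0, Fin.elim0, Fin.elim0, by simp⟩
    | h1 m n => exact ⟨1, fun _ => m, fun _ => n, by simp⟩
    | h2 a b ha hb =>
      obtain ⟨l, y, n, rfl⟩ := ha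
      obtain ⟨l', y', n', rfl⟩ := hb
      exact ⟨l + l', Fin.append y y', Fin.append n n', by simp [Fin.sum_univ_add]⟩
  obtain ⟨l, y, n, hu⟩ := hu
  -- `c x` is the morphism `S → R ⊗ N` sending `1` to `1 ⊗ x`
  let c (x : N.carrier) : SS ⟶ N.rightTensorFunctor.obj RR :=
    ModuleCat.ofHom (Y := N.rightTensorFunctor.obj RR)
      { toFun := fun s => pure N RR (1 : R) (op s • x)
        map_add' := fun s s' => by rw [MulOpposite.op_add, add_smul, pure_add]
        map_smul' := fun t s => congrArg (pure N RR (1 : R)) (mul_smul t (op s) x) }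
  have hc (f : W.obj SS ⟶ RR) (x : N.carrier) :
      f = (adj.homEquiv _ _).symm (c x) ↔ ∑ i, (f (y i) : R) • n i = x := by
    rw [Equiv.eq_symm_apply]
    have h1 : (adj.homEquiv _ _ f) (1 : S) = ∑ i, pure N RR (f (y i)) (n i) := by
      rw [adj.homEquiv_unit]
      change N.rightTensorFunctor.map f u = _
      rw [hu, map_sum]
      rfl
    have h2 : N.tensorUnitIso.hom (adj.homEquiv _ _ f (1 : S)) = ∑ i, (f (y i) : R) • n i := by
      rw [h1, map_sum]
      rfl
    have h3 : N.tensorUnitIso.hom (c x (1 : S)) = x :=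
      (one_smul R _).trans (one_smul Sᵐᵒᵖ x)
    rw [← h2]
    refine ⟨fun h => by rw [h]; exact h3, fun h => ?_⟩
    have h4 : adj.homEquiv _ _ f (1 : S) = c x (1 : S) := by
      have := congrArg N.tensorUnitIso.inv (h.trans h3.symm)
      simpa using this
    ext
    exact h4
  let h (x : N.carrier) : W.obj SS ⟶ RR := (adj.homEquiv _ _).symm (c x)
  have hh (x : N.carrier) : ∑ i, (h x (y i) : R) • n i = x := (hc _ x).1 rfl
  let mulLeft (r : R) : RR ⟶ RR := ModuleCat.ofHom
    { toFun := fun a => (r * a : R)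
      map_add' := fun a b => mul_add r a b
      map_smul' := fun s a => (mul_assoc r a (unop s)).symm }
  have hadd (x x' : N.carrier) : h (x + x') = h x + h x' := by
    refine ((hc _ _).2 ?_).symm
    calc ∑ i, ((h x + h x') (y i) : R) • n i
        = ∑ i, ((h x (y i) : R) • n i + (h x' (y i) : R) • n i) :=
          Finset.sum_congr rfl fun i _ => add_smul (h x (y i) : R) (h x' (y i)) (n i)
      _ = x + x' := by rw [Finset.sum_add_distrib, hh, hh]
  have hsmul (r : R) (x : N.carrier) : h (r • x) = h x ≫ mulLeft r := by
    refine ((hc _ _).2 ?_).symm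
    calc ∑ i, ((h x ≫ mulLeft r) (y i) : R) • n i = ∑ i, r • (h x (y i) : R) • n i :=
          Finset.sum_congr rfl fun i _ => mul_smul r (h x (y i) : R) (n i)
      _ = r • x := by rw [← Finset.smul_sum, hh]
  exact finite_projective_of_dual_basis n
    (fun i =>
      { toFun := fun x => h x (y i)
        map_add' := fun x x' => by rw [hadd]; rfl
        map_smul' := fun r x => by rw [hsmul]; rfl }) hh

variable {R' S' : Type u} [Ring R'] [Algebra k R'] [Ring S'] [Algebra k S']

/-- If `- ⊗ N` and `- ⊗ N'` correspond to each other under equivalences of module categories and `N`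
is finitely generated projective on each side, then so is `N'`. -/
theorem IsFGProjective.of_iso {N : Bimodule k R S} (hN : N.IsFGProjective)
    {N' : Bimodule k R' S'} {e : ModuleCat.{u} Rᵐᵒᵖ ≌ ModuleCat.{u} R'ᵐᵒᵖ}
    {f : ModuleCat.{u} Sᵐᵒᵖ ≌ ModuleCat.{u} S'ᵐᵒᵖ}
    (θ : e.functor ⋙ N'.rightTensorFunctor ≅ N.rightTensorFunctor ⋙ f.functor) :
    N'.IsFGProjective := by
  have := hN.finite_left
  have := hN.projective_left
  have := hN.finite_right
  have := hN.projective_right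
  have hadj := (N.dualPairLeft ‹_› ‹_›).adjunction
  have hadj' := (N.dualPairRight ‹_› ‹_›).adjunction
  have hl : Module.Finite R' N'.carrier ∧ Module.Projective R' N'.carrier := by
    have := hadj.isRightAdjoint
    have : (e.inverse ⋙ N.rightTensorFunctor ⋙ f.functor).IsRightAdjoint := inferInstance
    have i : e.inverse ⋙ N.rightTensorFunctor ⋙ f.functor ≅ N'.rightTensorFunctor :=
      Functor.isoWhiskerLeft e.inverse θ.symm ≪≫
        (Functor.associator _ _ _).symm ≪≫ Functor.isoWhiskerRight e.counitIso _ ≪≫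
          Functor.leftUnitor _
    have := Functor.isRightAdjoint_of_iso i
    exact N'.finite_projective_left_of_isRightAdjoint
  -- as a right module, `N' ≅ R' ⊗ N'` is the image of the regular module `R'`
  let M := e.inverse.obj (ModuleCat.of R'ᵐᵒᵖ R')
  obtain ⟨_, _⟩ := finite_projective_op R'
  have hM : Module.Finite Rᵐᵒᵖ M := ModuleCat.finite_obj_of_equivalence e.symm _
  have hM' : Module.Projective Rᵐᵒᵖ M := ModuleCat.projective_obj_of_equivalence e.symm _
  have i : f.functor.obj (N.rightTensorFunctor.obj M) ≅ ModuleCat.of S'ᵐᵒᵖ N'.carrier :=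
    (θ.symm.app M) ≪≫ N'.rightTensorFunctor.mapIso (e.counitIso.app _) ≪≫ N'.tensorUnitIso
  have := N.finite_rightTensorFunctor_obj ‹_› M hM
  have : Module.Projective Sᵐᵒᵖ (N.rightTensorFunctor.obj M) := by
    rw [IsProjective.iff_projective] at hM' ⊢
    exact hadj'.map_projective _ hM'
  have := ModuleCat.finite_obj_of_equivalence f (N.rightTensorFunctor.obj M)
  have := ModuleCat.projective_obj_of_equivalence f (N.rightTensorFunctor.obj M)
  exact ⟨hl.1, hl.2, Module.Finite.equiv i.toLinearEquiv,
    Module.Projective.of_equiv i.toLinearEquiv⟩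

end

end Bimodule

/-! ### Morita equivalences between sequences of iterated duals -/

open Bimodule

/-- A compatible family of Morita equivalences between two sequences of bimodules: `k`-linear
equivalences `e_i` between the categories of right modules over `F_i` and `F'_i`, intertwining the
functors `- ⊗ N_i` and `- ⊗ N'_i` and the relations `Q_i` and `Q'_i`. -/
structure BimoduleSeq.MoritaEquiv {k : Type u} [Field k] (D D' : BimoduleSeq k) where
  e : ∀ i, ModuleCat.{u} (D.F i).carrierᵐᵒᵖ ≌ ModuleCat.{u} (D'.F i).carrierᵐᵒᵖ
  additive : ∀ i, (e i).functor.Additive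
  linear : ∀ i, (e i).functor.Linear k
  θ : ∀ i, (e i).functor ⋙ (D'.N i).rightTensorFunctor ≅
    (D.N i).rightTensorFunctor ⋙ (e (i + 1)).functor
  kills_iff : ∀ (i : ℤ) (M : ModuleCat.{u} (D.F i).carrierᵐᵒᵖ)
    (Z : ModuleCat.{u} (D.F (i + 1 + 1)).carrierᵐᵒᵖ)
    (g : (D.N (i + 1)).rightTensorFunctor.obj ((D.N i).rightTensorFunctor.obj M) ⟶ Z),
    Kills (D.Q i) g ↔ Kills (D'.Q i)
      ((D'.N (i + 1)).rightTensorFunctor.map ((θ i).hom.app M) ≫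
        (θ (i + 1)).hom.app ((D.N i).rightTensorFunctor.obj M) ≫ (e (i + 1 + 1)).functor.map g)

namespace Bimodule

section

variable {k : Type u} [Field k] {R S R' S' : Type u} [Ring R] [Algebra k R] [Ring S] [Algebra k S]
  [Ring R'] [Algebra k R'] [Ring S'] [Algebra k S']

/-- Squares of functors compatible with the units of dualities match the relations. -/
theorem DualPair.kills_iff_kills {X : Bimodule k R S} {Y : Bimodule k S R} (P : DualPair X Y)
    {X' : Bimodule k R' S'} {Y' : Bimodule k S' R'} (P' : DualPair X' Y')
    {Q : Submodule k (X.tensor Y).carrier} (hQ : ∀ q, q ∈ Q ↔ ∃ r : R, q = r • P.coev)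
    {Q' : Submodule k (X'.tensor Y').carrier} (hQ' : ∀ q, q ∈ Q' ↔ ∃ r : R', q = r • P'.coev)
    (e : ModuleCat.{u} Rᵐᵒᵖ ≌ ModuleCat.{u} R'ᵐᵒᵖ) [e.functor.Additive]
    (f : ModuleCat.{u} Sᵐᵒᵖ ≌ ModuleCat.{u} S'ᵐᵒᵖ)
    (θ : e.functor ⋙ X'.rightTensorFunctor ≅ X.rightTensorFunctor ⋙ f.functor)
    (θ' : f.functor ⋙ Y'.rightTensorFunctor ≅ Y.rightTensorFunctor ⋙ e.functor)
    (h : ∀ M, P'.adjunction.unit.app (e.functor.obj M) ≫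
      Y'.rightTensorFunctor.map (θ.hom.app M) ≫ θ'.hom.app (X.rightTensorFunctor.obj M) =
        e.functor.map (P.adjunction.unit.app M))
    (M Z : ModuleCat.{u} Rᵐᵒᵖ) (g : Y.rightTensorFunctor.obj (X.rightTensorFunctor.obj M) ⟶ Z) :
    Kills Q g ↔ Kills Q' (Y'.rightTensorFunctor.map (θ.hom.app M) ≫
      θ'.hom.app (X.rightTensorFunctor.obj M) ≫ e.functor.map g) := by
  have h' : P'.adjunction.unit.app (e.functor.obj M) ≫ (Y'.rightTensorFunctor.map (θ.hom.app M) ≫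
      θ'.hom.app (X.rightTensorFunctor.obj M) ≫ e.functor.map g) =
        e.functor.map (P.adjunction.unit.app M ≫ g) := by
    rw [e.functor.map_comp, ← h M]
    simp only [Category.assoc]
  have h'' := P'.kills_iff hQ' (Y'.rightTensorFunctor.map (θ.hom.app M) ≫
      θ'.hom.app (X.rightTensorFunctor.obj M) ≫ e.functor.map g)
  rw [P.kills_iff hQ, h'', h', Functor.map_eq_zero_iff]

/-- The duality with the right dual of a bimodule that is finitely generated projective on each
side. -/
noncomputable abbrev IsFGProjective.dualPairRight {N : Bimodule k R S} (h : N.IsFGProjective) :=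
  N.dualPairRight h.finite_right h.projective_right

/-- The duality with the left dual of a bimodule that is finitely generated projective on each
side. -/
noncomputable abbrev IsFGProjective.dualPairLeft {N : Bimodule k R S} (h : N.IsFGProjective) :=
  N.dualPairLeft h.finite_left h.projective_left

end

section

variable {k : Type u} [Field k] {R S R' S' : KAlg.{u} k}
  (e : ModuleCat.{u} R.carrierᵐᵒᵖ ≌ ModuleCat.{u} R'.carrierᵐᵒᵖ)
  (f : ModuleCat.{u} S.carrierᵐᵒᵖ ≌ ModuleCat.{u} S'.carrierᵐᵒᵖ)

/-- The equivalences `e`, `f`, `e`, `f`, … between modules over the rings of index `n : ℕ`. -/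
def equivNat : ∀ n : ℕ, ModuleCat.{u} (baseNat R S n).carrierᵐᵒᵖ ≌
    ModuleCat.{u} (baseNat R' S' n).carrierᵐᵒᵖ
  | 0 => e
  | 1 => f
  | n + 2 => equivNat n

/-- The equivalences `e` in even and `f` in odd degrees, by the same case distinction as in the
definition of the rings `F_i`. -/
def equivInt : ∀ i : ℤ, ModuleCat.{u} (base R S i).carrierᵐᵒᵖ ≌
    ModuleCat.{u} (base R' S' i).carrierᵐᵒᵖ
  | .ofNat n => equivNat e f n
  | .negSucc n => equivNat e f (n + 1)

theorem equivNat_linear [e.functor.Additive] [f.functor.Additive] [e.functor.Linear k]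
    [f.functor.Linear k] :
    ∀ n, (equivNat e f n).functor.Additive ∧ (equivNat e f n).functor.Linear k
  | 0 => ⟨‹_›, ‹_›⟩
  | 1 => ⟨‹_›, ‹_›⟩
  | n + 2 => equivNat_linear n

theorem equivInt_linear [e.functor.Additive] [f.functor.Additive] [e.functor.Linear k]
    [f.functor.Linear k] :
    ∀ i, (equivInt e f i).functor.Additive ∧ (equivInt e f i).functor.Linear k
  | .ofNat n => equivNat_linear e f n
  | .negSucc n => equivNat_linear e f (n + 1)

variable {N : Bimodule k R.carrier S.carrier} {N' : Bimodule k R'.carrier S'.carrier}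
  (θ : e.functor ⋙ N'.rightTensorFunctor ≅ N.rightTensorFunctor ⋙ f.functor)

variable {e f}

/-- The equivalences intertwine tensoring with the iterated right duals of `N` and `N'`. -/
noncomputable def isoPos (hN : ∀ n, (dualPos N n).IsFGProjective) : ∀ n,
    (equivNat e f n).functor ⋙ (dualPos N' n).rightTensorFunctor ≅
      (dualPos N n).rightTensorFunctor ⋙ (equivNat e f (n + 1)).functor
  | 0 => θ
  | n + 1 => rightMate (hN n).dualPairRight.adjunction
      ((hN n).of_iso (isoPos hN n)).dualPairRight.adjunction _ _ (isoPos hN n)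

/-- The equivalences intertwine tensoring with the iterated left duals of `N` and `N'`. -/
noncomputable def isoNeg (hN : ∀ n, (dualNeg N n).IsFGProjective) : ∀ n,
    (equivNat e f n).functor ⋙ (dualNeg N' n).rightTensorFunctor ≅
      (dualNeg N n).rightTensorFunctor ⋙ (equivNat e f (n + 1)).functor
  | 0 => θ
  | n + 1 => leftMate (hN n).dualPairLeft.adjunction
      ((hN n).of_iso (isoNeg hN n)).dualPairLeft.adjunction (equivNat e f (n + 1))
        (equivNat e f n) (isoNeg hN n)

theorem isFGProjective_dualPos (hN : ∀ i, (iterDual N i).IsFGProjective) (n : ℕ) :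
    (dualPos N n).IsFGProjective := hN n

theorem isFGProjective_dualNeg (hN : ∀ i, (iterDual N i).IsFGProjective) :
    ∀ n : ℕ, (dualNeg N n).IsFGProjective
  | 0 => hN 0
  | 1 => hN (.negSucc 0)
  | n + 2 => hN (.negSucc (n + 1))

/-- The equivalences intertwine tensoring with the iterated duals of `N` and `N'`. -/
noncomputable def isoInt (hN : ∀ i, (iterDual N i).IsFGProjective) : ∀ i,
    (equivInt e f i).functor ⋙ (iterDual N' i).rightTensorFunctor ≅
      (iterDual N i).rightTensorFunctor ⋙ (equivInt e f (i + 1)).functor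
  | .ofNat n => isoPos θ (isFGProjective_dualPos hN) n
  | .negSucc 0 => isoNeg θ (isFGProjective_dualNeg hN) 1
  | .negSucc (n + 1) => isoNeg θ (isFGProjective_dualNeg hN) (n + 2)

theorem kills_iff_pos (he : ∀ n, (equivNat e f n).functor.Additive)
    (hN : ∀ n, (dualPos N n).IsFGProjective) (n : ℕ)
    (M Z : ModuleCat.{u} (baseNat R S n).carrierᵐᵒᵖ)
    (g : (dualPos N (n + 1)).rightTensorFunctor.obj ((dualPos N n).rightTensorFunctor.obj M) ⟶ Z) :
    Kills (dualPos N n).unitRight g ↔ Kills (dualPos N' n).unitRight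
      ((dualPos N' (n + 1)).rightTensorFunctor.map ((isoPos θ hN n).hom.app M) ≫
        (isoPos θ hN (n + 1)).hom.app ((dualPos N n).rightTensorFunctor.obj M) ≫
          (equivNat e f (n + 2)).functor.map g) :=
  have := he n
  (hN n).dualPairRight.kills_iff_kills ((hN n).of_iso (isoPos θ hN n)).dualPairRight
    (mem_unitRight_iff _ _ _) (mem_unitRight_iff _ _ _) _ _ (isoPos θ hN n) (isoPos θ hN (n + 1))
    (unit_rightMate _ _ _ _ _) M Z g

theorem kills_iff_neg (he : ∀ n, (equivNat e f n).functor.Additive)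
    (hN : ∀ n, (dualNeg N n).IsFGProjective) (n : ℕ)
    (M Z : ModuleCat.{u} (baseNat R S (n + 1)).carrierᵐᵒᵖ)
    (g : (dualNeg N n).rightTensorFunctor.obj ((dualNeg N (n + 1)).rightTensorFunctor.obj M) ⟶ Z) :
    Kills (dualNeg N n).unitLeft g ↔ Kills (dualNeg N' n).unitLeft
      ((dualNeg N' n).rightTensorFunctor.map ((isoNeg θ hN (n + 1)).hom.app M) ≫
        (isoNeg θ hN n).hom.app ((dualNeg N (n + 1)).rightTensorFunctor.obj M) ≫
          (equivNat e f (n + 1)).functor.map g) :=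
  have := he (n + 1)
  (hN n).dualPairLeft.kills_iff_kills ((hN n).of_iso (isoNeg θ hN n)).dualPairLeft
    (mem_unitLeft_iff _ _ _) (mem_unitLeft_iff _ _ _) _ (equivNat e f n) (isoNeg θ hN (n + 1))
    (isoNeg θ hN n) (unit_leftMate _ _ _ _ _) M Z g

/-- The equivalences match the relations `Q_i` of `N` and `N'`. -/
theorem kills_iff_int (he : ∀ n, (equivNat e f n).functor.Additive)
    (hN : ∀ i, (iterDual N i).IsFGProjective) : ∀ (i : ℤ)
    (M : ModuleCat.{u} (base R S i).carrierᵐᵒᵖ)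
    (Z : ModuleCat.{u} (base R S (i + 1 + 1)).carrierᵐᵒᵖ)
    (g : (iterDual N (i + 1)).rightTensorFunctor.obj ((iterDual N i).rightTensorFunctor.obj M) ⟶ Z),
    Kills (unitRel N i) g ↔ Kills (unitRel N' i)
      ((iterDual N' (i + 1)).rightTensorFunctor.map ((isoInt θ hN i).hom.app M) ≫
        (isoInt θ hN (i + 1)).hom.app ((iterDual N i).rightTensorFunctor.obj M) ≫
          (equivInt e f (i + 1 + 1)).functor.map g)
  | .ofNat n => kills_iff_pos θ he (isFGProjective_dualPos hN) n
  | .negSucc 0 => kills_iff_neg θ he (isFGProjective_dualNeg hN) 0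
  | .negSucc 1 => kills_iff_neg θ he (isFGProjective_dualNeg hN) 1
  | .negSucc (n + 2) => kills_iff_neg θ he (isFGProjective_dualNeg hN) (n + 2)

end

section

variable {k : Type u} [Field k] {R S R' S' : Type u} [Ring R] [Algebra k R] [Ring S] [Algebra k S]
  [Ring R'] [Algebra k R'] [Ring S'] [Algebra k S']
  {N : Bimodule k R S} {N' : Bimodule k R' S'}
  {e : ModuleCat.{u} Rᵐᵒᵖ ≌ ModuleCat.{u} R'ᵐᵒᵖ} {f : ModuleCat.{u} Sᵐᵒᵖ ≌ ModuleCat.{u} S'ᵐᵒᵖ}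

/-- Admissibility is invariant under Morita equivalence. -/
theorem Admissible.of_iso (hN : N.Admissible)
    (θ : e.functor ⋙ N'.rightTensorFunctor ≅ N.rightTensorFunctor ⋙ f.functor) :
    N'.Admissible := fun i =>
  (hN i).of_iso (isoInt (R := ⟨R⟩) (S := ⟨S⟩) (R' := ⟨R'⟩) (S' := ⟨S'⟩) θ hN i)

/-- A Morita equivalence between bimodules induces one between the sequences of their iterated duals,
the relations being matched because mates are compatible with units. -/
noncomputable def Admissible.moritaEquiv [e.functor.Additive] [f.functor.Additive]
    [e.functor.Linear k] [f.functor.Linear k] (hN : N.Admissible)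
    (θ : e.functor ⋙ N'.rightTensorFunctor ≅ N.rightTensorFunctor ⋙ f.functor) :
    N.ncSym.MoritaEquiv N'.ncSym where
  e := equivInt (R := ⟨R⟩) (S := ⟨S⟩) (R' := ⟨R'⟩) (S' := ⟨S'⟩) e f
  additive i := (equivInt_linear (R := ⟨R⟩) (S := ⟨S⟩) (R' := ⟨R'⟩) (S' := ⟨S'⟩) e f i).1
  linear i := (equivInt_linear (R := ⟨R⟩) (S := ⟨S⟩) (R' := ⟨R'⟩) (S' := ⟨S'⟩) e f i).2
  θ := isoInt (R := ⟨R⟩) (S := ⟨S⟩) (R' := ⟨R'⟩) (S' := ⟨S'⟩) θ hN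
  kills_iff := kills_iff_int (R := ⟨R⟩) (S := ⟨S⟩) (R' := ⟨R'⟩) (S' := ⟨S'⟩) θ
    (fun n => (equivNat_linear (R := ⟨R⟩) (S := ⟨S⟩) (R' := ⟨R'⟩) (S' := ⟨S'⟩) e f n).1) hN

end

end Bimodule

/-! ### Graded modules by generators and relations -/

namespace BimoduleSeq

open Bimodule DirectSum

variable {k : Type u} [Field k] (D : BimoduleSeq k)

/-- Generators and relations for graded modules: a sequence of right `F_i`-modules `M_i` and maps
`M_i ⊗ N_i → M_{i+1}` such that `M_i ⊗ N_i ⊗ N_{i+1} → M_{i+2}` kills the relations `Q_i`. -/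
structure Rep : Type (u + 1) where
  obj : ∀ i, ModuleCat.{u} (D.F i).carrierᵐᵒᵖ
  act : ∀ i, (D.N i).rightTensorFunctor.obj (obj i) ⟶ obj (i + 1)
  kills : ∀ i, Kills (D.Q i) ((D.N (i + 1)).rightTensorFunctor.map (act i) ≫ act (i + 1))

namespace Rep

variable {D}

/-- The vector space of morphisms `X ⟶ Y`: families of linear maps commuting with the actions. -/
def homSubmodule (X Y : D.Rep) : Submodule k (∀ i, X.obj i ⟶ Y.obj i) where
  carrier := {f | ∀ i, X.act i ≫ f (i + 1) = (D.N i).rightTensorFunctor.map (f i) ≫ Y.act i}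
  zero_mem' i := by simp
  add_mem' {f g} hf hg i := by
    simp only [Pi.add_apply, Preadditive.comp_add, Functor.map_add, Preadditive.add_comp, hf i, hg i]
  smul_mem' c f hf i := by
    simp only [Pi.smul_apply, Linear.comp_smul, Functor.map_smul, Linear.smul_comp, hf i]

instance : Category.{u} D.Rep where
  Hom X Y := homSubmodule X Y
  id X := ⟨fun i => 𝟙 _, fun i => by simp⟩
  comp f g := ⟨fun i => f.1 i ≫ g.1 i, fun i => by
    rw [← Category.assoc, f.2 i, Category.assoc, g.2 i, Functor.map_comp, Category.assoc]⟩
  id_comp _ := Subtype.ext (funext fun _ => Category.id_comp _)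
  comp_id _ := Subtype.ext (funext fun _ => Category.comp_id _)
  assoc _ _ _ := Subtype.ext (funext fun _ => Category.assoc _ _ _)

instance : Preadditive D.Rep where
  homGroup X Y := inferInstanceAs (AddCommGroup (homSubmodule X Y))
  add_comp _ _ _ _ _ _ := Subtype.ext (funext fun _ => Preadditive.add_comp _ _ _ _ _ _)
  comp_add _ _ _ _ _ _ := Subtype.ext (funext fun _ => Preadditive.comp_add _ _ _ _ _ _)

instance : Linear k D.Rep where
  homModule X Y := inferInstanceAs (Module k (homSubmodule X Y))
  smul_comp _ _ _ r f g := Subtype.ext (funext fun i => Linear.smul_comp _ _ _ r (f.1 i) (g.1 i))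
  comp_smul _ _ _ f r g := Subtype.ext (funext fun i => Linear.comp_smul _ _ _ (f.1 i) r (g.1 i))

theorem hom_ext {X Y : D.Rep} {f g : X ⟶ Y} (h : ∀ i, f.1 i = g.1 i) : f = g :=
  Subtype.ext (funext h)

/-- An isomorphism of families of modules with an action, from its components. -/
def isoMk {X Y : D.Rep} (f : ∀ i, X.obj i ≅ Y.obj i)
    (h : ∀ i, X.act i ≫ (f (i + 1)).hom = (D.N i).rightTensorFunctor.map (f i).hom ≫ Y.act i) :
    X ≅ Y where
  hom := ⟨fun i => (f i).hom, h⟩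
  inv := ⟨fun i => (f i).inv, fun i => by
    rw [Iso.comp_inv_eq, Category.assoc, h, ← Category.assoc, ← Functor.map_comp, Iso.inv_hom_id,
      CategoryTheory.Functor.map_id, Category.id_comp]⟩
  hom_inv_id := hom_ext fun i => (f i).hom_inv_id
  inv_hom_id := hom_ext fun i => (f i).inv_hom_id

end Rep

/-! ### From graded modules to generators and relations -/

/-- The element of `A_{ii}` given by `r ∈ F_i`. -/
noncomputable def scal (i : ℤ) : (D.F i).carrier →ₗ[k] (D.pt i ⟶ D.pt i) :=
  D.hom (.nil (i := i))

/-- The element of `A_{i,i+1}` given by `n ∈ N_i`. -/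
noncomputable def step {i : ℤ} : (D.N i).carrier →ₗ[k] (D.pt i ⟶ D.pt (i + 1)) :=
  (D.hom (.snoc .nil)).comp (D.snocT .nil (D.oneT i))

variable {D}

theorem hom_comp_step {i j : ℤ} (p : Path i j) (x : (D.T p).carrier) (n : (D.N j).carrier) :
    D.hom p x ≫ D.step n = D.hom p.snoc (D.snocT p x n) := by
  refine (hom_comp p (.snoc .nil) x _).trans ?_
  change D.hom p.snoc (D.snocT p (D.mulT p .nil x (D.oneT j)) n) = _
  rw [mulT_oneT]

theorem hom_comp_scal {i j : ℤ} (p : Path i j) (x : (D.T p).carrier) (r : (D.F j).carrier) :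
    D.hom p x ≫ D.scal j r = D.hom p (op r • x) :=
  hom_comp p .nil x _

theorem scal_one (i : ℤ) : D.scal i 1 = 𝟙 (D.pt i) := rfl

theorem scal_comp_step {i : ℤ} (r : (D.F i).carrier) (n : (D.N i).carrier) :
    D.scal i r ≫ D.step n = D.step (r • n) := by
  have h : D.scal i r = D.hom .nil (op r • D.oneT i) :=
    congrArg (D.scal i) (one_mul r).symm
  rw [h, hom_comp_step]
  exact congrArg (D.hom (.snoc .nil)) (tmul_balanced (D.oneT i) r n)

theorem step_comp_scal {i : ℤ} (r : (D.F (i + 1)).carrier) (n : (D.N i).carrier) :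
    D.step n ≫ D.scal (i + 1) r = D.step (op r • n) :=
  hom_comp_scal _ _ _

theorem scal_comp_scal {i : ℤ} (r s : (D.F i).carrier) :
    D.scal i r ≫ D.scal i s = D.scal i (r * s) :=
  hom_comp_scal (.nil (i := i)) _ _

theorem map_map_apply (M : D.GrMod) {i j l : D.Alg} (a : i ⟶ j) (b : j ⟶ l) (m : M.deg i) :
    M.obj.map b (M.obj.map a m) = M.obj.map (a ≫ b) m := by
  rw [M.obj.map_comp]; rfl

theorem map_add_apply (M : D.GrMod) {i j : D.Alg} (a b : i ⟶ j) (m : M.deg i) :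
    M.obj.map (a + b) m = M.obj.map a m + M.obj.map b m := by
  have := M.property.1
  rw [M.obj.map_add]; rfl

theorem map_zero_apply (M : D.GrMod) {i j : D.Alg} (m : M.deg i) :
    M.obj.map (0 : i ⟶ j) m = 0 := by
  have := M.property.1
  rw [M.obj.map_zero]; rfl

theorem map_smul_apply (M : D.GrMod) {i j : D.Alg} (c : k) (a : i ⟶ j) (m : M.deg i) :
    M.obj.map (c • a) m = c • M.obj.map a m := by
  have := M.property.1
  have := M.property.2
  rw [M.obj.map_smul]; rfl

/-- The right action of `F_i = A_{ii}` on `M_i`. -/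
@[reducible] noncomputable def degModule (M : D.GrMod) (i : ℤ) :
    Module (D.F i).carrierᵐᵒᵖ (M.deg (D.pt i)) where
  smul r m := M.obj.map (D.scal i (unop r)) m
  one_smul m := by
    change M.obj.map (𝟙 (D.pt i)) m = m
    rw [M.obj.map_id]; rfl
  mul_smul r s m := by
    change M.obj.map (D.scal i (unop s * unop r)) m =
      M.obj.map (D.scal i (unop r)) (M.obj.map (D.scal i (unop s)) m)
    rw [map_map_apply, scal_comp_scal]
  smul_zero r := map_zero (M.obj.map (D.scal i (unop r))).hom
  smul_add r m m' := map_add (M.obj.map (D.scal i (unop r))).hom m m'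
  add_smul r s m := by
    change M.obj.map (D.scal i (unop r + unop s)) m = _
    rw [map_add, map_add_apply]
    rfl
  zero_smul m := by
    change M.obj.map (D.scal i 0) m = _
    rw [map_zero, map_zero_apply]

/-- The component `M_i` of a graded module, as a right `F_i`-module. -/
noncomputable def degMod (M : D.GrMod) (i : ℤ) : ModuleCat.{u} (D.F i).carrierᵐᵒᵖ :=
  letI := degModule M i
  ModuleCat.of _ (M.deg (D.pt i))

theorem degMod_smul (M : D.GrMod) {i : ℤ} (r : (D.F i).carrierᵐᵒᵖ) (m : degMod M i) :
    r • m = M.obj.map (D.scal i (unop r)) m := rfl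

/-- The action `M_i ⊗ N_i → M_{i+1}` of `A_{i,i+1} = N_i`. -/
noncomputable def degAct (M : D.GrMod) (i : ℤ) :
    (D.N i).rightTensorFunctor.obj (degMod M i) ⟶ degMod M (i + 1) :=
  tensorDesc (M := degMod M i) (Z := degMod M (i + 1))
    (biadd (fun (m : M.deg (D.pt i)) n => (M.obj.map (D.step n) m : M.deg (D.pt (i + 1))))
      (fun m m' n => map_add _ _ _)
      (fun m n n' => by rw [map_add]; exact map_add_apply M _ _ _))
    (fun (m : M.deg (D.pt i)) s n => by
      change M.obj.map (D.step n) (M.obj.map (D.scal i s) m) = M.obj.map (D.step (s • n)) m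
      rw [map_map_apply, scal_comp_step])
    (fun (m : M.deg (D.pt i)) t n => by
      change M.obj.map (D.step (op (unop t) • n)) m =
        M.obj.map (D.scal (i + 1) (unop t)) (M.obj.map (D.step n) m)
      rw [map_map_apply, step_comp_scal])

/-- The two-step action factors through `A_{i,i+2}`, so that it kills the relations `Q_i`. -/
theorem degAct_insertPure (M : D.GrMod) {i : ℤ} (m : degMod M i)
    (q : ((D.N i).tensor (D.N (i + 1))).carrier) :
    degAct M (i + 1) ((D.N (i + 1)).rightTensorFunctor.map (degAct M i)
      (insertPure (D.N i) (D.N (i + 1)) (degMod M i) m q)) =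
        M.obj.map (D.hom (.snoc (.snoc .nil)) (D.snocT₂ .nil (D.oneT i) q)) m := by
  induction q using tensor_induction with
  | h0 =>
    rw [map_zero, map_zero, map_zero, map_zero, map_zero]
    exact (map_zero_apply M _).symm
  | h1 a b =>
    rw [snocT₂_tmul, ← hom_comp_step]
    exact map_map_apply M _ _ _
  | h2 a b ha hb =>
    rw [map_add, map_add, map_add, ha, hb, map_add, map_add]
    exact (map_add_apply M _ _ _).symm

variable (D) in
/-- A graded module, in terms of generators and relations of the `ℤ`-algebra. -/
noncomputable def toRep : D.GrMod ⥤ D.Rep where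
  obj M :=
    { obj := degMod M
      act := degAct M
      kills := fun i m q hq => by
        refine (degAct_insertPure M m q).trans ?_
        have h : D.hom (.snoc (.snoc .nil)) (D.snocT₂ .nil (D.oneT i) q) = 0 :=
          D.cls_eq_zero _ _ (by
            rw [R_snoc_snoc]
            exact Submodule.subset_span (Or.inr ⟨_, q, hq, rfl⟩))
        rw [h]
        exact map_zero_apply M _ }
  map {M M'} f := ⟨fun i => ModuleCat.ofHom (X := degMod M i) (Y := degMod M' i)
      { toFun := fun m => f.hom.app (D.pt i) m
        map_add' := fun m m' => map_add (f.hom.app (D.pt i)).hom m m'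
        map_smul' := fun r m => NatTrans.naturality_apply f.hom (D.scal i (unop r)) m },
    fun i => tensorHom_ext fun m n => NatTrans.naturality_apply f.hom (D.step n) m⟩
  map_id M := rfl
  map_comp f g := rfl

instance : D.toRep.Additive where
  map_add := rfl

end BimoduleSeq

namespace BimoduleSeq

open Bimodule DirectSum

variable {k : Type u} [Field k] {D : BimoduleSeq k}

theorem degMod_algebraMap_smul (M : D.GrMod) {i : ℤ} (c : k) (m : degMod M i) :
    op (algebraMap k (D.F i).carrier c) • m = c • (show M.deg (D.pt i) from m) := by
  rw [degMod_smul, unop_op, Algebra.algebraMap_eq_smul_one, map_smul, scal_one]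
  refine (map_smul_apply M c _ m).trans ?_
  rw [M.obj.map_id]
  rfl

instance : D.toRep.Linear k where
  map_smul {M M'} f c := Rep.hom_ext fun i => by
    ext m
    exact (degMod_algebraMap_smul M' c (f.hom.app (D.pt i) m)).symm

instance : D.toRep.Faithful where
  map_injective {M M'} f g h := by
    apply ObjectProperty.hom_ext
    ext i m
    exact congrArg (fun φ => (φ.1 i).hom m) h

/-- Maps commuting with the actions of the `F_i` and `N_i` commute with the actions of all tensors, by
induction on the length. -/
theorem toRep_map_hom_apply {M M' : D.GrMod} (g : D.toRep.obj M ⟶ D.toRep.obj M') {i : ℤ} :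
    ∀ {j : ℤ} (p : Path i j) (x : (D.T p).carrier) (m : degMod M i),
      (g.1 j (M.obj.map (D.hom p x) m : M.deg (D.pt j)) : degMod M' j) =
        M'.obj.map (D.hom p x) (g.1 i m : degMod M' i)
  | _, .nil, x, m => (g.1 i).hom.map_smul (op (α := (D.F i).carrier) x) m
  | _, .snoc (j := j) p, x, m => by
    induction x using T_induction with
    | h0 =>
      rw [map_zero]
      refine (congrArg (g.1 (j + 1)).hom (map_zero_apply M m)).trans ?_
      exact (map_zero (g.1 (j + 1)).hom).trans (map_zero_apply M' _).symm
    | h1 x n =>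
      rw [← hom_comp_step]
      refine (congrArg (g.1 (j + 1)).hom (map_map_apply M _ _ m).symm).trans ?_
      refine Eq.trans ?_ (map_map_apply M' _ _ _)
      refine Eq.trans ?_ (congrArg (M'.obj.map (D.step n)).hom (toRep_map_hom_apply g p x m))
      exact congrArg (fun φ => φ.hom (pure (D.N j) (degMod M j) (M.obj.map (D.hom p x) m) n)) (g.2 j)
    | h2 a b ha hb =>
      rw [map_add]
      refine (congrArg (g.1 (j + 1)).hom (map_add_apply M _ _ m)).trans ?_
      refine ((g.1 (j + 1)).hom.map_add _ _).trans ?_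
      refine Eq.trans ?_ (map_add_apply M' _ _ _).symm
      exact congrArg₂ (· + ·) ha hb

theorem toRep_map_apply {M M' : D.GrMod} (g : D.toRep.obj M ⟶ D.toRep.obj M') {i j : ℤ}
    (a : D.pt i ⟶ D.pt j) (m : degMod M i) :
      (g.1 j (M.obj.map a m : M.deg (D.pt j)) : degMod M' j) =
        M'.obj.map a (g.1 i m : degMod M' i) := by
  induction a using hom_induction with
  | h0 =>
    refine (congrArg (g.1 j).hom (map_zero_apply M m)).trans ?_
    exact (map_zero (g.1 j).hom).trans (map_zero_apply M' _).symm
  | h1 p x => exact toRep_map_hom_apply g p x m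
  | h2 a b ha hb =>
    refine (congrArg (g.1 j).hom (map_add_apply M _ _ m)).trans ?_
    refine ((g.1 j).hom.map_add _ _).trans ?_
    refine Eq.trans ?_ (map_add_apply M' _ _ _).symm
    exact congrArg₂ (· + ·) ha hb

instance : D.toRep.Full where
  map_surjective {M M'} g :=
    ⟨ObjectProperty.homMk
      { app := fun i => ModuleCat.ofHom (X := M.deg i) (Y := M'.deg i)
          { toFun := fun m => (g.1 i).hom m
            map_add' := fun m m' => (g.1 i).hom.map_add m m'
            map_smul' := fun c m =>
              (congrArg (g.1 i).hom (degMod_algebraMap_smul (i := i) M c m).symm).trans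
                (((g.1 i).hom.map_smul _ _).trans (degMod_algebraMap_smul (i := i) M' c _)) }
        naturality := fun i j a => by
          ext m
          exact toRep_map_apply g a m }, rfl⟩

/-! ### From generators and relations to graded modules -/

namespace Rep

variable (X : D.Rep)

/-- The action `M_i ⊗ N_i → M_{i+1}` as a linear map of vector spaces. -/
noncomputable def actLin (i : ℤ) :
    ((ofRight k (X.obj i)).tensor (D.N i)).carrier →ₗ[k] (ofRight k (X.obj (i + 1))).carrier where
  toFun z := X.act i z
  map_add' z z' := (X.act i).hom.map_add z z'
  map_smul' c z := (congrArg (X.act i).hom (smul_eq_op_algebraMap (Bimodule.tensor _ _) c z)).trans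
    ((X.act i).hom.map_smul (op (algebraMap k _ c)) z)

/-- The composition of a bilinear map that is right linear in the second variable with a right linear
map. -/
noncomputable def mulComp {A A' B C : Type u} [Ring A] [Algebra k A] [Ring A'] [Algebra k A']
    [Ring B] [Algebra k B] [Ring C] [Algebra k C]
    {U : Bimodule k A B} {V : Bimodule k B C} {W : Bimodule k A C} {W' : Bimodule k A' C}
    (f : {f : U.carrier →ₗ[k] V.carrier →ₗ[k] W.carrier //
      ∀ x y (s : Cᵐᵒᵖ), f x (s • y) = s • f x y}) (g : W.carrier →ₗ[k] W'.carrier)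
    (hg : ∀ (s : Cᵐᵒᵖ) w, g (s • w) = s • g w) :
    {f : U.carrier →ₗ[k] V.carrier →ₗ[k] W'.carrier //
      ∀ x y (s : Cᵐᵒᵖ), f x (s • y) = s • f x y} :=
  ⟨f.1.compr₂ g, fun x y s => (congrArg g (f.2 x y s)).trans (hg s _)⟩

/-- The action `M_i × T_{ij} → M_j`, which is right `F_j`-linear. -/
noncomputable def actAux {i : ℤ} : ∀ {j : ℤ} (p : Path i j),
    {f : (ofRight k (X.obj i)).carrier →ₗ[k] (D.T p).carrier →ₗ[k] (ofRight k (X.obj j)).carrier //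
      ∀ m x (s : (D.F j).carrierᵐᵒᵖ), f m (s • x) = s • f m x}
  | _, .nil => mulNil (ofRight k (X.obj i))
  | _, .snoc (j := j) p =>
    mulComp (mulStep (actAux p) (D.N j)) (X.actLin j) fun s z => (X.act j).hom.map_smul s z

/-- The action `M_i × T_{ij} → M_j`. -/
noncomputable def actT {i j : ℤ} (p : Path i j) :
    (ofRight k (X.obj i)).carrier →ₗ[k] (D.T p).carrier →ₗ[k] (ofRight k (X.obj j)).carrier :=
  (X.actAux p).1

theorem actT_smul {i j : ℤ} (p : Path i j) (m : (ofRight k (X.obj i)).carrier)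
    (x : (D.T p).carrier) (s : (D.F j).carrierᵐᵒᵖ) : X.actT p m (s • x) = s • X.actT p m x :=
  (X.actAux p).2 m x s

theorem actT_snocT {i j : ℤ} (p : Path i j) (m : (ofRight k (X.obj i)).carrier)
    (x : (D.T p).carrier) (n : (D.N j).carrier) :
    X.actT p.snoc m (D.snocT p x n) = X.act j (pure (D.N j) (X.obj j) (X.actT p m x) n) := rfl

theorem actT_snocT₂ {i j : ℤ} (p : Path i j) (m : (ofRight k (X.obj i)).carrier)
    (x : (D.T p).carrier) (q : ((D.N j).tensor (D.N (j + 1))).carrier) :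
    X.actT p.snoc.snoc m (D.snocT₂ p x q) =
      ((D.N (j + 1)).rightTensorFunctor.map (X.act j) ≫ X.act (j + 1))
        (insertPure (D.N j) (D.N (j + 1)) (X.obj j) (X.actT p m x) q) := by
  induction q using tensor_induction with
  | h0 => rw [map_zero, map_zero, map_zero, map_zero]; rfl
  | h1 a b => rfl
  | h2 a b ha hb => rw [map_add, map_add, map_add, map_add, ha, hb]; rfl

/-- The relations `R_{ij}` act by zero. -/
theorem actT_eq_zero {i : ℤ} : ∀ {j : ℤ} (p : Path i j) (x : (D.T p).carrier) (_ : x ∈ D.R p)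
    (m : (ofRight k (X.obj i)).carrier), X.actT p m x = 0
  | _, .nil, x, hx, m => by
      have : x = 0 := by simpa [R] using hx
      rw [this, map_zero]
  | _, .snoc .nil, x, hx, m => by
      have : x = 0 := by simpa [R] using hx
      rw [this, map_zero]
  | _, .snoc (.snoc (j := j) p), x, hx, m => by
      rw [R_snoc_snoc] at hx
      induction hx using Submodule.span_induction with
      | mem x h =>
        rcases h with ⟨x, hx, n, rfl⟩ | ⟨x, q, hq, rfl⟩
        · have h := actT_eq_zero p.snoc x hx m
          rw [actT_snocT, h]
          exact (congrArg (X.act (j + 1)).hom (zero_pure n)).trans (map_zero _)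
        · rw [actT_snocT₂]
          exact X.kills j _ q hq
      | zero => rw [map_zero]
      | add a b _ _ ha hb => rw [map_add, ha, hb, add_zero]
      | smul c a _ ha => rw [map_smul, ha, smul_zero]

theorem actT_mulT {i j : ℤ} (p : Path i j) (m : (ofRight k (X.obj i)).carrier)
    (x : (D.T p).carrier) : ∀ {l : ℤ} (q : Path j l) (y : (D.T q).carrier),
      X.actT (p.comp q) m (D.mulT p q x y) = X.actT q (X.actT p m x) y
  | _, .nil, y => X.actT_smul p m x (op (α := (D.F j).carrier) y)
  | _, .snoc (j := l) q, y => by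
      induction y using T_induction with
      | h0 => rw [map_zero, map_zero, map_zero]
      | h1 y n =>
        have h := actT_mulT p m x q y
        change X.act l (pure (D.N l) (X.obj l) (X.actT (p.comp q) m (D.mulT p q x y)) n) = _
        rw [h]
        rfl
      | h2 a b ha hb => rw [map_add, map_add, map_add, ha, hb]

/-- The action `A_{ij} → Hom(M_i, M_j)`. -/
noncomputable def actA (i j : ℤ) :
    D.A i j →ₗ[k] (ofRight k (X.obj i)).carrier →ₗ[k] (ofRight k (X.obj j)).carrier :=
  toModule k _ _ fun p => (D.R p).liftQ (X.actT p).flip fun x hx =>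
    LinearMap.ext fun m => X.actT_eq_zero p x hx m

theorem actA_cls {i j : ℤ} (p : Path i j) (x : (D.T p).carrier)
    (m : (ofRight k (X.obj i)).carrier) : X.actA i j (D.cls p x) m = X.actT p m x := by
  simp [actA, cls]
  rfl

theorem actA_one (i : ℤ) (m : (ofRight k (X.obj i)).carrier) : X.actA i i (D.one i) m = m := by
  rw [one, actA_cls]
  exact one_smul (D.F i).carrierᵐᵒᵖ m

theorem actA_mul {i j l : ℤ} (a : D.A i j) (b : D.A j l) (m : (ofRight k (X.obj i)).carrier) :
    X.actA i l (D.mul i j l a b) m = X.actA j l b (X.actA i j a m) := by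
  induction a using A_induction with
  | h0 => simp only [map_zero, LinearMap.zero_apply]
  | h2 a a' h h' => simp only [map_add, LinearMap.add_apply, h, h']
  | h1 p x =>
  induction b using A_induction with
  | h0 => simp only [map_zero, LinearMap.zero_apply]
  | h2 a a' h h' => simp only [map_add, LinearMap.add_apply, h, h']
  | h1 q y => rw [mul_cls, actA_cls, actA_cls, actA_cls, actT_mulT]

/-- The graded module with given generators and relations. -/
noncomputable def toGrMod : D.GrMod where
  obj :=
    { obj := fun i => ModuleCat.of k (ofRight k (X.obj i)).carrier
      map := fun {i j} a => ModuleCat.ofHom (X.actA i j a)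
      map_id := fun i => ModuleCat.hom_ext (LinearMap.ext fun m => X.actA_one i m)
      map_comp := fun a b => ModuleCat.hom_ext (LinearMap.ext fun m => X.actA_mul a b m) }
  property := ⟨⟨fun {i j a b} => ModuleCat.hom_ext ((X.actA i j).map_add a b)⟩,
    ⟨fun {i j} a r => ModuleCat.hom_ext ((X.actA i j).map_smul r a)⟩⟩

theorem degMod_toGrMod_smul {i : ℤ} (r : (D.F i).carrierᵐᵒᵖ) (m : degMod X.toGrMod i) :
    r • m = r • (show X.obj i from m) :=
  X.actA_cls (.nil (i := i)) (unop r : (D.F i).carrier) m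

/-- The graded module with given generators and relations has these generators and relations. -/
noncomputable def toRepIso : D.toRep.obj X.toGrMod ≅ X :=
  isoMk
    (fun i =>
      { hom := ModuleCat.ofHom (X := degMod X.toGrMod i) (Y := X.obj i)
          { toFun := fun m => m
            map_add' := fun _ _ => rfl
            map_smul' := fun r m => X.degMod_toGrMod_smul r m }
        inv := ModuleCat.ofHom (X := X.obj i) (Y := degMod X.toGrMod i)
          { toFun := fun m => m
            map_add' := fun _ _ => rfl
            map_smul' := fun r m => (X.degMod_toGrMod_smul r m).symm }
        hom_inv_id := rfl
        inv_hom_id := rfl })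
    fun i => tensorHom_ext fun m n => by
      refine (X.actA_cls (.snoc .nil) (D.snocT .nil (D.oneT i) n) m).trans ?_
      refine (X.actT_snocT .nil m (D.oneT i) n).trans ?_
      exact congrArg (fun m' => X.act i (pure (D.N i) (X.obj i) m' n))
        (one_smul (D.F i).carrierᵐᵒᵖ (show X.obj i from m))

end Rep

instance : D.toRep.EssSurj where
  mem_essImage X := ⟨X.toGrMod, ⟨X.toRepIso⟩⟩

instance : D.toRep.IsEquivalence where

end BimoduleSeq

/-! ### Transport of graded modules along Morita equivalences -/

namespace BimoduleSeq

open Bimodule DirectSum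

variable {k : Type u} [Field k] {D D' : BimoduleSeq k}

namespace MoritaEquiv

variable (E : D.MoritaEquiv D')

/-- The action of `N'_i` on the image of a family of modules under the Morita equivalences. -/
noncomputable def mapAct (X : D.Rep) (i : ℤ) :
    (D'.N i).rightTensorFunctor.obj ((E.e i).functor.obj (X.obj i)) ⟶
      (E.e (i + 1)).functor.obj (X.obj (i + 1)) :=
  (E.θ i).hom.app (X.obj i) ≫ (E.e (i + 1)).functor.map (X.act i)

theorem θ_naturality (i : ℤ) {M M' : ModuleCat.{u} (D.F i).carrierᵐᵒᵖ} (f : M ⟶ M') :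
    (D'.N i).rightTensorFunctor.map ((E.e i).functor.map f) ≫ (E.θ i).hom.app M' =
      (E.θ i).hom.app M ≫ (E.e (i + 1)).functor.map ((D.N i).rightTensorFunctor.map f) :=
  (E.θ i).hom.naturality f

theorem mapAct_comp_map {X Y : D.Rep} (f : ∀ i, X.obj i ⟶ Y.obj i) (i : ℤ)
    (hf : X.act i ≫ f (i + 1) = (D.N i).rightTensorFunctor.map (f i) ≫ Y.act i) :
    E.mapAct X i ≫ (E.e (i + 1)).functor.map (f (i + 1)) =
      (D'.N i).rightTensorFunctor.map ((E.e i).functor.map (f i)) ≫ E.mapAct Y i := by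
  have h2 := congrArg (E.e (i + 1)).functor.map hf
  rw [Functor.map_comp, Functor.map_comp] at h2
  refine (Category.assoc _ _ _).trans ((congrArg _ h2).trans ?_)
  refine (Category.assoc _ _ _).symm.trans (Eq.trans ?_ (Category.assoc _ _ _))
  exact congrArg (· ≫ (E.e (i + 1)).functor.map (Y.act i)) (E.θ_naturality i (f i)).symm

theorem kills_mapAct (X : D.Rep) (i : ℤ) : Kills (D'.Q i)
    ((D'.N (i + 1)).rightTensorFunctor.map (E.mapAct X i) ≫ E.mapAct X (i + 1)) := by
  have h := (E.kills_iff i _ _ _).1 (X.kills i)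
  have h' := E.θ_naturality (i + 1) (X.act i)
  rw [Functor.map_comp] at h
  unfold mapAct
  rw [Functor.map_comp, Category.assoc, reassoc_of% h']
  exact h

/-- Transport of generators and relations along a compatible family of Morita equivalences. -/
noncomputable def mapRep : D.Rep ⥤ D'.Rep where
  obj X :=
    { obj i := (E.e i).functor.obj (X.obj i)
      act := E.mapAct X
      kills := E.kills_mapAct X }
  map f := ⟨fun i => (E.e i).functor.map (f.1 i), fun i => E.mapAct_comp_map f.1 i (f.2 i)⟩
  map_id _ := Rep.hom_ext fun i => (E.e i).functor.map_id _
  map_comp _ _ := Rep.hom_ext fun i => (E.e i).functor.map_comp _ _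

instance : E.mapRep.Additive where
  map_add := Rep.hom_ext fun i => have := E.additive i; (E.e i).functor.map_add

instance : E.mapRep.Linear k where
  map_smul f c := Rep.hom_ext fun i => have := E.linear i; (E.e i).functor.map_smul c (f.1 i)

instance : E.mapRep.Faithful where
  map_injective h := Rep.hom_ext fun i =>
    (E.e i).functor.map_injective (congrArg (fun φ => φ.1 i) h)

theorem comm_of_mapAct_comp {X Y : D.Rep} (f : ∀ i, X.obj i ⟶ Y.obj i) (i : ℤ)
    (h : E.mapAct X i ≫ (E.e (i + 1)).functor.map (f (i + 1)) =
      (D'.N i).rightTensorFunctor.map ((E.e i).functor.map (f i)) ≫ E.mapAct Y i) :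
    X.act i ≫ f (i + 1) = (D.N i).rightTensorFunctor.map (f i) ≫ Y.act i := by
  apply (E.e (i + 1)).functor.map_injective
  apply (cancel_epi ((E.θ i).hom.app (X.obj i))).1
  rw [Functor.map_comp, Functor.map_comp]
  refine (Category.assoc _ _ _).symm.trans (h.trans ((Category.assoc _ _ _).symm.trans ?_))
  exact (congrArg (· ≫ (E.e (i + 1)).functor.map (Y.act i)) (E.θ_naturality i (f i))).trans
    (Category.assoc _ _ _)

instance : E.mapRep.Full where
  map_surjective {X Y} g := by
    let f (i) : X.obj i ⟶ Y.obj i := (E.e i).functor.preimage (g.1 i)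
    have hf (i) : (E.e i).functor.map (f i) = g.1 i := (E.e i).functor.map_preimage _
    refine ⟨⟨f, fun i => E.comm_of_mapAct_comp f i ?_⟩, Rep.hom_ext hf⟩
    rw [hf, hf]
    exact g.2 i

section EssSurj

variable (Y : D'.Rep)

/-- A family of modules whose image is a given family. -/
noncomputable def preObj (i : ℤ) : ModuleCat.{u} (D.F i).carrierᵐᵒᵖ :=
  (E.e i).functor.objPreimage (Y.obj i)

/-- The image of `preObj` is the given family. -/
noncomputable def preIso (i : ℤ) : (E.e i).functor.obj (E.preObj Y i) ≅ Y.obj i :=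
  (E.e i).functor.objObjPreimageIso (Y.obj i)

/-- The action on `preObj`. -/
noncomputable def preAct (i : ℤ) :
    (D.N i).rightTensorFunctor.obj (E.preObj Y i) ⟶ E.preObj Y (i + 1) :=
  (E.e (i + 1)).functor.preimage ((E.θ i).inv.app (E.preObj Y i) ≫
    (D'.N i).rightTensorFunctor.map (E.preIso Y i).hom ≫ Y.act i ≫ (E.preIso Y (i + 1)).inv)

theorem θ_comp_map_preAct (i : ℤ) :
    (E.θ i).hom.app (E.preObj Y i) ≫ (E.e (i + 1)).functor.map (E.preAct Y i) =
      (D'.N i).rightTensorFunctor.map (E.preIso Y i).hom ≫ Y.act i ≫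
        (E.preIso Y (i + 1)).inv := by
  rw [preAct, Functor.map_preimage]
  exact (E.θ i).hom_inv_id_app_assoc _ _

theorem preAct_relation (i : ℤ) :
    (D'.N (i + 1)).rightTensorFunctor.map ((E.θ i).hom.app (E.preObj Y i)) ≫
      (E.θ (i + 1)).hom.app ((D.N i).rightTensorFunctor.obj (E.preObj Y i)) ≫
        (E.e (i + 1 + 1)).functor.map
          ((D.N (i + 1)).rightTensorFunctor.map (E.preAct Y i) ≫ E.preAct Y (i + 1)) =
      (D'.N (i + 1)).rightTensorFunctor.map
          ((D'.N i).rightTensorFunctor.map (E.preIso Y i).hom) ≫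
        ((D'.N (i + 1)).rightTensorFunctor.map (Y.act i) ≫ Y.act (i + 1)) ≫
          (E.preIso Y (i + 1 + 1)).inv := by
  have h1 := congrArg (D'.N (i + 1)).rightTensorFunctor.map (E.θ_comp_map_preAct Y i)
  rw [Functor.map_comp, Functor.map_comp, Functor.map_comp] at h1
  have h2 := E.θ_comp_map_preAct Y (i + 1)
  have h' := E.θ_naturality (i + 1) (E.preAct Y i)
  have h3 : (D'.N (i + 1)).rightTensorFunctor.map (E.preIso Y (i + 1)).inv ≫
      (D'.N (i + 1)).rightTensorFunctor.map (E.preIso Y (i + 1)).hom = 𝟙 _ := by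
    rw [← Functor.map_comp, Iso.inv_hom_id, CategoryTheory.Functor.map_id]
  rw [Functor.map_comp, ← reassoc_of% h', h2, reassoc_of% h1, reassoc_of% h3]
  simp only [Category.assoc]

theorem kills_preAct (i : ℤ) : Kills (D.Q i)
    ((D.N (i + 1)).rightTensorFunctor.map (E.preAct Y i) ≫ E.preAct Y (i + 1)) := by
  rw [E.kills_iff, preAct_relation]
  intro m q hq
  have h1 := Y.kills i ((E.preIso Y i).hom m) q hq
  rw [← map_insertPure] at h1
  exact (congrArg (E.preIso Y (i + 1 + 1)).inv.hom h1).trans (map_zero _)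

instance : E.mapRep.EssSurj where
  mem_essImage Y := by
    refine ⟨⟨E.preObj Y, E.preAct Y, E.kills_preAct Y⟩, ⟨Rep.isoMk (E.preIso Y) fun i => ?_⟩⟩
    refine (congrArg (· ≫ (E.preIso Y (i + 1)).hom) (E.θ_comp_map_preAct Y i)).trans ?_
    simp only [Category.assoc, Iso.inv_hom_id, Category.comp_id]
    rfl

end EssSurj

instance : E.mapRep.IsEquivalence where

/-- The equivalence of categories of graded modules. -/
noncomputable def grModFunctor : D.GrMod ⥤ D'.GrMod :=
  D.toRep ⋙ E.mapRep ⋙ D'.toRep.inv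

instance : E.grModFunctor.IsEquivalence := by
  unfold grModFunctor; infer_instance

instance : E.grModFunctor.Additive := by
  have : D'.toRep.asEquivalence.functor.Additive := inferInstanceAs D'.toRep.Additive
  have : D'.toRep.inv.Additive := D'.toRep.asEquivalence.inverse_additive
  unfold grModFunctor; infer_instance

instance : E.grModFunctor.Linear k := by
  have : D'.toRep.asEquivalence.functor.Linear k := inferInstanceAs (D'.toRep.Linear k)
  have : D'.toRep.inv.Linear k := D'.toRep.asEquivalence.inverseLinear k
  unfold grModFunctor; infer_instance

end MoritaEquiv

end BimoduleSeq

/-! ### Quotient categories -/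

section Localization

variable {k : Type*} [Field k] {C C' : Type*} [Category* C] [Category* C'] [Abelian C] [Abelian C']
  [Linear k C] [Linear k C'] (P : ObjectProperty C) (P' : ObjectProperty C') [P.IsSerreClass]
  [P'.IsSerreClass]

theorem isoModSerre_inverseImage (F : C ⥤ C') [F.IsEquivalence] (h : P = P'.inverseImage F) :
    P.isoModSerre = P'.isoModSerre.inverseImage F := by
  have : F.PreservesZeroMorphisms := Functor.preservesZeroMorphisms_of_isLeftAdjoint F
  ext X Y f
  have h1 : P (Limits.kernel f) ↔ P' (Limits.kernel (F.map f)) := by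
    rw [h]
    exact P'.prop_iff_of_iso (Limits.PreservesKernel.iso F f)
  have h2 : P (Limits.cokernel f) ↔ P' (Limits.cokernel (F.map f)) := by
    rw [h]
    exact P'.prop_iff_of_iso (Limits.PreservesCokernel.iso F f)
  exact and_congr h1 h2

/-- An equivalence matching two Serre classes induces an equivalence of the quotient categories. -/
theorem linearlyEquivalent_localization (F : C ⥤ C') [F.IsEquivalence] [F.Additive] [F.Linear k]
    (h : P = P'.inverseImage F) :
    LinearlyEquivalent k P.isoModSerre.Localization P'.isoModSerre.Localization := by
  let Φ : LocalizerMorphism P.isoModSerre P'.isoModSerre :=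
    .ofEq (isoModSerre_inverseImage P P' F h)
  have : Φ.functor.IsEquivalence := ‹F.IsEquivalence›
  have : Φ.IsInduced := ⟨(isoModSerre_inverseImage P P' F h).symm⟩
  have : Φ.IsLocalizedEquivalence := Φ.isLocalizedEquivalence_of_isInduced
  let G := Φ.localizedFunctor P.isoModSerre.Q P'.isoModSerre.Q
  let i : F ⋙ P'.isoModSerre.Q ≅ P.isoModSerre.Q ⋙ G := CatCommSq.iso Φ.functor _ _ _
  have : G.IsEquivalence := inferInstance
  have : (F ⋙ P'.isoModSerre.Q).Additive := inferInstance
  have : (F ⋙ P'.isoModSerre.Q).Linear k := inferInstance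
  have hadd : G.Additive := by
    rw [Localization.functor_additive_iff P.isoModSerre.Q P.isoModSerre]
    exact Functor.additive_of_iso i
  have : Localization.Lifting P.isoModSerre.Q P.isoModSerre (F ⋙ P'.isoModSerre.Q) G := ⟨i.symm⟩
  refine ⟨G.asEquivalence, hadd, ?_⟩
  exact (Localization.functor_linear_iff P.isoModSerre.Q P.isoModSerre k
    (F ⋙ P'.isoModSerre.Q) G).1 inferInstance

end Localization

namespace BimoduleSeq

open Bimodule

variable {k : Type u} [Field k] {D D' : BimoduleSeq k}

instance : (rightBounded (D := D)).IsClosedUnderIsomorphisms where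
  of_iso {M M'} e h := by
    obtain ⟨n, hn⟩ := h
    exact ⟨n, fun i hi => (hn i hi).of_iso ((evalFunctor (D.pt i)).mapIso e.symm)⟩

theorem isZero_deg_iff (M : D.GrMod) (i : ℤ) :
    Limits.IsZero (M.deg (D.pt i)) ↔ Limits.IsZero ((D.toRep.obj M).obj i) :=
  ⟨fun h => by
    have : Subsingleton (M.deg (D.pt i)) := ModuleCat.subsingleton_of_isZero h
    exact @ModuleCat.isZero_of_subsingleton _ _ ((D.toRep.obj M).obj i) this,
  fun h => by
    have : Subsingleton ((D.toRep.obj M).obj i) := ModuleCat.subsingleton_of_isZero h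
    exact @ModuleCat.isZero_of_subsingleton _ _ (M.deg (D.pt i)) this⟩

theorem Rep.isZero_iff_of_iso {X Y : D.Rep} (f : X ≅ Y) (i : ℤ) :
    Limits.IsZero (X.obj i) ↔ Limits.IsZero (Y.obj i) :=
  (⟨f.hom.1 i, f.inv.1 i, congrArg (fun g => g.1 i) f.hom_inv_id,
    congrArg (fun g => g.1 i) f.inv_hom_id⟩ : X.obj i ≅ Y.obj i).isZero_iff

namespace MoritaEquiv

variable (E : D.MoritaEquiv D')

theorem rightBounded_grModFunctor :
    rightBounded (D := D) = rightBounded.inverseImage E.grModFunctor := by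
  ext M
  refine exists_congr fun n => forall₂_congr fun i _ => ?_
  have h := Rep.isZero_iff_of_iso
    (D'.toRep.asEquivalence.counitIso.app (E.mapRep.obj (D.toRep.obj M))) i
  refine (isZero_deg_iff M i).trans (Iff.trans ?_ (h.symm.trans (isZero_deg_iff _ i).symm))
  have := E.additive i
  exact ⟨fun h => (E.e i).functor.map_isZero h,
    fun h => ((E.e i).inverse.map_isZero h).of_iso ((E.e i).unitIso.app _)⟩

theorem tors_grModFunctor : tors (D := D) = tors.inverseImage E.grModFunctor := by
  unfold tors
  rw [← ObjectProperty.ind_inverseImage_eq_of_isEquivalence, ← E.rightBounded_grModFunctor]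

end MoritaEquiv

theorem MoritaEquiv.linearlyEquivalent_QGr (E : D.MoritaEquiv D') [D.RightFinite]
    [D'.RightFinite] : LinearlyEquivalent k D.QGr D'.QGr :=
  linearlyEquivalent_localization _ _ E.grModFunctor E.tors_grModFunctor

end BimoduleSeq

/-- `ℙ^{nc}(N)` depends only on the functor `- ⊗_R N`, up to equivalences of its source and
target. -/
theorem Bimodule.Admissible.linearlyEquivalent {k : Type u} [Field k] {R S R' S' : Type u}
    [Ring R] [Algebra k R] [Ring S] [Algebra k S] [Ring R'] [Algebra k R'] [Ring S'] [Algebra k S']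
    {N : Bimodule k R S} (hN : N.Admissible) {N' : Bimodule k R' S'}
    (e : ModuleCat.{u} Rᵐᵒᵖ ≌ ModuleCat.{u} R'ᵐᵒᵖ) (f : ModuleCat.{u} Sᵐᵒᵖ ≌ ModuleCat.{u} S'ᵐᵒᵖ)
    [e.functor.Additive] [f.functor.Additive] [e.functor.Linear k] [f.functor.Linear k]
    (θ : e.functor ⋙ N'.rightTensorFunctor ≅ N.rightTensorFunctor ⋙ f.functor) :
    ∃ h : N'.Admissible, LinearlyEquivalent k (N.Pnc hN) (N'.Pnc h) := by
  have h := hN.of_iso θ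
  have := hN.rightFinite
  have := h.rightFinite
  exact ⟨h, (hN.moritaEquiv θ).linearlyEquivalent_QGr⟩

/-! ### Associativity of tensor products and Morita contexts -/

namespace Bimodule

section

variable {k : Type u} [Field k] {R S T : Type u} [Ring R] [Algebra k R] [Ring S] [Algebra k S]
  [Ring T] [Algebra k T]

section Assoc

variable (N : Bimodule k R S) (L : Bimodule k S T) (M : ModuleCat.{u} Rᵐᵒᵖ)

/-- The map `(M ⊗ N) ⊗ L → M ⊗ (N ⊗ L)`. -/
noncomputable def assocHom : L.rightTensorFunctor.obj (N.rightTensorFunctor.obj M) ⟶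
    (N.tensor L).rightTensorFunctor.obj M :=
  tensorTensorDesc (fun m n l => pure (N.tensor L) M m (tmul n l)) (fun _ _ _ _ => add_pure _ _ _)
    (fun m n n' l => by rw [add_tmul, pure_add]) (fun m n l l' => by rw [tmul_add, pure_add])
    (fun _ _ _ _ => pure_balanced _ _ _)
    (fun m n s l => congrArg (pure _ M m) (tmul_balanced n s l)) (fun _ _ _ _ => rfl)

theorem assocHom_pure (m : M) (n : N.carrier) (l : L.carrier) :
    N.assocHom L M (pure L _ (pure N M m n) l) = pure (N.tensor L) M m (tmul n l) := rfl

/-- The map `M ⊗ (N ⊗ L) → (M ⊗ N) ⊗ L`. -/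
noncomputable def assocInv : (N.tensor L).rightTensorFunctor.obj M ⟶
    L.rightTensorFunctor.obj (N.rightTensorFunctor.obj M) :=
  tensorDesc
    (biadd (fun m x => insertPure N L M m x) (fun _ _ _ => insertPure_add _ _ _)
      (fun _ _ _ => map_add _ _ _))
    (fun _ _ _ => insertPure_op_smul _ _ _)
    (fun _ _ _ => insertPure_smul _ _ _)

theorem assocInv_pure (m : M) (x : (N.tensor L).carrier) :
    N.assocInv L M (pure (N.tensor L) M m x) = insertPure N L M m x := rfl

theorem assocHom_insertPure (m : M) (x : (N.tensor L).carrier) :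
    N.assocHom L M (insertPure N L M m x) = pure (N.tensor L) M m x := by
  induction x using tensor_induction with
  | h0 => rw [pure_zero, map_zero, map_zero]
  | h1 n l => rw [insertPure_tmul, assocHom_pure]
  | h2 x y hx hy => rw [pure_add, map_add, map_add, hx, hy]

end Assoc

/-- Associativity of tensor products: `(- ⊗ N) ⊗ L ≅ - ⊗ (N ⊗ L)`. -/
noncomputable def assocIso (N : Bimodule k R S) (L : Bimodule k S T) :
    N.rightTensorFunctor ⋙ L.rightTensorFunctor ≅ (N.tensor L).rightTensorFunctor :=
  NatIso.ofComponents
    (fun M =>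
      { hom := N.assocHom L M
        inv := N.assocInv L M
        hom_inv_id := tensorTensorHom_ext fun m n l => by
          change N.assocInv L M (N.assocHom L M (pure L _ (pure N M m n) l)) =
            pure L _ (pure N M m n) l
          rw [assocHom_pure, assocInv_pure, insertPure_tmul]
        inv_hom_id := tensorHom_ext fun m x => by
          change N.assocHom L M (N.assocInv L M (pure _ M m x)) = pure _ M m x
          rw [assocInv_pure, assocHom_insertPure] })
    (fun {M M'} f => tensorTensorHom_ext fun m n l => by
      change N.assocHom L M' (pure L _ (pure N M' (f m) n) l) =
        (N.tensor L).rightTensorFunctor.map f (N.assocHom L M (pure L _ (pure N M m n) l))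
      rw [assocHom_pure, assocHom_pure, map_pure])

/-- If `X` and `Y` are bimodules in a Morita context whose pairing `X × Y → R` hits `1`, then
`M ⊗ X ⊗ Y → M` is an isomorphism, with inverse `m ↦ ∑ m ⊗ x_i ⊗ y_i`, where
`∑ ⟨x_i, y_i⟩ = 1`. -/
theorem nonempty_tensor_tensor_iso (X : Bimodule k R S) (Y : Bimodule k S R)
    (μ : X.carrier →+ Y.carrier →+ R) (ν : Y.carrier → X.carrier → S)
    (hb : ∀ x (s : S) y, μ (op s • x) y = μ x (s • y)) (hl : ∀ (r : R) x y, μ (r • x) y = r * μ x y)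
    (hr : ∀ x y (r : R), μ x (op r • y) = μ x y * r)
    (h₁ : ∀ x y x', μ x y • x' = op (ν y x') • x) (h₂ : ∀ y x y', ν y x • y' = op (μ x y') • y)
    {ι : Type*} [Fintype ι] (x : ι → X.carrier) (y : ι → Y.carrier) (h : ∑ i, μ (x i) (y i) = 1) :
    Nonempty (X.rightTensorFunctor ⋙ Y.rightTensorFunctor ≅ 𝟭 (ModuleCat.{u} Rᵐᵒᵖ)) := by
  let α (M : ModuleCat.{u} Rᵐᵒᵖ) : Y.rightTensorFunctor.obj (X.rightTensorFunctor.obj M) ⟶ M :=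
    tensorTensorDesc (fun m x y => op (μ x y) • m) (fun m m' x y => smul_add _ _ _)
      (fun m x x' y => by rw [map_add, AddMonoidHom.add_apply, MulOpposite.op_add, add_smul])
      (fun m x y y' => by rw [map_add, MulOpposite.op_add, add_smul])
      (fun m r x y => by rw [hl, op_mul, mul_smul]) (fun m x s y => by rw [hb])
      (fun m x t y => by rw [← op_unop t, hr, op_mul, mul_smul])
  have hα (M : ModuleCat.{u} Rᵐᵒᵖ) (m : M) (x y) : α M (pure Y _ (pure X M m x) y) = op (μ x y) • m := rfl
  have hβ (M : ModuleCat.{u} Rᵐᵒᵖ) (z) : ∑ i, pure Y _ (pure X M (α M z) (x i)) (y i) = z := by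
    induction z using tensorTensor_induction with
    | h0 => simp only [map_zero, zero_pure, Finset.sum_const_zero]
    | h1 m x' y' =>
      calc ∑ i, pure Y _ (pure X M (α M (pure Y _ (pure X M m x') y')) (x i)) (y i)
          = ∑ i, pure Y _ (pure X M m x') (op (μ (x i) (y i)) • y') :=
            Finset.sum_congr rfl fun i _ => by
              rw [hα, pure_balanced, h₁, ← smul_pure, pure_balanced, h₂]
        _ = pure Y _ (pure X M m x') y' := by
            rw [← pure_sum, ← Finset.sum_smul, ← Finset.op_sum, h, op_one, one_smul]
    | h2 a b ha hb =>
      simp only [add_pure, map_add, Finset.sum_add_distrib]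
      rw [ha, hb]
  have hβ' (M : ModuleCat.{u} Rᵐᵒᵖ) (m : M) :
      α M (∑ i, pure Y _ (pure X M m (x i)) (y i)) = m := by
    rw [map_sum]
    simp only [hα]
    rw [← Finset.sum_smul, ← Finset.op_sum, h, op_one, one_smul]
  have hiso (M) : IsIso (α M) := by
    rw [ConcreteCategory.isIso_iff_bijective]
    exact Function.bijective_iff_has_inverse.2
      ⟨fun m => ∑ i, pure Y _ (pure X M m (x i)) (y i), hβ M, hβ' M⟩
  exact ⟨NatIso.ofComponents (fun M => @asIso _ _ _ _ (α M) (hiso M)) fun {M M'} f =>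
    tensorTensorHom_ext fun m x y => by
      change α M' (pure Y _ (pure X M' (f m) x) y) = f (α M (pure Y _ (pure X M m x) y))
      rw [hα, hα]
      exact (f.hom.map_smul (op (μ x y)) m).symm⟩

end

end Bimodule

/-! ### Bimodules for which tensoring with left modules is an equivalence -/

namespace Bimodule

section

variable {k : Type u} [Field k] {R S : Type u} [Ring R] [Algebra k R] [Ring S] [Algebra k S]

section LeftTensor

variable (P : Bimodule k R S) (M : ModuleCat.{u} S)

/-- The pure tensor `p ⊗ m` in `P ⊗_S M`, for a left `S`-module `M`. -/
noncomputable def leftPure (p : P.carrier) (m : M) : P.leftTensorFunctor.obj M :=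
  tmul (N := ofLeft k M) p m

variable {P M}

theorem add_leftPure (p p' : P.carrier) (m : M) :
    leftPure P M (p + p') m = leftPure P M p m + leftPure P M p' m :=
  add_tmul (N := ofLeft k M) p p' m

theorem leftPure_balanced (p : P.carrier) (s : S) (m : M) :
    leftPure P M (op s • p) m = leftPure P M p (s • m) :=
  tmul_balanced (N := ofLeft k M) p s m

theorem leftPure_induction {q : P.leftTensorFunctor.obj M → Prop} (h0 : q 0)
    (h1 : ∀ p m, q (leftPure P M p m)) (h2 : ∀ x y, q x → q y → q (x + y))
    (x : P.leftTensorFunctor.obj M) : q x :=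
  tensor_induction (M := P) (N := ofLeft k M) (p := q) h0 h1 h2 x

theorem leftTensorHom_ext {Z : ModuleCat.{u} R} {f g : P.leftTensorFunctor.obj M ⟶ Z}
    (h : ∀ p m, f (leftPure P M p m) = g (leftPure P M p m)) : f = g := by
  ext x
  induction x using leftPure_induction with
  | h0 => rw [map_zero, map_zero]
  | h1 p m => exact h p m
  | h2 x y hx hy => rw [map_add, map_add, hx, hy]

variable (P)

/-- The map `P ⊗_S S → P` of abelian groups. -/
noncomputable def leftTensorUnitAdd : P.leftTensorFunctor.obj (ModuleCat.of S S) →+ P.carrier :=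
  liftAdd (M := P) (N := ofLeft k (ModuleCat.of S S))
    (biadd (fun p (s : S) => op s • p) (fun _ _ _ => smul_add _ _ _)
      (fun p (s s' : S) => add_smul (op s) (op s') p))
    (fun p s (s' : S) => (mul_smul (op s') (op s) p).symm)

/-- The map `P ⊗_S S → P` of left modules. -/
noncomputable def leftTensorUnitHom :
    P.leftTensorFunctor.obj (ModuleCat.of S S) ⟶ ModuleCat.of R P.carrier :=
  ModuleCat.ofHom
    { P.leftTensorUnitAdd with
      map_smul' := fun r (x : P.leftTensorFunctor.obj (ModuleCat.of S S)) => by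
        change P.leftTensorUnitAdd (r • x) = r • P.leftTensorUnitAdd x
        induction x using leftPure_induction with
        | h0 => rw [smul_zero, map_zero, smul_zero]
        | h1 p s => exact (smul_comm r (op (s : S)) p).symm
        | h2 x y hx hy => rw [smul_add, map_add, map_add, hx, hy, smul_add] }

/-- The isomorphism `P ⊗_S S ≅ P` of left modules. -/
noncomputable def leftTensorUnitIso :
    P.leftTensorFunctor.obj (ModuleCat.of S S) ≅ ModuleCat.of R P.carrier where
  hom := P.leftTensorUnitHom
  inv := ModuleCat.ofHom
    { toFun := fun p => leftPure P (ModuleCat.of S S) p (1 : S)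
      map_add' := fun p p' => add_leftPure _ _ _
      map_smul' := fun r p => rfl }
  hom_inv_id := leftTensorHom_ext fun p (s : S) => by
    change leftPure P (ModuleCat.of S S) (op s • p) (1 : S) = leftPure P (ModuleCat.of S S) p s
    rw [leftPure_balanced]
    exact congrArg (fun a : S => leftPure P (ModuleCat.of S S) p a) (mul_one s)
  inv_hom_id := by
    ext p
    exact one_smul Sᵐᵒᵖ p

end LeftTensor

/-- If `P ⊗_S -` is an equivalence, every left linear endomorphism of `P` is given by right
multiplication by a unique element of `S`. -/
theorem existsUnique_op_smul (P : Bimodule k R S) [P.leftTensorFunctor.IsEquivalence]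
    (f : P.carrier →ₗ[R] P.carrier) : ∃! s : S, ∀ p, f p = op s • p := by
  let mulRight (s : S) : ModuleCat.of S S ⟶ ModuleCat.of S S :=
    ModuleCat.ofHom (LinearMap.toSpanSingleton S S s)
  have key (s : S) (p : P.carrier) :
      P.leftTensorUnitIso.hom (P.leftTensorFunctor.map (mulRight s) (P.leftTensorUnitIso.inv p)) =
        op s • p := by
    change op (1 * s) • p = op s • p
    rw [one_mul]
  obtain ⟨g, hg⟩ := P.leftTensorFunctor.map_surjective
    (P.leftTensorUnitIso.hom ≫ ModuleCat.ofHom f ≫ P.leftTensorUnitIso.inv)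
  have hg' : g = mulRight (g (1 : S) : S) := by
    ext
    exact (one_smul S _).symm
  refine ⟨(g (1 : S) : S), fun p => ?_, fun s hs => ?_⟩
  · rw [← key, ← hg', hg]
    change _ = P.leftTensorUnitIso.hom (P.leftTensorUnitIso.inv
      (f (P.leftTensorUnitIso.hom (P.leftTensorUnitIso.inv p))))
    rw [Iso.inv_hom_id_apply, Iso.inv_hom_id_apply]
  · have : mulRight s = g := by
      apply P.leftTensorFunctor.map_injective
      rw [hg, ← cancel_epi P.leftTensorUnitIso.inv, ← cancel_mono P.leftTensorUnitIso.hom]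
      ext p
      refine (key s p).trans ((hs p).symm.trans ?_)
      change _ = P.leftTensorUnitIso.hom (P.leftTensorUnitIso.inv
        (f (P.leftTensorUnitIso.hom (P.leftTensorUnitIso.inv p))))
      rw [Iso.inv_hom_id_apply, Iso.inv_hom_id_apply]
    rw [← this]
    exact (one_smul S s).symm

/-- If `P ⊗_S -` is an equivalence, `P` is finitely generated projective as a left module. -/
theorem exists_left_dual_basis (P : Bimodule k R S) [P.leftTensorFunctor.IsEquivalence] :
    ∃ (n : ℕ) (x : Fin n → P.carrier) (f : Fin n → P.carrier →ₗ[R] R),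
      ∀ p, ∑ i, f i p • x i = p := by
  have : Module.Finite R (P.leftTensorFunctor.obj (ModuleCat.of S S)) :=
    ModuleCat.finite_obj_of_equivalence P.leftTensorFunctor.asEquivalence (ModuleCat.of S S)
  have : Module.Projective R (P.leftTensorFunctor.obj (ModuleCat.of S S)) :=
    ModuleCat.projective_obj_of_equivalence P.leftTensorFunctor.asEquivalence (ModuleCat.of S S)
  have : Module.Finite R P.carrier := .equiv P.leftTensorUnitIso.toLinearEquiv
  have : Module.Projective R P.carrier := .of_equiv P.leftTensorUnitIso.toLinearEquiv
  exact exists_dual_basis R P.carrier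

/-- If `P ⊗_S -` is an equivalence, `P` is a generator: if `P ⊗_S M ≅ R`, then `1` is the
image of some `∑ p_i ⊗ m_i`, and `p ↦ p ⊗ m_i` is a linear form on `P`. -/
theorem exists_sum_apply_eq_one (P : Bimodule k R S) [P.leftTensorFunctor.IsEquivalence] :
    ∃ (n : ℕ) (x : Fin n → P.carrier) (f : Fin n → P.carrier →ₗ[R] R), ∑ i, f i (x i) = 1 := by
  let M := P.leftTensorFunctor.objPreimage (ModuleCat.of R R)
  let ε : P.leftTensorFunctor.obj M ≅ ModuleCat.of R R := P.leftTensorFunctor.objObjPreimageIso _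
  have key (z : P.leftTensorFunctor.obj M) :
      ∃ (n : ℕ) (x : Fin n → P.carrier) (f : Fin n → P.carrier →ₗ[R] R),
        ∑ i, f i (x i) = (ε.hom z : R) := by
    induction z using leftPure_induction with
    | h0 => exact ⟨0, Fin.elim0, Fin.elim0, (map_zero ε.hom.hom).symm⟩
    | h1 p m =>
      refine ⟨1, fun _ => p, fun _ =>
        { toFun := fun p => (ε.hom (leftPure P M p m) : R)
          map_add' := fun p p' => by rw [add_leftPure]; exact map_add ε.hom.hom _ _
          map_smul' := fun r p => ε.hom.hom.map_smul r (leftPure P M p m) }, ?_⟩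
      exact Fin.sum_univ_one _
    | h2 a b ha hb =>
      obtain ⟨n, x, f, h⟩ := ha
      obtain ⟨n', x', f', h'⟩ := hb
      refine ⟨n + n', Fin.append x x', Fin.append f f', ?_⟩
      rw [Fin.sum_univ_add]
      simp only [Fin.append_left, Fin.append_right, h, h']
      exact (map_add ε.hom.hom a b).symm
  obtain ⟨n, x, f, h⟩ := key (ε.inv (1 : R))
  exact ⟨n, x, f, h.trans (ε.inv_hom_id_apply (1 : R))⟩

/-- If `P ⊗_S -` is an equivalence, then `- ⊗ ^*P` and `- ⊗ P` are inverse equivalences. -/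
theorem nonempty_leftDual_tensor_isos (P : Bimodule k R S) [P.leftTensorFunctor.IsEquivalence] :
    Nonempty (P.leftDual.rightTensorFunctor ⋙ P.rightTensorFunctor ≅ 𝟭 _) ∧
      Nonempty (P.rightTensorFunctor ⋙ P.leftDual.rightTensorFunctor ≅ 𝟭 _) := by
  choose ρ hρ hρ' using fun f => P.existsUnique_op_smul f
  have eq_of {s s' : S} (h : ∀ p : P.carrier, op s • p = op s' • p) : s = s' := by
    let f : P.carrier →ₗ[R] P.carrier :=
      { toFun := fun p => op s • p
        map_add' := smul_add _
        map_smul' := fun r p => (smul_comm r (op s) p).symm }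
    exact (hρ' f s fun _ => rfl).trans (hρ' f s' h).symm
  -- the Morita context: `ν p f = f(p)`, and `μ f p ∈ S` is defined by `x · μ f p = f(x) p`
  let φ (f : P.leftDual.carrier) (p : P.carrier) : P.carrier →ₗ[R] P.carrier :=
    (leftEval f).smulRight p
  have hφ (f p x) : op (ρ (φ f p)) • x = leftEval f x • p := (hρ (φ f p) x).symm
  let μ : P.leftDual.carrier →+ P.carrier →+ S :=
    biadd (fun f p => ρ (φ f p))
      (fun f f' p => eq_of fun x => by
        rw [hφ, MulOpposite.op_add, add_smul, hφ, hφ, ← add_smul]; rfl)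
      (fun f p p' => eq_of fun x => by
        rw [hφ, MulOpposite.op_add, add_smul, hφ, hφ, smul_add])
  let ν : P.carrier →+ P.leftDual.carrier →+ R :=
    biadd (fun p f => leftEval f p) (fun _ _ _ => map_add _ _ _) (fun _ _ _ => rfl)
  have hμ (f p) (x : P.carrier) : op (μ f p) • x = leftEval f x • p := hφ f p x
  have h₁ (f p f') : μ f p • f' = op (ν p f') • f := LinearMap.ext fun x => by
    change leftEval f' (op (μ f p) • x) = leftEval f x * leftEval f' p
    rw [hμ, map_smul, smul_eq_mul]
  have h₂ (p f p') : ν p f • p' = op (μ f p') • p := (hμ f p' p).symm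
  constructor
  · obtain ⟨n, x, f, h⟩ := P.exists_left_dual_basis
    refine nonempty_tensor_tensor_iso P.leftDual P μ (fun p f => ν p f) ?_ ?_ ?_ h₁ h₂ f x ?_
    · intro f r p
      refine eq_of fun x => ?_
      rw [hμ, hμ]
      exact mul_smul (leftEval f x) r p
    · intro s f p
      refine eq_of fun x => ?_
      rw [hμ, op_mul, mul_smul, hμ]
      rfl
    · intro f p s
      refine eq_of fun x => ?_
      rw [hμ, op_mul, mul_smul, hμ, smul_comm]
    · refine eq_of fun p => ?_
      rw [Finset.op_sum, Finset.sum_smul, op_one, one_smul]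
      exact (Finset.sum_congr rfl fun i _ => hμ (f i) (x i) p).trans (h p)
  · obtain ⟨n, x, f, h⟩ := P.exists_sum_apply_eq_one
    exact nonempty_tensor_tensor_iso P P.leftDual ν (fun f p => μ f p) (fun _ _ _ => rfl)
      (fun r p f => (leftEval f).map_smul r p) (fun _ _ _ => rfl) h₂ h₁ x f h

end

end Bimodule

/-! ### Invertible bimodules and twists -/

namespace Bimodule

section

variable {k : Type u} [Field k] {R S R' S' : Type u} [Ring R] [Algebra k R] [Ring S] [Algebra k S]
  [Ring R'] [Algebra k R'] [Ring S'] [Algebra k S']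

/-- Tensoring on the right with an invertible bimodule: `- ⊗ (N ⊗ L)` is `- ⊗ N` followed by the
equivalence `- ⊗ L`. -/
theorem Admissible.linearlyEquivalent_tensor_right {N : Bimodule k R S} (hN : N.Admissible)
    (L : Bimodule k S S') [L.rightTensorFunctor.IsEquivalence] :
    ∃ h : (N.tensor L).Admissible, LinearlyEquivalent k (N.Pnc hN) ((N.tensor L).Pnc h) := by
  let f := L.rightTensorFunctor.asEquivalence
  have : f.functor.Additive := inferInstanceAs L.rightTensorFunctor.Additive
  have : f.functor.Linear k := inferInstanceAs (L.rightTensorFunctor.Linear k)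
  have : (CategoryTheory.Equivalence.refl (C := ModuleCat.{u} Rᵐᵒᵖ)).functor.Additive :=
    inferInstanceAs (𝟭 _).Additive
  have : (CategoryTheory.Equivalence.refl (C := ModuleCat.{u} Rᵐᵒᵖ)).functor.Linear k :=
    inferInstanceAs ((𝟭 _).Linear k)
  exact hN.linearlyEquivalent .refl f
    ((N.tensor L).rightTensorFunctor.leftUnitor ≪≫ (assocIso N L).symm)

/-- Tensoring on the left with an invertible bimodule: `- ⊗ N` is the equivalence `- ⊗ ^*P` followed by
`- ⊗ (P ⊗ N)`. -/
theorem Admissible.linearlyEquivalent_tensor_left {N : Bimodule k R S} (hN : N.Admissible)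
    (P : Bimodule k R' R) [P.leftTensorFunctor.IsEquivalence] :
    ∃ h : (P.tensor N).Admissible, LinearlyEquivalent k (N.Pnc hN) ((P.tensor N).Pnc h) := by
  obtain ⟨⟨α⟩, ⟨β⟩⟩ := P.nonempty_leftDual_tensor_isos
  let e : ModuleCat.{u} Rᵐᵒᵖ ≌ ModuleCat.{u} R'ᵐᵒᵖ :=
    .mk P.leftDual.rightTensorFunctor P.rightTensorFunctor α.symm β
  have : e.functor.Additive := inferInstanceAs P.leftDual.rightTensorFunctor.Additive
  have : e.functor.Linear k := inferInstanceAs (P.leftDual.rightTensorFunctor.Linear k)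
  have : (CategoryTheory.Equivalence.refl (C := ModuleCat.{u} Sᵐᵒᵖ)).functor.Additive :=
    inferInstanceAs (𝟭 _).Additive
  have : (CategoryTheory.Equivalence.refl (C := ModuleCat.{u} Sᵐᵒᵖ)).functor.Linear k :=
    inferInstanceAs ((𝟭 _).Linear k)
  exact hN.linearlyEquivalent e .refl
    (Functor.isoWhiskerLeft P.leftDual.rightTensorFunctor (assocIso P N).symm ≪≫
      (Functor.associator _ _ _).symm ≪≫ Functor.isoWhiskerRight α N.rightTensorFunctor ≪≫
      N.rightTensorFunctor.leftUnitor ≪≫ N.rightTensorFunctor.rightUnitor.symm)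

/-- Restriction of scalars along `φ⁻¹`, as an equivalence between categories of right modules. -/
noncomputable def twistEquivalence (φ : R ≃ₐ[k] R') :
    ModuleCat.{u} Rᵐᵒᵖ ≌ ModuleCat.{u} R'ᵐᵒᵖ :=
  ModuleCat.restrictScalarsEquivalenceOfRingEquiv (RingEquiv.op φ.symm.toRingEquiv)

instance (φ : R ≃ₐ[k] R') : (twistEquivalence φ).functor.Additive where
  map_add := rfl

instance (φ : R ≃ₐ[k] R') : (twistEquivalence φ).functor.Linear k where
  map_smul {X Y} f c := by
    ext x
    change algebraMap k Rᵐᵒᵖ c • f.hom x = op (φ.symm (algebraMap k R' c)) • f.hom x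
    rw [AlgEquiv.commutes]
    rfl

section Twist

variable (N : Bimodule k R S) (φ₁ : R ≃ₐ[k] R') (φ₂ : S ≃ₐ[k] S') (M : ModuleCat.{u} Rᵐᵒᵖ)

/-- The map `M ⊗_{R'} N' → M ⊗_R N`, where `N'` is the twist of `N`. -/
noncomputable def twistHom :
    (N.twist φ₁ φ₂).rightTensorFunctor.obj ((twistEquivalence φ₁).functor.obj M) ⟶
      (twistEquivalence φ₂).functor.obj (N.rightTensorFunctor.obj M) :=
  tensorDesc (N := N.twist φ₁ φ₂) (M := (twistEquivalence φ₁).functor.obj M)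
    (Z := (twistEquivalence φ₂).functor.obj (N.rightTensorFunctor.obj M))
    (biadd (A := M) (B := N.carrier) (C := N.rightTensorFunctor.obj M) (fun m n => pure N M m n)
      (fun _ _ _ => add_pure _ _ _) (fun _ _ _ => pure_add _ _ _))
    (fun (m : M) r (n : N.carrier) => pure_balanced (N := N) (M := M) m (φ₁.symm r) n)
    (fun _ _ _ => rfl)

/-- The map `M ⊗_R N → M ⊗_{R'} N'` of abelian groups. -/
noncomputable def twistInv : N.rightTensorFunctor.obj M →+
    (N.twist φ₁ φ₂).rightTensorFunctor.obj ((twistEquivalence φ₁).functor.obj M) :=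
  tensorLift
    (biadd
      (fun (m : M) (n : N.carrier) =>
        pure (N.twist φ₁ φ₂) ((twistEquivalence φ₁).functor.obj M) m n)
      (fun _ _ _ => add_pure _ _ _) (fun _ _ _ => pure_add _ _ _))
    (fun m r n => by
      have h := pure_balanced (N := N.twist φ₁ φ₂) (M := (twistEquivalence φ₁).functor.obj M) m
        (φ₁ r) n
      have h1 : (op (φ₁ r) • (show (twistEquivalence φ₁).functor.obj M from m) :
          (twistEquivalence φ₁).functor.obj M) = op r • m :=
        congrArg (fun a => op a • m) (φ₁.symm_apply_apply r)
      have h2 : (φ₁ r • (show (N.twist φ₁ φ₂).carrier from n) : (N.twist φ₁ φ₂).carrier) = r • n :=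
        congrArg (fun a => a • n) (φ₁.symm_apply_apply r)
      exact ((congrArg (fun m => pure (N.twist φ₁ φ₂) ((twistEquivalence φ₁).functor.obj M) m n)
        h1).symm.trans h).trans (congrArg (pure (N.twist φ₁ φ₂) _ _) h2))

theorem twistHom_twistInv (x : N.rightTensorFunctor.obj M) :
    N.twistHom φ₁ φ₂ M (N.twistInv φ₁ φ₂ M x) = x := by
  induction x using pure_induction with
  | h0 => rw [map_zero, map_zero]; rfl
  | h1 m n => rfl
  | h2 x y hx hy => rw [map_add, map_add, hx, hy]; rfl

theorem twistInv_twistHom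
    (x : (N.twist φ₁ φ₂).rightTensorFunctor.obj ((twistEquivalence φ₁).functor.obj M)) :
    N.twistInv φ₁ φ₂ M (N.twistHom φ₁ φ₂ M x) = x := by
  induction x using pure_induction with
  | h0 => rw [map_zero]; exact map_zero _
  | h1 m n => rfl
  | h2 x y hx hy => rw [map_add]; exact (map_add _ _ _).trans (congrArg₂ (· + ·) hx hy)

theorem isIso_twistHom : IsIso (N.twistHom φ₁ φ₂ M) := by
  rw [ConcreteCategory.isIso_iff_bijective]
  exact Function.bijective_iff_has_inverse.2
    ⟨N.twistInv φ₁ φ₂ M, N.twistInv_twistHom φ₁ φ₂ M, N.twistHom_twistInv φ₁ φ₂ M⟩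

/-- Twisting a bimodule amounts to restricting scalars before and after tensoring with it. -/
noncomputable def twistIso :
    (twistEquivalence φ₁).functor ⋙ (N.twist φ₁ φ₂).rightTensorFunctor ≅
      N.rightTensorFunctor ⋙ (twistEquivalence φ₂).functor :=
  NatIso.ofComponents (fun M => @asIso _ _ _ _ (N.twistHom φ₁ φ₂ M) (N.isIso_twistHom φ₁ φ₂ M))
    fun _ => tensorHom_ext fun _ _ => rfl

end Twist

end

end Bimodule

end NCP1

theorem proposition2p5 (k : Type u) [Field k] :
    (∀ (R S S' : Type u) [Ring R] [Algebra k R] [IsNoetherianRing R] [IsNoetherianRing Rᵐᵒᵖ]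
        [Ring S] [Algebra k S] [IsNoetherianRing S] [IsNoetherianRing Sᵐᵒᵖ]
        [Ring S'] [Algebra k S'] [IsNoetherianRing S'] [IsNoetherianRing S'ᵐᵒᵖ]
        (N : NCP1.Bimodule k R S) (hN : N.Admissible)
        (L : NCP1.Bimodule k S S') (_ : L.rightTensorFunctor.IsEquivalence),
        ∃ h : (N.tensor L).Admissible,
          NCP1.LinearlyEquivalent k (N.Pnc hN) ((N.tensor L).Pnc h)) ∧
    (∀ (R R' S : Type u) [Ring R] [Algebra k R] [IsNoetherianRing R] [IsNoetherianRing Rᵐᵒᵖ]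
        [Ring R'] [Algebra k R'] [IsNoetherianRing R'] [IsNoetherianRing R'ᵐᵒᵖ]
        [Ring S] [Algebra k S] [IsNoetherianRing S] [IsNoetherianRing Sᵐᵒᵖ]
        (N : NCP1.Bimodule k R S) (hN : N.Admissible)
        (P : NCP1.Bimodule k R' R) (_ : P.leftTensorFunctor.IsEquivalence),
        ∃ h : (P.tensor N).Admissible,
          NCP1.LinearlyEquivalent k (N.Pnc hN) ((P.tensor N).Pnc h)) ∧
    (∀ (R R' S S' : Type u) [DivisionRing R] [Algebra k R] [Module.Finite k R]
        [DivisionRing S] [Algebra k S] [Module.Finite k S]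
        [Ring R'] [Algebra k R'] [Ring S'] [Algebra k S']
        (N : NCP1.Bimodule k R S) (hN : N.Admissible) (φ₁ : R ≃ₐ[k] R') (φ₂ : S ≃ₐ[k] S'),
        ∃ h : (N.twist φ₁ φ₂).Admissible,
          NCP1.LinearlyEquivalent k (N.Pnc hN) ((N.twist φ₁ φ₂).Pnc h)) := by
  refine ⟨fun R S S' _ _ _ _ _ _ _ _ _ _ _ _ N hN L _ => hN.linearlyEquivalent_tensor_right L,
    fun R R' S _ _ _ _ _ _ _ _ _ _ _ _ N hN P _ => hN.linearlyEquivalent_tensor_left P,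
    fun R R' S S' _ _ _ _ _ _ _ _ _ _ N hN φ₁ φ₂ => ?_⟩
  exact hN.linearlyEquivalent _ _ (N.twistIso φ₁ φ₂)
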